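/- Let $(M,g)$ be a connected smooth Riemannian $n$-manifold (not necessarily compact) with Levi-Civita connection $\nabla$, Riemann tensor $R$ and Ricci tensor $\mathrm{Ric}$. A $(p,q)$ double form on $M$ is a smooth covariant tensor field $\omega(Y_1,\dots,Y_p;Z_1,\dots,Z_q)$ that is alternating in the $Y$'s and alternating in the $Z$'s. A $(p,p)$ double form is symmetric if $\omega^t=\omega$, where $\omega^t(Y;Z)=\omega(Z;Y)$. Put $$(D\omega)(Y_0,\dots,Y_p;Z)=\sum_{i=0}^p(-1)^i(\nabla_{Y_i}\omega)(Y_0,\dots,\widehat{Y_i},\dots,Y_p;Z),\qquad (\delta\omega)(Y_1,\dots,Y_{p-1};Z)=-\sum_{i=1}^n(\nabla_{e_i}\omega)(e_i,Y_1,\dots,Y_{p-1};Z)$$ for any orthonormal frame $(e_i)$, and let $\Delta=D\delta+\delta D$ be the Hodge-de Rham Laplacian on double forms. Assume that $p=1$, or $2\le p\le n-2$, or $(n,p)=(3,2)$. Then $\Delta$ maps every symmetric $(p,p)$ double form on $M$ to a symmetric $(p,p)$ double form if and only if one of the following conditions holds: 1. $p=1$ and $(M,g)$ is Einstein, i.e.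 $\mathrm{Ric}=c\,g$ for some constant $c\in\mathbb R$; 2. $n=2p$ and $(M,g)$ is conformally flat, i.e. its Weyl tensor (the trace-free $(2,2)$ component of $R$ in the orthogonal decomposition $R=W+g\,\omega_1+g^2\omega_0$ of double forms) vanishes identically; equivalently, at every point $R$ is the exterior (Kulkarni-Nomizu) product of $g$ with a symmetric bilinear form (this is automatic if $n=2$); 3. $p>1$, $n\neq 2p$ and $(M,g)$ has constant sectional curvature. -/

import Mathlib

open scoped Manifold ContDiff

noncomputable section

namespace DoubleForms

/-- The model space `ℝⁿ`. -/
abbrev Model (n : ℕ) : Type := EuclideanSpace ℝ (Fin n)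

/-! ### Tensor calculus on `ℝⁿ` for a metric `G` given in coordinates -/

/-- A field on `ℝⁿ` of functions of `p + q` vectors (coordinate expression of a `(p,q)` double
form); the first `p` and the last `q` vectors are grouped. -/
abbrev LocalForm (n p q : ℕ) : Type :=
  Model n → (Fin p → Model n) → (Fin q → Model n) → ℝ

/-- A field of bilinear forms on `ℝⁿ` (coordinate expression of a Riemannian metric). -/
abbrev LocalMetric (n : ℕ) : Type := Model n → Model n →L[ℝ] Model n →L[ℝ] ℝ

/-- The `a`-th vector of the coordinate frame. -/
def frame {n : ℕ} (a : Fin n) : Model n := EuclideanSpace.single a 1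

/-- The metric dual (`♯`) of the `a`-th coordinate covector: the vector with components
`(g^{ab})_b`. -/
def dualFrame {n : ℕ} (G : LocalMetric n) (y : Model n) (a : Fin n) : Model n :=
  (G y).inverse (EuclideanSpace.proj a)

/-- The Christoffel map of the Levi-Civita connection, `Γ(v,w) = ∇_v w` for constant `v`, `w`:
`2 G(Γ(v,w), z) = (∂_v G)(w,z) + (∂_w G)(v,z) - (∂_z G)(v,w)` for all `z`. -/
def christoffel {n : ℕ} (G : LocalMetric n) (y v w : Model n) : Model n :=
  (G y).inverse ((1 / 2 : ℝ) •
    (fderiv ℝ G y v w + fderiv ℝ G y w v - ((fderiv ℝ G y).flip v).flip w))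

/-- The curvature `R(v,w)z = ∇_v ∇_w z - ∇_w ∇_v z - ∇_[v,w] z` in coordinates. -/
def localCurvature {n : ℕ} (G : LocalMetric n) (y v w z : Model n) : Model n :=
  fderiv ℝ (fun y' => christoffel G y' w z) y v - fderiv ℝ (fun y' => christoffel G y' v z) y w
    + christoffel G y v (christoffel G y w z) - christoffel G y w (christoffel G y v z)

/-- The covariant derivative `(∇_v θ)(Y; Z)`, extended to tensors by the Leibniz rule. -/
def covDeriv {n p q : ℕ} (G : LocalMetric n) (θ : LocalForm n p q) (y v : Model n)
    (Y : Fin p → Model n) (Z : Fin q → Model n) : ℝ :=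
  fderiv ℝ (fun y' => θ y' Y Z) y v
    - ∑ i, θ y (Function.update Y i (christoffel G y v (Y i))) Z
    - ∑ j, θ y Y (Function.update Z j (christoffel G y v (Z j)))

/-- `(Dθ)(Y₀,…,Y_p; Z) = ∑ᵢ (-1)ⁱ (∇_{Yᵢ} θ)(Y₀,…,Ŷᵢ,…,Y_p; Z)`. -/
def localD {n p q : ℕ} (G : LocalMetric n) (θ : LocalForm n p q) : LocalForm n (p + 1) q :=
  fun y Y Z => ∑ i : Fin (p + 1), (-1 : ℝ) ^ (i : ℕ) * covDeriv G θ y (Y i) (i.removeNth Y) Z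

/-- `(δθ)(Y; Z) = - tr_g (∇_· θ)(·, Y; Z)`. -/
def localDelta {n p q : ℕ} (G : LocalMetric n) (θ : LocalForm n (p + 1) q) : LocalForm n p q :=
  fun y Y Z => - ∑ a : Fin n, covDeriv G θ y (frame a) (Fin.cons (dualFrame G y a) Y) Z

/-- The Hodge-de Rham Laplacian `Δ = D δ + δ D` on `(p,q)` double forms (`δ = 0` if `p = 0`). -/
def localLaplacian {n q : ℕ} (G : LocalMetric n) :
    {p : ℕ} → LocalForm n p q → LocalForm n p q
  | 0, θ => localDelta G (localD G θ)
  | _ + 1, θ => localD G (localDelta G θ) + localDelta G (localD G θ)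

/-! ### Riemannian manifolds

`TangentSpace 𝓘(ℝ, Model n) x` is, by Mathlib's definition, a copy of `Model n`, a vector being
identified with its components in the preferred chart `extChartAt 𝓘(ℝ, Model n) x` at `x`. So a
tensor at `x` is given by its components in that chart. -/

section Manifold

variable {n : ℕ} {M : Type*} [TopologicalSpace M] [ChartedSpace (Model n) M]

/-- The differential at `y` of the inverse of the preferred chart at `x₀`. -/
def chartFrame (x₀ : M) (y : Model n) : Model n →L[ℝ]
    TangentSpace 𝓘(ℝ, Model n) ((extChartAt 𝓘(ℝ, Model n) x₀).symm y) :=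
  mfderiv 𝓘(ℝ, Model n) 𝓘(ℝ, Model n) (extChartAt 𝓘(ℝ, Model n) x₀).symm y

/-- A `(p,q)` double form on a vector space: alternating in the first `p` and in the last `q`
arguments. -/
abbrev DoubleForm (p q : ℕ) (V : Type*) [AddCommGroup V] [Module ℝ V] : Type _ :=
  V [⋀^Fin p]→ₗ[ℝ] (V [⋀^Fin q]→ₗ[ℝ] ℝ)

/-- The coordinate expression, in the preferred chart at `x₀`, of a field of double forms. -/
def inChart {p q : ℕ} (θ : ∀ x : M, DoubleForm p q (TangentSpace 𝓘(ℝ, Model n) x)) (x₀ : M) :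
    LocalForm n p q :=
  fun y Y Z => θ ((extChartAt 𝓘(ℝ, Model n) x₀).symm y)
    (fun i => chartFrame x₀ y (Y i)) (fun j => chartFrame x₀ y (Z j))

/-- A field of double forms is smooth if its components in charts are. -/
def IsSmooth {p q : ℕ} (θ : ∀ x : M, DoubleForm p q (TangentSpace 𝓘(ℝ, Model n) x)) : Prop :=
  ∀ (x₀ : M) (Y : Fin p → Model n) (Z : Fin q → Model n),
    ContDiffOn ℝ ∞ (fun y => inChart θ x₀ y Y Z) (extChartAt 𝓘(ℝ, Model n) x₀).target

/-- The transpose of a function of two groups of vectors. -/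
def transpose {p q : ℕ} {V : Type*} (w : (Fin p → V) → (Fin q → V) → ℝ) :
    (Fin q → V) → (Fin p → V) → ℝ :=
  fun Z Y => w Y Z

variable [IsManifold 𝓘(ℝ, Model n) ∞ M]

/-- A smooth Riemannian metric on the smooth `n`-manifold `M`. -/
abbrev Metric (n : ℕ) (M : Type*) [TopologicalSpace M] [ChartedSpace (Model n) M]
    [IsManifold 𝓘(ℝ, Model n) ∞ M] : Type _ :=
  Bundle.ContMDiffRiemannianMetric 𝓘(ℝ, Model n) ∞ (Model n)
    (fun x : M => TangentSpace 𝓘(ℝ, Model n) x)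

/-- The coordinate expression of the metric in the preferred chart at `x₀`. -/
def chartMetric (g : Metric n M) (x₀ : M) : LocalMetric n :=
  fun y => (ContinuousLinearMap.precomp ℝ (chartFrame x₀ y)).comp
    ((g.inner ((extChartAt 𝓘(ℝ, Model n) x₀).symm y)).comp (chartFrame x₀ y))

theorem chartMetric_apply (g : Metric n M) (x₀ : M) (y v w : Model n) :
    chartMetric g x₀ y v w = g.inner ((extChartAt 𝓘(ℝ, Model n) x₀).symm y)
      (chartFrame x₀ y v) (chartFrame x₀ y w) :=
  rfl

/-- The Hodge-de Rham Laplacian `Δ θ` of a field of double forms, at the point `x`. -/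
def laplacian {p q : ℕ} (g : Metric n M)
    (θ : ∀ x : M, DoubleForm p q (TangentSpace 𝓘(ℝ, Model n) x)) (x : M) :
    (Fin p → TangentSpace 𝓘(ℝ, Model n) x) → (Fin q → TangentSpace 𝓘(ℝ, Model n) x) → ℝ :=
  localLaplacian (chartMetric g x) (inChart θ x) (extChartAt 𝓘(ℝ, Model n) x x)

/-- `Δ` sends smooth symmetric `(p,p)` double forms on `M` to symmetric ones. -/
def LaplacianPreservesSymmetric (g : Metric n M) (p : ℕ) : Prop :=
  ∀ θ : ∀ x : M, DoubleForm p p (TangentSpace 𝓘(ℝ, Model n) x), IsSmooth θ →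
    (∀ x, transpose (fun Y Z => θ x Y Z) = fun Y Z => θ x Y Z) →
    ∀ x, transpose (laplacian g θ x) = laplacian g θ x

/-- The curvature endomorphism `R(v,w)u` at `x`. -/
def curvature (g : Metric n M) (x : M) (v w u : TangentSpace 𝓘(ℝ, Model n) x) :
    TangentSpace 𝓘(ℝ, Model n) x :=
  localCurvature (chartMetric g x) (extChartAt 𝓘(ℝ, Model n) x x) v w u

/-- The Riemann tensor as a `(2,2)` double form: `R(v,w; z,u) = g(R(v,w)u, z)`, so that
`R(v,w; v,w)` is positive on round spheres. -/
def riemann (g : Metric n M) (x : M) (v w z u : TangentSpace 𝓘(ℝ, Model n) x) : ℝ :=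
  g.inner x (curvature g x v w u) z

/-- The Ricci tensor `Ric(v,w) = tr (u ↦ R(u,v)w)`. -/
def ricci (g : Metric n M) (x : M) (v w : TangentSpace 𝓘(ℝ, Model n) x) : ℝ :=
  ∑ a : Fin n, EuclideanSpace.proj a (localCurvature (chartMetric g x)
    (extChartAt 𝓘(ℝ, Model n) x x) (frame a) v w)

/-- Einstein: `Ric = c g` for a constant `c`. -/
def IsEinstein (g : Metric n M) : Prop :=
  ∃ c : ℝ, ∀ (x : M) (v w : TangentSpace 𝓘(ℝ, Model n) x), ricci g x v w = c * g.inner x v w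

/-- Sectional curvature of the plane spanned by two linearly independent vectors. -/
def sectionalCurvature (g : Metric n M) (x : M) (v w : TangentSpace 𝓘(ℝ, Model n) x) : ℝ :=
  riemann g x v w v w / (g.inner x v v * g.inner x w w - g.inner x v w ^ 2)

/-- Constant sectional curvature. -/
def HasConstantSectionalCurvature (g : Metric n M) : Prop :=
  ∃ K : ℝ, ∀ (x : M) (v w : TangentSpace 𝓘(ℝ, Model n) x), LinearIndependent ℝ ![v, w] →
    sectionalCurvature g x v w = K

/-- The exterior product `g · h` of the `(1,1)` double forms `g` and `h` (the Kulkarni-Nomizu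
product). -/
def kulkarniNomizu {V : Type*} (g h : V → V → ℝ) (v w z u : V) : ℝ :=
  g v z * h w u + g w u * h v z - g v u * h w z - g w z * h v u

/-- Conformally flat, in terms of the Weyl tensor: the trace-free `(2,2)` component `W` in the
orthogonal decomposition `R = W + g·ω₁ + g²·ω₀` of the Riemann tensor vanishes at every point,
i.e. `R = g·h` for some symmetric bilinear form `h` (`= ω₁ + ω₀ g`). -/
def IsConformallyFlat (g : Metric n M) : Prop :=
  ∀ x : M, ∃ h : LinearMap.BilinForm ℝ (TangentSpace 𝓘(ℝ, Model n) x),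
    (∀ v w, h v w = h w v) ∧
    ∀ v w z u, riemann g x v w z u =
      kulkarniNomizu (fun a b => g.inner x a b) (fun a b => h a b) v w z u

end Manifold

end DoubleForms

end

open DoubleForms

open scoped Topology

noncomputable section

namespace DoubleForms

/-! ### Levi-Civita connection and curvature in coordinates -/

section Local

set_option maxSynthPendingDepth 5

variable {n : ℕ}

/-! The Weitzenböck formula writes Δω as ∇*∇ω plus curvature terms. The two groups of arguments play
the same role in ∇*∇ω, and the curvature term coupling a Y-slot with a Z-slot is symmetric by the
pair symmetry of R (`curvature_cross_symm`). What remains is the classical Weitzenböck operator W of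
p-forms, acting on the Y's alone. For symmetric ω the asymmetry of Δω is therefore (W⊗1)ω − (1⊗W)ω,
which is algebraic in ω (`localLaplacian_sub_transpose`). The question becomes when W is a multiple
of the identity at every point.

Necessity: a bump function extends any α⊗β + β⊗α at a point to a global symmetric form. Taking for
α, β coordinate forms of an orthonormal frame that differ in one index shows that the corresponding
diagonal entries of W agree. Writing K for the sectional curvatures of the frame planes, Ric_ii − 2
∑ K_ik, with k over the other indices, is unchanged when i is replaced by an index j outside the set
(`IsFrame.ricci_sub_eq`). For p = 1 this says that Ric is pointwise a multiple of g. For p ≥ 2 the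
difference of two such identities is K_ia − K_ib = K_ja − K_jb. Let h be the Schouten tensor. The
array of R − g·h satisfies the same identity and has zero row sums, so it vanishes
(`eq_zero_of_four_index`); as this holds in every frame, R = g·h. If n ≠ 2p, the exchange identity
for g·h then forces h to be a multiple of g.

Sufficiency: for R = g·h, W is (n − 2p) times the derivation induced by h plus the scalar p tr h
(`IsFrame.weitzenbock_kulkarniNomizu`). This is scalar if n = 2p or if h is a multiple of g. For p =
1, W is the Ricci endomorphism.

Schur's lemma, from the twice contracted second Bianchi identity, turns the pointwise factors into
constants for n ≥ 3. It compares different points within one chart, whereas `ricci` at a point uses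
the chart centred there; hence the invariance of curvature under changes of charts. -/

theorem two_le_infty : minSmoothness ℝ 2 ≤ (∞ : WithTop ℕ∞) := by
  rw [minSmoothness_of_isRCLikeNormedField]
  exact WithTop.coe_le_coe.2 (le_top (a := (2 : ℕ∞)))

/-- `G` is a smooth Riemannian metric on the open set `U`. -/
structure IsRiemannianOn (G : LocalMetric n) (U : Set (Model n)) : Prop where
  isOpen : IsOpen U
  smooth : ContDiffOn ℝ ∞ G U
  symm : ∀ y ∈ U, ∀ v w, G y v w = G y w v
  pos : ∀ y ∈ U, ∀ v, v ≠ 0 → 0 < G y v v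

/-- The Christoffel map as a field of bilinear maps. -/
def christoffelCLM (G : LocalMetric n) (y : Model n) : Model n →L[ℝ] Model n →L[ℝ] Model n :=
  ((ContinuousLinearMap.compL ℝ (Model n) (Model n →L[ℝ] ℝ) (Model n)) (G y).inverse).comp
    ((1 / 2 : ℝ) • (fderiv ℝ G y + (fderiv ℝ G y).flip -
      (ContinuousLinearMap.flipₗᵢ ℝ (Model n) (Model n) ℝ).toContinuousLinearEquiv.toContinuousLinearMap.comp
        (fderiv ℝ G y).flip))

theorem christoffelCLM_apply (G : LocalMetric n) (y v w : Model n) :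
    christoffelCLM G y v w = christoffel G y v w := by
  simp [christoffelCLM, christoffel]

namespace IsRiemannianOn

variable {G : LocalMetric n} {U : Set (Model n)} (hG : IsRiemannianOn G U) {y : Model n}
  (hy : y ∈ U)
include hG hy

/-- `ContinuousLinearMap.inverse` is `0` on non-invertible maps, so `dualFrame` and `christoffel`
have their meaning only because positive definiteness makes `G y` injective, hence bijective by
dimension. -/
theorem exists_equiv : ∃ e : Model n ≃L[ℝ] (Model n →L[ℝ] ℝ), (e : Model n →L[ℝ] _) = G y := by
  have hinj : Function.Injective (G y).toLinearMap := by
    rw [← LinearMap.ker_eq_bot, LinearMap.ker_eq_bot']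
    intro v hv
    by_contra h
    have := hG.pos y hy v h
    rw [show G y v = 0 from hv] at this
    simp at this
  have hfin : Module.finrank ℝ (Model n) = Module.finrank ℝ (Model n →L[ℝ] ℝ) := by
    rw [← (LinearMap.toContinuousLinearMap (𝕜 := ℝ) (E := Model n) (F' := ℝ)).finrank_eq]
    exact (Subspace.dual_finrank_eq (K := ℝ) (V := Model n)).symm
  refine ⟨(LinearEquiv.ofInjectiveOfFinrankEq (G y).toLinearMap hinj hfin).toContinuousLinearEquiv, ?_⟩
  ext v w
  exact congrArg (fun f : Model n →ₗ[ℝ] Model n →L[ℝ] ℝ => f v w)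
    (LinearEquiv.coe_ofInjectiveOfFinrankEq (G y).toLinearMap hinj hfin)

theorem apply_inverse (l : Model n →L[ℝ] ℝ) : G y ((G y).inverse l) = l := by
  obtain ⟨e, he⟩ := hG.exists_equiv hy
  rw [← he, ContinuousLinearMap.inverse_equiv]
  simp

theorem inverse_apply (v : Model n) : (G y).inverse (G y v) = v := by
  obtain ⟨e, he⟩ := hG.exists_equiv hy
  rw [← he, ContinuousLinearMap.inverse_equiv]
  simp

theorem ext_apply {v w : Model n} (h : ∀ z, G y v z = G y w z) : v = w := by
  rw [← hG.inverse_apply hy v, ← hG.inverse_apply hy w]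
  congr 1
  ext z
  exact h z

theorem apply_dualFrame (a : Fin n) (v : Model n) : G y (dualFrame G y a) v = v a := by
  rw [dualFrame, hG.apply_inverse hy]
  rfl

theorem apply_christoffel (v w z : Model n) : G y (christoffel G y v w) z =
    (1 / 2) * (fderiv ℝ G y v w z + fderiv ℝ G y w v z - fderiv ℝ G y z v w) := by
  rw [christoffel, hG.apply_inverse hy]
  simp

theorem contDiffAt : ContDiffAt ℝ ∞ G y :=
  hG.smooth.contDiffAt (hG.isOpen.mem_nhds hy)

theorem differentiableAt : DifferentiableAt ℝ G y :=
  (hG.contDiffAt hy).differentiableAt (by simp)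

omit hy in
theorem eventually_mem (hy : y ∈ U) : ∀ᶠ y' in 𝓝 y, y' ∈ U := hG.isOpen.mem_nhds hy

theorem fderiv_apply (u v w : Model n) :
    fderiv ℝ (fun y' => G y' v w) y u = fderiv ℝ G y u v w := by
  have h := ((hG.differentiableAt hy).hasFDerivAt.clm_apply (hasFDerivAt_const v y)).clm_apply
    (hasFDerivAt_const w y)
  rw [h.fderiv]
  simp

theorem fderiv_symm (u v w : Model n) : fderiv ℝ G y u v w = fderiv ℝ G y u w v := by
  rw [← hG.fderiv_apply hy, ← hG.fderiv_apply hy]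
  have : (fun y' => G y' v w) =ᶠ[𝓝 y] fun y' => G y' w v := by
    filter_upwards [hG.eventually_mem hy] with y' hy'
    exact hG.symm y' hy' v w
  rw [this.fderiv_eq]

theorem christoffel_symm (v w : Model n) : christoffel G y v w = christoffel G y w v := by
  apply hG.ext_apply hy
  intro z
  rw [hG.apply_christoffel hy, hG.apply_christoffel hy, hG.fderiv_symm hy z v w]
  ring

/-- Metric compatibility, ∇G = 0: in the sum of the two Koszul expressions the derivatives in the
directions v and w cancel. -/
theorem fderiv_eq (u v w : Model n) :
    fderiv ℝ G y u v w = G y (christoffel G y u v) w + G y v (christoffel G y u w) := by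
  rw [hG.symm y hy v, hG.apply_christoffel hy, hG.apply_christoffel hy, hG.fderiv_symm hy u w v,
    hG.fderiv_symm hy v u w, hG.fderiv_symm hy w u v]
  ring

/-- Koszul: a symmetric connection that is compatible with the metric is Levi-Civita. -/
theorem christoffel_unique (B : Model n → Model n → Model n) (hB : ∀ v w, B v w = B w v)
    (hc : ∀ u v w, fderiv ℝ G y u v w = G y (B u v) w + G y v (B u w)) (v w : Model n) :
    christoffel G y v w = B v w := by
  apply hG.ext_apply hy
  intro z
  rw [hG.apply_christoffel hy, hc, hc, hc, hB w v, hB z v, hB z w, hG.symm y hy (B v z) w,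
    hG.symm y hy w]
  rw [hG.symm y hy v]
  ring

theorem contDiffAt_inverse : ContDiffAt ℝ ∞ (fun y => (G y).inverse) y := by
  obtain ⟨e, he⟩ := hG.exists_equiv hy
  have h := contDiffAt_map_inverse (n := ∞) e
  rw [he] at h
  exact ContDiffAt.comp (x := y) (f := G) (g := ContinuousLinearMap.inverse) h (hG.contDiffAt hy)

theorem contDiffAt_dualFrame (a : Fin n) : ContDiffAt ℝ ∞ (fun y => dualFrame G y a) y :=
  (hG.contDiffAt_inverse hy).clm_apply contDiffAt_const

theorem contDiffAt_fderiv : ContDiffAt ℝ ∞ (fderiv ℝ G) y :=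
  (hG.contDiffAt hy).fderiv_right (m := ∞) (by simp)

theorem contDiffAt_christoffel (v w : Model n) :
    ContDiffAt ℝ ∞ (fun y => christoffel G y v w) y := by
  refine (hG.contDiffAt_inverse hy).clm_apply ?_
  have h := hG.contDiffAt_fderiv hy
  refine ContDiffAt.const_smul _ ((ContDiffAt.add ?_ ?_).sub ?_)
  · exact (h.clm_apply contDiffAt_const).clm_apply contDiffAt_const
  · exact (h.clm_apply contDiffAt_const).clm_apply contDiffAt_const
  · have h1 : ContDiffAt ℝ ∞ (fun y => (fderiv ℝ G y).flip) y :=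
      ContDiffAt.comp (g := fun F : Model n →L[ℝ] Model n →L[ℝ] Model n →L[ℝ] ℝ => F.flip) y
        (ContinuousLinearMap.flipₗᵢ ℝ (Model n) (Model n)
          (Model n →L[ℝ] ℝ)).toContinuousLinearEquiv.contDiff.contDiffAt h
    have h2 : ContDiffAt ℝ ∞ (fun y => ((fderiv ℝ G y).flip v).flip) y :=
      (ContinuousLinearMap.flipₗᵢ ℝ (Model n) (Model n) ℝ).toContinuousLinearEquiv.contDiff.contDiffAt.comp
        y (h1.clm_apply contDiffAt_const)
    exact h2.clm_apply contDiffAt_const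

omit hy in
theorem contDiffOn_christoffelCLM : ContDiffOn ℝ ∞ (christoffelCLM G) U := by
  rw [contDiffOn_clm_apply]
  intro v
  rw [contDiffOn_clm_apply]
  intro w y hy
  simp only [christoffelCLM_apply]
  exact (hG.contDiffAt_christoffel hy v w).contDiffWithinAt

theorem contDiffAt_christoffelCLM : ContDiffAt ℝ ∞ (christoffelCLM G) y :=
  hG.contDiffOn_christoffelCLM.contDiffAt (hG.isOpen.mem_nhds hy)

theorem differentiableAt_christoffelCLM : DifferentiableAt ℝ (christoffelCLM G) y :=
  (hG.contDiffAt_christoffelCLM hy).differentiableAt (by simp)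

theorem christoffelCLM_symm (v w : Model n) : christoffelCLM G y v w = christoffelCLM G y w v := by
  simp only [christoffelCLM_apply, hG.christoffel_symm hy v w]

theorem fderiv_christoffel (u v w : Model n) :
    fderiv ℝ (fun y' => christoffel G y' v w) y u = fderiv ℝ (christoffelCLM G) y u v w := by
  have h := ((hG.differentiableAt_christoffelCLM hy).hasFDerivAt.clm_apply
    (hasFDerivAt_const v y)).clm_apply (hasFDerivAt_const w y)
  simp only [christoffelCLM_apply] at h
  rw [h.fderiv]
  simp

theorem fderiv_christoffelCLM_symm (u v w : Model n) :
    fderiv ℝ (christoffelCLM G) y u v w = fderiv ℝ (christoffelCLM G) y u w v := by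
  rw [← hG.fderiv_christoffel hy, ← hG.fderiv_christoffel hy]
  have : (fun y' => christoffel G y' v w) =ᶠ[𝓝 y] fun y' => christoffel G y' w v := by
    filter_upwards [hG.eventually_mem hy] with y' hy'
    exact hG.christoffel_symm hy' v w
  rw [this.fderiv_eq]

theorem localCurvature_eq (v w z : Model n) : localCurvature G y v w z =
    fderiv ℝ (christoffelCLM G) y v w z - fderiv ℝ (christoffelCLM G) y w v z
      + christoffelCLM G y v (christoffelCLM G y w z)
      - christoffelCLM G y w (christoffelCLM G y v z) := by
  simp only [localCurvature, hG.fderiv_christoffel hy, christoffelCLM_apply]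

theorem localCurvature_antisymm (v w z : Model n) :
    localCurvature G y v w z = - localCurvature G y w v z := by
  rw [hG.localCurvature_eq hy, hG.localCurvature_eq hy]
  abel

/-- The connection has no torsion: Γ and its derivative are symmetric in their last two arguments,
and the cyclic sum cancels in pairs. -/
theorem localCurvature_bianchi (v w z : Model n) :
    localCurvature G y v w z + localCurvature G y w z v + localCurvature G y z v w = 0 := by
  simp only [hG.localCurvature_eq hy]
  rw [hG.fderiv_christoffelCLM_symm hy w z v, hG.fderiv_christoffelCLM_symm hy v z w,
    hG.fderiv_christoffelCLM_symm hy z v w, hG.christoffelCLM_symm hy z v,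
    hG.christoffelCLM_symm hy w v, hG.christoffelCLM_symm hy w z]
  abel

/-- The second derivative of the metric in terms of the Christoffel map. -/
theorem fderiv_fderiv_apply (u v z w : Model n) :
    fderiv ℝ (fderiv ℝ G) y u v z w =
      fderiv ℝ G y u (christoffel G y v z) w + G y (fderiv ℝ (christoffelCLM G) y u v z) w
        + fderiv ℝ G y u z (christoffel G y v w)
        + G y z (fderiv ℝ (christoffelCLM G) y u v w) := by
  have hd := (hG.contDiffAt_fderiv hy).differentiableAt (by simp)
  have h1 := ((hd.hasFDerivAt.clm_apply (hasFDerivAt_const v y)).clm_apply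
    (hasFDerivAt_const z y)).clm_apply (hasFDerivAt_const w y)
  have hg := (hG.differentiableAt hy).hasFDerivAt
  have hc := (hG.differentiableAt_christoffelCLM hy).hasFDerivAt.clm_apply (hasFDerivAt_const v y)
  have h2 := ((hg.clm_apply (hc.clm_apply (hasFDerivAt_const z y))).clm_apply
    (hasFDerivAt_const w y)).add ((hg.clm_apply (hasFDerivAt_const z y)).clm_apply
    (hc.clm_apply (hasFDerivAt_const w y)))
  -- Compatibility holds on a neighbourhood, so it may be differentiated once more.
  have he : (fun y' => fderiv ℝ G y' v z w) =ᶠ[𝓝 y] fun y' =>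
      G y' (christoffelCLM G y' v z) w + G y' z (christoffelCLM G y' v w) := by
    filter_upwards [hG.eventually_mem hy] with y' hy'
    simp only [hG.fderiv_eq hy', christoffelCLM_apply]
  have h3 := congrArg (fun L => L u) (h1.unique (h2.congr_of_eventuallyEq he))
  simp only [add_apply, ContinuousLinearMap.comp_apply,
    ContinuousLinearMap.flip_apply, zero_apply, map_zero, zero_add,
    christoffelCLM_apply] at h3
  rw [h3]
  ring

/-- This is the Ricci identity for ∇G = 0: the second derivatives of G commute, and after both are
written through Γ and its derivative, their difference is G(R(v,w)z, u) + G(z, R(v,w)u). -/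
theorem localCurvature_metric_skew (v w z u : Model n) :
    G y (localCurvature G y v w z) u = - G y (localCurvature G y v w u) z := by
  have hs : fderiv ℝ (fderiv ℝ G) y v w = fderiv ℝ (fderiv ℝ G) y w v :=
    ((hG.contDiffAt hy).isSymmSndFDerivAt two_le_infty).eq v w
  have h : fderiv ℝ (fderiv ℝ G) y v w z u = fderiv ℝ (fderiv ℝ G) y w v z u := by rw [hs]
  rw [hG.fderiv_fderiv_apply hy, hG.fderiv_fderiv_apply hy] at h
  simp only [hG.fderiv_eq hy] at h
  simp only [hG.localCurvature_eq hy, map_add, map_sub, add_apply,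
    sub_apply, christoffelCLM_apply]
  rw [hG.symm y hy _ z, hG.symm y hy _ z, hG.symm y hy _ z, hG.symm y hy _ z]
  linarith

end IsRiemannianOn

end Local

/-! ### Covariant derivatives of tensor fields and the Ricci identity -/

section Tensor

set_option maxSynthPendingDepth 5

variable {n : ℕ}

theorem sum_smul_frame (w : Model n) : ∑ b, w b • (frame b : Model n) = w := by
  ext j
  simp [frame, Finset.sum_apply, Pi.single_apply]

theorem linearMap_apply_eq_sum (f : Model n →ₗ[ℝ] ℝ) (w : Model n) :
    f w = ∑ b, w b * f (frame b) := by
  conv_lhs => rw [← sum_smul_frame w, map_sum]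
  simp

/-- Expansion of one slot of a multilinear form in the coordinate frame. -/
theorem multilinear_update_eq_sum {ι : Type*} [DecidableEq ι]
    (m : MultilinearMap ℝ (fun _ : ι => Model n) ℝ) (Y : ι → Model n) (i : ι) (w : Model n) :
    m (Function.update Y i w) = ∑ b, w b * m (Function.update Y i (frame b)) :=
  linearMap_apply_eq_sum (m.toLinearMap Y i) w

/-- Derivative of a field of linear forms along a varying vector. -/
theorem hasFDerivAt_slot {F : Model n → Model n → ℝ} {X : Model n → Model n} {y : Model n}
    -- Linearity is required as an expansion in the constant frame. This reduces the product rule to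
    -- finitely many scalar functions, with no topology on multilinear maps.
    (hF : ∀ᶠ y' in 𝓝 y, ∀ w, F y' w = ∑ b, w b * F y' (frame b))
    (hd : ∀ w, DifferentiableAt ℝ (fun y' => F y' w) y) (hX : DifferentiableAt ℝ X y) :
    ∃ L : Model n →L[ℝ] ℝ, HasFDerivAt (fun y' => F y' (X y')) L y ∧
      ∀ u, L u = fderiv ℝ (fun y' => F y' (X y)) y u + F y (fderiv ℝ X y u) := by
  have hXb : ∀ b : Fin n, HasFDerivAt (fun y' => X y' b)
      ((EuclideanSpace.proj b : Model n →L[ℝ] ℝ).comp (fderiv ℝ X y)) y := fun b =>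
    (EuclideanSpace.proj b : Model n →L[ℝ] ℝ).hasFDerivAt.comp y hX.hasFDerivAt
  have h1 := HasFDerivAt.fun_sum (u := Finset.univ)
    fun (b : Fin n) _ => (hXb b).mul (hd (frame b)).hasFDerivAt
  have h2 := HasFDerivAt.fun_sum (u := Finset.univ)
    fun (b : Fin n) _ => (hd (frame b)).hasFDerivAt.const_mul (X y b)
  have e1 : (fun y' => F y' (X y')) =ᶠ[𝓝 y] fun y' => ∑ b, X y' b * F y' (frame b) := by
    filter_upwards [hF] with y' h
    exact h _
  have e2 : (fun y' => F y' (X y)) =ᶠ[𝓝 y] fun y' => ∑ b, X y b * F y' (frame b) := by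
    filter_upwards [hF] with y' h
    exact h _
  refine ⟨_, h1.congr_of_eventuallyEq e1, fun u => ?_⟩
  rw [(h2.congr_of_eventuallyEq e2).fderiv, hF.self_of_nhds (fderiv ℝ X y u)]
  simp only [_root_.sum_apply, add_apply, _root_.smul_apply, ContinuousLinearMap.comp_apply, smul_eq_mul,
    Finset.sum_add_distrib]
  simp [mul_comm]

theorem fderiv_slot {F : Model n → Model n → ℝ} {X : Model n → Model n} {y : Model n}
    (hF : ∀ᶠ y' in 𝓝 y, ∀ w, F y' w = ∑ b, w b * F y' (frame b))
    (hd : ∀ w, DifferentiableAt ℝ (fun y' => F y' w) y) (hX : DifferentiableAt ℝ X y)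
    (u : Model n) : fderiv ℝ (fun y' => F y' (X y')) y u =
      fderiv ℝ (fun y' => F y' (X y)) y u + F y (fderiv ℝ X y u) := by
  obtain ⟨L, hL, h⟩ := hasFDerivAt_slot hF hd hX
  rw [hL.fderiv, h]

theorem differentiableAt_slot {F : Model n → Model n → ℝ} {X : Model n → Model n} {y : Model n}
    (hF : ∀ᶠ y' in 𝓝 y, ∀ w, F y' w = ∑ b, w b * F y' (frame b))
    (hd : ∀ w, DifferentiableAt ℝ (fun y' => F y' w) y) (hX : DifferentiableAt ℝ X y) :
    DifferentiableAt ℝ (fun y' => F y' (X y')) y := by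
  obtain ⟨L, hL, h⟩ := hasFDerivAt_slot hF hd hX
  exact hL.differentiableAt

variable {ι : Type*} [Fintype ι] [DecidableEq ι]

/-- Commutator of the derivations of the tensor algebra defined by two endomorphisms. -/
theorem derivation_commutator (m : MultilinearMap ℝ (fun _ : ι => Model n) ℝ)
    (A B : Model n → Model n) (Y : ι → Model n) :
    ∑ k, ∑ i, m (Function.update (Function.update Y k (A (Y k))) i
        (B (Function.update Y k (A (Y k)) i))) -
      ∑ k, ∑ i, m (Function.update (Function.update Y k (B (Y k))) i
        (A (Function.update Y k (B (Y k)) i))) =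
    ∑ k, (m (Function.update Y k (B (A (Y k)))) - m (Function.update Y k (A (B (Y k))))) := by
  rw [Finset.sum_comm (f := fun k i => m (Function.update (Function.update Y k (B (Y k))) i
        (A (Function.update Y k (B (Y k)) i)))), ← Finset.sum_sub_distrib]
  refine Finset.sum_congr rfl fun k _ => ?_
  -- Updates of different slots commute, so only the terms in which both endomorphisms hit the same
  -- slot survive.
  rw [← Finset.sum_sub_distrib, Finset.sum_eq_single k]
  · simp
  · intro i _ hik
    rw [Function.update_of_ne hik, Function.update_of_ne hik.symm,
      Function.update_comm hik.symm, sub_self]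
  · simp

/-- The covariant derivative of a covariant tensor field. -/
def cov (G : LocalMetric n) (T : Model n → (ι → Model n) → ℝ) (y v : Model n)
    (Y : ι → Model n) : ℝ :=
  fderiv ℝ (fun y' => T y' Y) y v - ∑ i, T y (Function.update Y i (christoffel G y v (Y i)))

/-- The second covariant derivative of a covariant tensor field. -/
def cov2 (G : LocalMetric n) (T : Model n → (ι → Model n) → ℝ) (y u v : Model n)
    (Y : ι → Model n) : ℝ :=
  fderiv ℝ (fun y' => cov G T y' v Y) y u - cov G T y (christoffel G y u v) Y
    - ∑ i, cov G T y v (Function.update Y i (christoffel G y u (Y i)))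

variable {G : LocalMetric n} {U : Set (Model n)} (hG : IsRiemannianOn G U)
  {T : Model n → MultilinearMap ℝ (fun _ : ι => Model n) ℝ}
  (hT : ∀ Y, ContDiffOn ℝ ∞ (fun y => T y Y) U) {y : Model n} (hy : y ∈ U)
include hG hT hy

omit [Fintype ι] [DecidableEq ι] in
theorem contDiffAt_tensor (Y : ι → Model n) : ContDiffAt ℝ ∞ (fun y => T y Y) y :=
  (hT Y).contDiffAt (hG.isOpen.mem_nhds hy)

omit [Fintype ι] [DecidableEq ι] in
theorem differentiableAt_tensor (Y : ι → Model n) : DifferentiableAt ℝ (fun y => T y Y) y :=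
  (contDiffAt_tensor hG hT hy Y).differentiableAt (by simp)

omit [Fintype ι] [DecidableEq ι] in
theorem contDiffAt_fderiv_tensor (v : Model n) (Y : ι → Model n) :
    ContDiffAt ℝ ∞ (fun y' => fderiv ℝ (fun y'' => T y'' Y) y' v) y :=
  ((contDiffAt_tensor hG hT hy Y).fderiv_right (m := ∞) (by simp)).clm_apply contDiffAt_const

theorem differentiableAt_cov (v : Model n) (Y : ι → Model n) :
    DifferentiableAt ℝ (fun y' => cov G (fun y Y => T y Y) y' v Y) y := by
  refine ((contDiffAt_fderiv_tensor hG hT hy v Y).differentiableAt (by simp)).fun_sub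
    (DifferentiableAt.fun_sum fun i _ => ?_)
  exact differentiableAt_slot (F := fun y' w => T y' (Function.update Y i w))
    (Filter.Eventually.of_forall fun y' w => multilinear_update_eq_sum (T y') Y i w)
    (fun w => differentiableAt_tensor hG hT hy _)
    ((hG.contDiffAt_christoffel hy v (Y i)).differentiableAt (by simp))

theorem fderiv_cov (u v : Model n) (Y : ι → Model n) :
    fderiv ℝ (fun y' => cov G (fun y Y => T y Y) y' v Y) y u =
      fderiv ℝ (fun y' => fderiv ℝ (fun y'' => T y'' Y) y' v) y u
      - ∑ i, (fderiv ℝ (fun y' => T y' (Function.update Y i (christoffel G y v (Y i)))) y u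
        + T y (Function.update Y i (fderiv ℝ (christoffelCLM G) y u v (Y i)))) := by
  have hF : ∀ i, ∀ᶠ y' in 𝓝 y, ∀ w, (fun y' w => T y' (Function.update Y i w)) y' w =
      ∑ b, w b * (fun y' w => T y' (Function.update Y i w)) y' (frame b) := fun i =>
    Filter.Eventually.of_forall fun y' w => multilinear_update_eq_sum (T y') Y i w
  have hX : ∀ i, DifferentiableAt ℝ (fun y' => christoffel G y' v (Y i)) y := fun i =>
    (hG.contDiffAt_christoffel hy v (Y i)).differentiableAt (by simp)
  have hs : ∀ i, DifferentiableAt ℝ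
      (fun y' => T y' (Function.update Y i (christoffel G y' v (Y i)))) y := fun i =>
    differentiableAt_slot (hF i) (fun w => differentiableAt_tensor hG hT hy _) (hX i)
  unfold cov
  rw [fderiv_fun_sub ((contDiffAt_fderiv_tensor hG hT hy v Y).differentiableAt (by simp))
    (DifferentiableAt.fun_sum fun i _ => hs i), fderiv_fun_sum fun i _ => hs i]
  simp only [sub_apply, _root_.sum_apply]
  congr 1
  refine Finset.sum_congr rfl fun i _ => ?_
  rw [fderiv_slot (hF i) (fun w => differentiableAt_tensor hG hT hy _) (hX i),
    hG.fderiv_christoffel hy]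

/-- The Ricci identity. -/
theorem cov2_sub_cov2 (u v : Model n) (Y : ι → Model n) :
    cov2 G (fun y Y => T y Y) y u v Y - cov2 G (fun y Y => T y Y) y v u Y =
      - ∑ i, T y (Function.update Y i (localCurvature G y u v (Y i))) := by
  have hs : fderiv ℝ (fun y' => fderiv ℝ (fun y'' => T y'' Y) y' v) y u =
      fderiv ℝ (fun y' => fderiv ℝ (fun y'' => T y'' Y) y' u) y v := by
    have hd := (((contDiffAt_tensor hG hT hy Y).fderiv_right (m := ∞)
      (by simp)).differentiableAt (by simp)).hasFDerivAt
    rw [(hd.clm_apply (hasFDerivAt_const v y)).fderiv,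
      (hd.clm_apply (hasFDerivAt_const u y)).fderiv]
    simpa using ((contDiffAt_tensor hG hT hy Y).isSymmSndFDerivAt two_le_infty).eq u v
  have hR : ∀ i, T y (Function.update Y i (localCurvature G y u v (Y i))) =
      T y (Function.update Y i (fderiv ℝ (christoffelCLM G) y u v (Y i)))
      - T y (Function.update Y i (fderiv ℝ (christoffelCLM G) y v u (Y i)))
      + T y (Function.update Y i (christoffel G y u (christoffel G y v (Y i))))
      - T y (Function.update Y i (christoffel G y v (christoffel G y u (Y i)))) := fun i => by
    simp only [hG.localCurvature_eq hy, MultilinearMap.map_update_sub,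
      MultilinearMap.map_update_add, christoffelCLM_apply]
  -- These terms, quadratic in Γ, supply the part [Γ_u, Γ_v] of the curvature. The terms along
  -- Γ(u,v) and Γ(v,u) cancel by symmetry of Γ.
  have hc := derivation_commutator (T y) (christoffel G y u) (christoffel G y v) Y
  unfold cov2
  rw [fderiv_cov hG hT hy, fderiv_cov hG hT hy, hs, hG.christoffel_symm hy v u,
    Finset.sum_congr rfl fun i _ => hR i]
  simp only [cov, Finset.sum_add_distrib, Finset.sum_sub_distrib] at hc ⊢
  linarith

end Tensor

/-! ### Metric contraction is parallel -/

section Contraction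

set_option maxSynthPendingDepth 5

variable {n : ℕ} {G : LocalMetric n} {U : Set (Model n)} (hG : IsRiemannianOn G U)
  {y : Model n} (hy : y ∈ U)
include hG hy

/-- Obtained by differentiating G(dualFrame a, z) = z_a, whose right side is constant in y, and
using ∇G = 0. The last sum is the action of Γ on the coframe. -/
theorem fderiv_dualFrame (a : Fin n) (u : Model n) :
    fderiv ℝ (fun y' => dualFrame G y' a) y u = - christoffel G y u (dualFrame G y a)
      - ∑ c, (christoffel G y u (frame c)) a • dualFrame G y c := by
  apply hG.ext_apply hy
  intro z
  have hd := ((hG.contDiffAt_dualFrame hy a).differentiableAt (by simp)).hasFDerivAt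
  have h1 := ((hG.differentiableAt hy).hasFDerivAt.clm_apply hd).clm_apply (hasFDerivAt_const z y)
  have he : (fun y' => G y' (dualFrame G y' a) z) =ᶠ[𝓝 y] fun _ => z a := by
    filter_upwards [hG.eventually_mem hy] with y' hy'
    exact hG.apply_dualFrame hy' a z
  have h2 := congrArg (fun L => L u)
    (h1.unique ((hasFDerivAt_const (z a) y).congr_of_eventuallyEq he))
  simp only [add_apply, ContinuousLinearMap.comp_apply, ContinuousLinearMap.flip_apply,
    zero_apply, hG.fderiv_eq hy, hG.apply_dualFrame hy, PiLp.zero_apply, zero_add] at h2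
  have h3 : (christoffel G y u z) a = ∑ c, z c * (christoffel G y u (frame c)) a := by
    have := linearMap_apply_eq_sum
      ((EuclideanSpace.proj a : Model n →L[ℝ] ℝ).comp (christoffelCLM G y u)).toLinearMap z
    simpa [christoffelCLM_apply] using this
  simp only [map_sub, map_neg, map_sum, map_smul, sub_apply, neg_apply, _root_.sum_apply,
    _root_.smul_apply, smul_eq_mul, hG.apply_dualFrame hy]
  rw [h3] at h2
  simp only [mul_comm] at h2 ⊢
  linarith

/-- Covariant differentiation commutes with metric contraction. -/
theorem fderiv_contraction {B : Model n → Model n → Model n → ℝ}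
    (hB1 : ∀ v w, B y v w = ∑ a, v a * B y (frame a) w)
    (hB2 : ∀ y' ∈ U, ∀ v w, B y' v w = ∑ a, w a * B y' v (frame a))
    (hd : ∀ v w, DifferentiableAt ℝ (fun y' => B y' v w) y) (u : Model n) :
    fderiv ℝ (fun y' => ∑ a, B y' (frame a) (dualFrame G y' a)) y u =
      ∑ a, (fderiv ℝ (fun y' => B y' (frame a) (dualFrame G y a)) y u
        - B y (christoffel G y u (frame a)) (dualFrame G y a)
        - B y (frame a) (christoffel G y u (dualFrame G y a))) := by
  have hF : ∀ a : Fin n, ∀ᶠ y' in 𝓝 y, ∀ w, (fun y' w => B y' (frame a) w) y' w =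
      ∑ b, w b * (fun y' w => B y' (frame a) w) y' (frame b) := fun a => by
    filter_upwards [hG.eventually_mem hy] with y' hy' w
    exact hB2 y' hy' _ w
  have hX : ∀ a, DifferentiableAt ℝ (fun y' => dualFrame G y' a) y := fun a =>
    (hG.contDiffAt_dualFrame hy a).differentiableAt (by simp)
  rw [fderiv_fun_sum fun a _ => differentiableAt_slot (hF a) (fun w => hd _ w) (hX a)]
  simp only [_root_.sum_apply]
  simp only [fun a => fderiv_slot (hF a) (fun w => hd (frame a) w) (hX a) u,
    fderiv_dualFrame hG hy]
  -- `B y` is only known to expand in the frame; `b` is the bilinear form with the same matrix, to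
  -- which the lemmas on linear maps apply.
  let b : Model n →ₗ[ℝ] Model n →ₗ[ℝ] ℝ := ∑ c, ∑ d, B y (frame c) (frame d) •
    (LinearMap.lsmul ℝ ℝ).compl₁₂ (EuclideanSpace.proj c : Model n →L[ℝ] ℝ).toLinearMap
      (EuclideanSpace.proj d : Model n →L[ℝ] ℝ).toLinearMap
  have hb : ∀ v w, B y v w = b v w := fun v w => by
    rw [hB1]
    simp only [hB2 y hy _ w, b, LinearMap.sum_apply, LinearMap.smul_apply,
      LinearMap.compl₁₂_apply, LinearMap.lsmul_apply, Finset.mul_sum]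
    refine Finset.sum_congr rfl fun c _ => Finset.sum_congr rfl fun d _ => ?_
    simp
    ring
  simp only [hb, map_sub, map_neg, map_sum, map_smul, Finset.sum_add_distrib,
    Finset.sum_sub_distrib, Finset.sum_neg_distrib]
  -- Exchanging the sums moves the coframe part of the derivative of the dual frame onto the first
  -- slot, as the term B(Γ(u, frame), dualFrame).
  rw [Finset.sum_comm]
  have h3 : ∀ c, ∑ a, (christoffel G y u (frame c)) a • b (frame a) (dualFrame G y c) =
      b (christoffel G y u (frame c)) (dualFrame G y c) := fun c => by
    conv_rhs => rw [← sum_smul_frame (christoffel G y u (frame c)), map_sum]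
    simp
  rw [Finset.sum_congr rfl fun c _ => h3 c]
  ring

end Contraction

/-! ### Second covariant derivatives and the Weitzenböck formula -/

section CovDeriv

set_option maxSynthPendingDepth 5

variable {n : ℕ}

/-- A double form as a multilinear form on the disjoint union of the two groups of arguments. -/
def joint {p q : ℕ} {V : Type*} [AddCommGroup V] [Module ℝ V] (w : DoubleForm p q V) :
    MultilinearMap ℝ (fun _ : Fin p ⊕ Fin q => V) ℝ :=
  MultilinearMap.uncurrySum (N := fun _ : Fin p ⊕ Fin q => V)
    ((AlternatingMap.toMultilinearMapLM (R := ℝ) (S := ℝ)).compMultilinearMap w.toMultilinearMap)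

theorem joint_apply {p q : ℕ} {V : Type*} [AddCommGroup V] [Module ℝ V] (w : DoubleForm p q V)
    (Y : Fin p → V) (Z : Fin q → V) : joint w (Sum.elim Y Z) = w Y Z := by
  simp [joint]

/-- ∇_v T is again a tensor in each slot, since Γ_v acts as a derivation by multilinear maps. The
expansion is the form in which `fderiv_contraction` uses linearity. -/
theorem cov_update_eq_sum {ι : Type*} [Fintype ι] [DecidableEq ι] {G : LocalMetric n}
    {U : Set (Model n)} (hG : IsRiemannianOn G U)
    {T : Model n → MultilinearMap ℝ (fun _ : ι => Model n) ℝ}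
    (hT : ∀ Y, ContDiffOn ℝ ∞ (fun y => T y Y) U) {y : Model n} (hy : y ∈ U) (v : Model n)
    (Y : ι → Model n) (i : ι) (w : Model n) :
    cov G (fun y Y => T y Y) y v (Function.update Y i w) =
      ∑ b, w b * cov G (fun y Y => T y Y) y v (Function.update Y i (frame b)) := by
  let D : MultilinearMap ℝ (fun _ : ι => Model n) ℝ := ∑ k, (T y).compLinearMap
    (Function.update (fun _ => LinearMap.id) k (christoffelCLM G y v).toLinearMap)
  have hD : ∀ Y, ∑ k, T y (Function.update Y k (christoffel G y v (Y k))) = D Y := fun Y => by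
    simp only [D, _root_.sum_apply, MultilinearMap.compLinearMap_apply]
    refine Finset.sum_congr rfl fun k _ => congrArg _ ?_
    ext1 j
    rcases eq_or_ne j k with rfl | h
    · simp [christoffelCLM_apply]
    · simp [h]
  have h1 : fderiv ℝ (fun y' => T y' (Function.update Y i w)) y =
      ∑ b, w b • fderiv ℝ (fun y' => T y' (Function.update Y i (frame b))) y := by
    have e : (fun y' => T y' (Function.update Y i w)) =
        fun y' => ∑ b, w b * T y' (Function.update Y i (frame b)) :=
      funext fun y' => multilinear_update_eq_sum (T y') Y i w
    rw [e]
    exact (HasFDerivAt.fun_sum fun (b : Fin n) _ => (differentiableAt_tensor hG hT hy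
      (Function.update Y i (frame b))).hasFDerivAt.const_mul (w b)).fderiv
  simp only [cov, hD, h1, _root_.sum_apply, _root_.smul_apply, smul_eq_mul, mul_sub,
    Finset.sum_sub_distrib]
  rw [multilinear_update_eq_sum D]

theorem cov_eq_sum {ι : Type*} [Fintype ι] [DecidableEq ι] (G : LocalMetric n)
    (T : Model n → MultilinearMap ℝ (fun _ : ι => Model n) ℝ) (y v : Model n) (Y : ι → Model n) :
    cov G (fun y Y => T y Y) y v Y = ∑ a, v a * cov G (fun y Y => T y Y) y (frame a) Y := by
  let l : Model n →ₗ[ℝ] ℝ := (fderiv ℝ (fun y' => T y' Y) y).toLinearMap -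
    ∑ i, ((T y).toLinearMap Y i).comp ((christoffelCLM G y).flip (Y i)).toLinearMap
  have hl : ∀ v, cov G (fun y Y => T y Y) y v Y = l v := fun v => by
    simp [cov, l, christoffelCLM_apply]
  simp only [hl]
  exact linearMap_apply_eq_sum l v

theorem covDeriv_eq_cov {p q : ℕ} (G : LocalMetric n) (Θ : Model n → DoubleForm p q (Model n))
    (y v : Model n) (Y : Fin p → Model n) (Z : Fin q → Model n) :
    covDeriv G (fun y Y Z => Θ y Y Z) y v Y Z =
      cov G (fun y Y => joint (Θ y) Y) y v (Sum.elim Y Z) := by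
  simp only [covDeriv, cov, joint_apply, Fintype.sum_sum_type, Sum.elim_inl, Sum.elim_inr,
    Sum.update_elim_inl, Sum.update_elim_inr, sub_sub]

/-- The second covariant derivative `(∇²_{u,v} θ)(Y; Z)`. -/
def covDeriv2 {p q : ℕ} (G : LocalMetric n) (θ : LocalForm n p q) (y u v : Model n)
    (Y : Fin p → Model n) (Z : Fin q → Model n) : ℝ :=
  fderiv ℝ (fun y' => covDeriv G θ y' v Y Z) y u - covDeriv G θ y (christoffel G y u v) Y Z
    - ∑ i, covDeriv G θ y v (Function.update Y i (christoffel G y u (Y i))) Z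
    - ∑ j, covDeriv G θ y v Y (Function.update Z j (christoffel G y u (Z j)))

theorem covDeriv2_eq_cov2 {p q : ℕ} (G : LocalMetric n) (Θ : Model n → DoubleForm p q (Model n))
    (y u v : Model n) (Y : Fin p → Model n) (Z : Fin q → Model n) :
    covDeriv2 G (fun y Y Z => Θ y Y Z) y u v Y Z =
      cov2 G (fun y Y => joint (Θ y) Y) y u v (Sum.elim Y Z) := by
  simp only [covDeriv2, cov2, covDeriv_eq_cov, Fintype.sum_sum_type, Sum.elim_inl, Sum.elim_inr,
    Sum.update_elim_inl, Sum.update_elim_inr, sub_sub, add_assoc]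

theorem covDeriv_transpose {p : ℕ} (G : LocalMetric n) {θ : LocalForm n p p}
    (hθ : ∀ y Y Z, θ y Y Z = θ y Z Y) (y v : Model n) (Y Z : Fin p → Model n) :
    covDeriv G θ y v Y Z = covDeriv G θ y v Z Y := by
  simp only [covDeriv]
  rw [show (fun y' => θ y' Y Z) = fun y' => θ y' Z Y from funext fun y' => hθ y' Y Z,
    Finset.sum_congr rfl fun i _ => hθ y (Function.update Y i _) Z,
    Finset.sum_congr rfl fun i _ => hθ y Y (Function.update Z i _)]
  ring

theorem covDeriv2_transpose {p : ℕ} (G : LocalMetric n) {θ : LocalForm n p p}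
    (hθ : ∀ y Y Z, θ y Y Z = θ y Z Y) (y u v : Model n) (Y Z : Fin p → Model n) :
    covDeriv2 G θ y u v Y Z = covDeriv2 G θ y u v Z Y := by
  have h := covDeriv_transpose G hθ
  simp only [covDeriv2]
  rw [show (fun y' => covDeriv G θ y' v Y Z) = fun y' => covDeriv G θ y' v Z Y from
      funext fun y' => h y' v Y Z, h y _ Y Z,
    Finset.sum_congr rfl fun i _ => h y v (Function.update Y i _) Z,
    Finset.sum_congr rfl fun i _ => h y v Y (Function.update Z i _)]
  ring

variable {p q : ℕ} {G : LocalMetric n} {U : Set (Model n)} (hG : IsRiemannianOn G U)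
  {y : Model n} (hy : y ∈ U)

section

variable {Θ : Model n → DoubleForm p q (Model n)}
  (hΘ : ∀ Y Z, ContDiffOn ℝ ∞ (fun y => Θ y Y Z) U)

include hΘ in
theorem contDiffOn_joint (W : Fin p ⊕ Fin q → Model n) :
    ContDiffOn ℝ ∞ (fun y => joint (Θ y) W) U := by
  rw [← Sum.elim_comp_inl_inr W]
  simp only [joint_apply]
  exact hΘ _ _

include hG hy hΘ

theorem differentiableAt_covDeriv (v : Model n) (Y : Fin p → Model n) (Z : Fin q → Model n) :
    DifferentiableAt ℝ (fun y' => covDeriv G (fun y Y Z => Θ y Y Z) y' v Y Z) y := by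
  simp only [covDeriv_eq_cov]
  exact differentiableAt_cov hG (contDiffOn_joint hΘ) hy v _

theorem covDeriv2_sub_covDeriv2 (u v : Model n) (Y : Fin p → Model n) (Z : Fin q → Model n) :
    covDeriv2 G (fun y Y Z => Θ y Y Z) y u v Y Z - covDeriv2 G (fun y Y Z => Θ y Y Z) y v u Y Z =
      - ∑ i, Θ y (Function.update Y i (localCurvature G y u v (Y i))) Z
      - ∑ j, Θ y Y (Function.update Z j (localCurvature G y u v (Z j))) := by
  rw [covDeriv2_eq_cov2, covDeriv2_eq_cov2, cov2_sub_cov2 hG (contDiffOn_joint hΘ) hy]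
  simp only [Fintype.sum_sum_type, Sum.elim_inl, Sum.elim_inr,
    Sum.update_elim_inl, Sum.update_elim_inr, joint_apply]
  ring

/-- Alternation is parallel, so no curvature appears. Among the corrections in the Y-slots of the
i-th summand, the one in slot i corrects the direction of differentiation and the others correct the
remaining arguments; together they complete ∂_u ∇ to ∇². -/
theorem covDeriv_localD (u : Model n) (Y : Fin (p + 1) → Model n) (Z : Fin q → Model n) :
    covDeriv G (localD G (fun y Y Z => Θ y Y Z)) y u Y Z = ∑ i : Fin (p + 1), (-1 : ℝ) ^ (i : ℕ) *
      covDeriv2 G (fun y Y Z => Θ y Y Z) y u (Y i) (i.removeNth Y) Z := by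
  have hd := differentiableAt_covDeriv hG hy hΘ
  unfold covDeriv2
  rw [covDeriv]
  unfold localD
  rw [fderiv_fun_sum fun i _ => (hd _ _ _).const_mul _]
  simp only [fun i : Fin (p + 1) =>
    fderiv_const_mul (hd (Y i) (i.removeNth Y) Z) ((-1 : ℝ) ^ (i : ℕ)), _root_.sum_apply,
    _root_.smul_apply, smul_eq_mul]
  rw [Finset.sum_comm, Finset.sum_comm (s := Finset.univ (α := Fin q)), ← Finset.sum_sub_distrib,
    ← Finset.sum_sub_distrib]
  refine Finset.sum_congr rfl fun i _ => ?_
  rw [Fin.sum_univ_succAbove _ i]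
  simp only [Function.update_self, Fin.removeNth_update, Fin.removeNth_update_succAbove,
    Function.update_of_ne (Fin.ne_succAbove i _), ← Finset.mul_sum]
  simp only [Fin.removeNth_apply]
  ring

end

variable {Θ : Model n → DoubleForm (p + 1) q (Model n)}
  (hΘ : ∀ Y Z, ContDiffOn ℝ ∞ (fun y => Θ y Y Z) U)
include hG hy hΘ

/-- ∇ commutes with the trace defining δ, by `fderiv_contraction`. -/
theorem covDeriv_localDelta (u : Model n) (Y : Fin p → Model n) (Z : Fin q → Model n) :
    covDeriv G (localDelta G (fun y Y Z => Θ y Y Z)) y u Y Z = - ∑ a,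
      covDeriv2 G (fun y Y Z => Θ y Y Z) y u (frame a) (Fin.cons (dualFrame G y a) Y) Z := by
  have hc := fderiv_contraction hG hy
    (B := fun y v w => covDeriv G (fun y Y Z => Θ y Y Z) y v (Fin.cons w Y) Z)
    (fun v w => by
      simp only [covDeriv_eq_cov]
      exact cov_eq_sum G _ y v _)
    (fun y' hy' v w => by
      have := cov_update_eq_sum hG (contDiffOn_joint hΘ) hy' v
        (Sum.elim (Fin.cons w Y) Z) (Sum.inl 0) w
      simpa only [covDeriv_eq_cov, Sum.update_elim_inl, Fin.update_cons_zero] using this)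
    (fun v w => differentiableAt_covDeriv hG hy hΘ v _ Z) u
  unfold covDeriv2
  rw [covDeriv]
  unfold localDelta
  rw [fderiv_fun_neg]
  simp only [neg_apply]
  rw [hc]
  simp only [Fin.sum_univ_succ, Fin.update_cons_zero, Fin.cons_zero, Fin.cons_succ,
    ← Fin.cons_update, Finset.sum_neg_distrib]
  rw [Finset.sum_comm, Finset.sum_comm (s := Finset.univ (α := Fin q))]
  simp only [Finset.sum_sub_distrib, Finset.sum_add_distrib]
  ring

/-- The Weitzenböck formula. -/
theorem localLaplacian_eq (Y : Fin (p + 1) → Model n) (Z : Fin q → Model n) :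
    localLaplacian G (fun y Y Z => Θ y Y Z) y Y Z =
      - ∑ a, covDeriv2 G (fun y Y Z => Θ y Y Z) y (frame a) (dualFrame G y a) Y Z
      - ∑ i, ∑ a, (Θ y (Function.update Y i
          (localCurvature G y (frame a) (Y i) (dualFrame G y a))) Z
        + ∑ k ∈ Finset.univ.erase i, Θ y (Function.update (Function.update Y k
          (localCurvature G y (frame a) (Y i) (Y k))) i (dualFrame G y a)) Z
        + ∑ l, Θ y (Function.update Y i (dualFrame G y a))
          (Function.update Z l (localCurvature G y (frame a) (Y i) (Z l)))) := by
  -- Moving the first argument back to position i costs i transpositions, which absorbs the sign of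
  -- D.
  have hsign : ∀ (i : Fin (p + 1)) (w : Model n) (Y : Fin (p + 1) → Model n) (Z : Fin q → Model n),
      (-1 : ℝ) ^ (i : ℕ) * Θ y (Fin.cons w (i.removeNth Y)) Z = Θ y (Function.update Y i w) Z := by
    intro i w Y Z
    have h := congrArg (fun f => f Z)
      (AlternatingMap.neg_one_pow_smul_map_insertNth (Θ y) i w (i.removeNth Y))
    rw [Fin.insertNth_removeNth] at h
    rw [show (Fin.cons w (i.removeNth Y) : Fin (p + 1) → Model n) =
      Matrix.vecCons w (i.removeNth Y) from rfl, ← h]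
    simp [← mul_assoc, ← pow_add]
  have hR := covDeriv2_sub_covDeriv2 hG hy hΘ
  -- Dδ contains ∇² in the order (Y_i, e_a) and δD in the order (e_a, Y_i), with opposite signs, so
  -- the Ricci identity leaves curvature only. The slot holding the dual vector gives the Ricci
  -- term, the other Y-slots the double sum, and the Z-slots the cross term.
  have hterm : ∀ (i : Fin (p + 1)) (a : Fin n), (-1 : ℝ) ^ (i : ℕ) *
      (covDeriv2 G (fun y Y Z => Θ y Y Z) y (frame a) (Y i)
          (Fin.cons (dualFrame G y a) (i.removeNth Y)) Z
        - covDeriv2 G (fun y Y Z => Θ y Y Z) y (Y i) (frame a)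
          (Fin.cons (dualFrame G y a) (i.removeNth Y)) Z) =
      - (Θ y (Function.update Y i
          (localCurvature G y (frame a) (Y i) (dualFrame G y a))) Z
        + ∑ k ∈ Finset.univ.erase i, Θ y (Function.update (Function.update Y k
          (localCurvature G y (frame a) (Y i) (Y k))) i (dualFrame G y a)) Z
        + ∑ l, Θ y (Function.update Y i (dualFrame G y a))
          (Function.update Z l (localCurvature G y (frame a) (Y i) (Z l)))) := by
    intro i a
    rw [hR, Fin.sum_univ_succ, Finset.sum_erase_eq_sub (Finset.mem_univ i),
      Fin.sum_univ_succAbove _ i]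
    simp only [Fin.update_cons_zero, Fin.cons_zero, Fin.cons_succ, ← Fin.cons_update]
    simp only [← hsign, ← Finset.mul_sum, Fin.removeNth_update_succAbove]
    simp only [Fin.removeNth_apply]
    ring
  have h1 : localD G (localDelta G (fun y Y Z => Θ y Y Z)) y Y Z = - ∑ i : Fin (p + 1), ∑ a,
      (-1 : ℝ) ^ (i : ℕ) * covDeriv2 G (fun y Y Z => Θ y Y Z) y (Y i) (frame a)
          (Fin.cons (dualFrame G y a) (i.removeNth Y)) Z := by
    rw [localD]
    simp only [covDeriv_localDelta hG hy hΘ, mul_neg, Finset.mul_sum, Finset.sum_neg_distrib]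
  -- Slot 0 of D, filled with the contracted vector, gives the rough Laplacian; slot i + 1 carries
  -- the sign −(−1)^i and gives the mixed terms.
  have h2 : localDelta G (localD G (fun y Y Z => Θ y Y Z)) y Y Z =
      - ∑ a, covDeriv2 G (fun y Y Z => Θ y Y Z) y (frame a) (dualFrame G y a) Y Z
      + ∑ i : Fin (p + 1), ∑ a, (-1 : ℝ) ^ (i : ℕ) *
        covDeriv2 G (fun y Y Z => Θ y Y Z) y (frame a) (Y i)
          (Fin.cons (dualFrame G y a) (i.removeNth Y)) Z := by
    rw [localDelta]
    simp only [covDeriv_localD hG hy hΘ]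
    have hrem : ∀ (i : Fin (p + 1)) (w : Model n), (Fin.removeNth i.succ (Fin.cons w Y :
        Fin (p + 2) → Model n) : Fin (p + 1) → Model n) = Fin.cons w (i.removeNth Y) := by
      intro i w
      ext1 j
      refine Fin.cases ?_ (fun j => ?_) j <;> simp [Fin.removeNth_apply]
    rw [Finset.sum_comm (s := Finset.univ (α := Fin (p + 1))), ← Finset.sum_neg_distrib,
      ← Finset.sum_neg_distrib, ← Finset.sum_add_distrib]
    refine Finset.sum_congr rfl fun a _ => ?_
    rw [Fin.sum_univ_succ]
    simp only [Fin.cons_zero, Fin.cons_succ, hrem, Fin.removeNth_zero, Fin.tail_cons, Fin.val_zero,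
      pow_zero, Fin.val_succ, pow_succ, mul_neg_one, neg_mul, one_mul, Finset.sum_neg_distrib,
      neg_add, neg_neg]
  have h3 : localLaplacian G (fun y Y Z => Θ y Y Z) y Y Z =
    localD G (localDelta G (fun y Y Z => Θ y Y Z)) y Y Z +
      localDelta G (localD G (fun y Y Z => Θ y Y Z)) y Y Z := rfl
  rw [h3, h1, h2]
  have h4 := Finset.sum_congr (rfl : (Finset.univ : Finset (Fin (p + 1))) = _) fun i _ =>
    Finset.sum_congr (rfl : (Finset.univ : Finset (Fin n)) = _) fun a _ => hterm i a
  simp only [mul_sub, Finset.sum_neg_distrib, Finset.sum_sub_distrib] at h4 ⊢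
  linarith

end CovDeriv

/-! ### Algebraic curvature tensors and inner products -/

section Algebra

variable {V : Type*} [AddCommGroup V] [Module ℝ V]

/-- The algebraic symmetries of the Riemann tensor. -/
structure IsCurvatureForm (T : V → V → V → V → ℝ) : Prop where
  add : ∀ v v' w z u, T (v + v') w z u = T v w z u + T v' w z u
  smul : ∀ (c : ℝ) v w z u, T (c • v) w z u = c * T v w z u
  antisymm : ∀ v w z u, T v w z u = - T w v z u
  skew : ∀ v w z u, T v w z u = - T v w u z
  bianchi : ∀ v w z u, T v w z u + T w z v u + T z v w u = 0

namespace IsCurvatureForm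

variable {T T' : V → V → V → V → ℝ} (hT : IsCurvatureForm T)
include hT

/-- The octahedron argument: a signed sum of the four cyclic instances of the Bianchi identity,
simplified by skewness in both pairs. -/
theorem pair (v w z u : V) : T v w z u = T z u v w := by
  have h1 := hT.bianchi v w z u
  have h2 := hT.bianchi w z u v
  have h3 := hT.bianchi z u v w
  have h4 := hT.bianchi u v w z
  have a1 := hT.skew w z u v
  have a2 := hT.skew z u v w
  have a3 := hT.skew u v w z
  have a4 := hT.skew v w z u
  have b1 := hT.antisymm z v w u
  have b2 := hT.antisymm u w z v
  have b3 := hT.antisymm z v u w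
  have b4 := hT.skew v z w u
  have b5 := hT.skew z v w u
  have b6 := hT.skew w u z v
  have b7 := hT.antisymm w u z v
  have b8 := hT.skew w u v z
  have b9 := hT.skew u w v z
  have c1 := hT.antisymm v u w z
  have c2 := hT.antisymm w v z u
  have c3 := hT.antisymm w v u z
  have c4 := hT.skew u v z w
  have c5 := hT.skew z u w v
  have c6 := hT.skew v z u w
  have c7 := hT.antisymm w u v z
  have c8 := hT.antisymm v z u w
  linarith

theorem sub (hT' : IsCurvatureForm T') :
    IsCurvatureForm fun v w z u => T v w z u - T' v w z u where
  add v v' w z u := by rw [hT.add, hT'.add]; ring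
  smul c v w z u := by rw [hT.smul, hT'.smul]; ring
  antisymm v w z u := by rw [hT.antisymm, hT'.antisymm]; ring
  skew v w z u := by rw [hT.skew, hT'.skew]; ring
  bianchi v w z u := by linarith [hT.bianchi v w z u, hT'.bianchi v w z u]

theorem add₂ (v w w' z u : V) : T v (w + w') z u = T v w z u + T v w' z u := by
  rw [hT.antisymm, hT.add, hT.antisymm w, hT.antisymm w']; ring

theorem smul₂ (c : ℝ) (v w z u : V) : T v (c • w) z u = c * T v w z u := by
  rw [hT.antisymm, hT.smul, hT.antisymm w]; ring

theorem add₃ (v w z z' u : V) : T v w (z + z') u = T v w z u + T v w z' u := by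
  rw [hT.pair, hT.add, hT.pair z, hT.pair z']

theorem smul₃ (c : ℝ) (v w z u : V) : T v w (c • z) u = c * T v w z u := by
  rw [hT.pair, hT.smul, hT.pair z]

theorem add₄ (v w z u u' : V) : T v w z (u + u') = T v w z u + T v w z u' := by
  rw [hT.pair, hT.add₂, hT.pair z, hT.pair z]

theorem smul₄ (c : ℝ) (v w z u : V) : T v w z (c • u) = c * T v w z u := by
  rw [hT.pair, hT.smul₂, hT.pair z]

theorem self_left (v z u : V) : T v v z u = 0 := by
  linarith [hT.antisymm v v z u]

theorem self_right (v w z : V) : T v w z z = 0 := by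
  linarith [hT.skew v w z z]

/-- A curvature form with vanishing sectional curvatures vanishes. -/
theorem eq_zero (h : ∀ v w, T v w v w = 0) (v w z u : V) : T v w z u = 0 := by
  have h1 : ∀ v w u, T v w v u = 0 := fun v w u => by
    have := h v (w + u)
    rw [hT.add₂, hT.add₄, hT.add₄, h, h, hT.pair v u v w] at this
    linarith
  -- Polarization in the first and third arguments. With skewness in the first pair, T is then
  -- invariant under cyclic permutations of its first three arguments, so the Bianchi identity reads
  -- 3T = 0.
  have h2 : ∀ v w z u, T v w z u = - T z w v u := fun v w z u => by
    have := h1 (v + z) w u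
    rw [hT.add, hT.add₃, hT.add₃, h1, h1] at this
    linarith
  have h3 := hT.bianchi v w z u
  have h4 := h2 w z v u
  have h5 := hT.antisymm v z w u
  have h6 := h2 v w z u
  have h7 := hT.antisymm z w v u
  have h8 := h2 z v w u
  have h9 := hT.antisymm w v z u
  linarith

end IsCurvatureForm

/-- Inner products. -/
structure IsInner (g : LinearMap.BilinForm ℝ V) : Prop where
  symm : ∀ v w, g v w = g w v
  pos : ∀ v, v ≠ 0 → 0 < g v v

theorem isCurvatureForm_kulkarniNomizu {g h : LinearMap.BilinForm ℝ V}
    (hg : ∀ v w, g v w = g w v) (hh : ∀ v w, h v w = h w v) :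
    IsCurvatureForm (kulkarniNomizu (fun a b => g a b) (fun a b => h a b)) where
  add v v' w z u := by simp [kulkarniNomizu]; ring
  smul c v w z u := by simp [kulkarniNomizu]; ring
  antisymm v w z u := by simp only [kulkarniNomizu]; ring
  skew v w z u := by simp only [kulkarniNomizu]; ring
  bianchi v w z u := by
    simp only [kulkarniNomizu]
    rw [hg z w, hg z v, hg w v, hh z w, hh z v, hh w v]; ring

/-- A `g`-orthonormal basis. -/
structure IsFrame {n : ℕ} (g : LinearMap.BilinForm ℝ V) (e : Fin n → V) : Prop where
  apply : ∀ i j, g (e i) (e j) = if i = j then 1 else 0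
  sum : ∀ v, ∑ i, g v (e i) • e i = v

namespace IsInner

variable {g : LinearMap.BilinForm ℝ V} (hg : IsInner g)
include hg

theorem nonneg (v : V) : 0 ≤ g v v := by
  rcases eq_or_ne v 0 with rfl | h
  · simp
  · exact (hg.pos v h).le

theorem eq_zero_of_forall {v : V} (h : ∀ w, g v w = 0) : v = 0 := by
  by_contra hv
  exact (hg.pos v hv).ne' (h v)

theorem ext_apply {v w : V} (h : ∀ z, g v z = g w z) : v = w := by
  rw [← sub_eq_zero]
  apply hg.eq_zero_of_forall
  intro z
  rw [map_sub, LinearMap.sub_apply, h, sub_self]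

theorem exists_frame_extending [FiniteDimensional ℝ V] {n : ℕ} (hn : Module.finrank ℝ V = n)
    (v : Fin n → V) (s : Set (Fin n))
    (hv : ∀ i ∈ s, ∀ j ∈ s, g (v i) (v j) = if i = j then 1 else 0) :
    ∃ e : Fin n → V, IsFrame g e ∧ ∀ i ∈ s, e i = v i := by
  -- The structure of an inner product space given by g is installed locally, in order to extend an
  -- orthonormal family to a basis.
  let core : InnerProductSpace.Core ℝ V :=
    { inner := fun v w => g v w
      conj_inner_symm := fun x y => by simpa using hg.symm y x
      re_inner_nonneg := fun x => by simpa using hg.nonneg x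
      add_left := fun x y z => by simp
      smul_left := fun x y r => by simp
      definite := fun x hx => by
        by_contra h
        exact (hg.pos x h).ne' hx }
  let : NormedAddCommGroup V := core.toNormedAddCommGroup
  let : InnerProductSpace ℝ V := InnerProductSpace.ofCore core.toCore
  have hin : ∀ x y : V, inner ℝ x y = g x y := fun _ _ => rfl
  have ho : Orthonormal ℝ (s.domRestrict v) := by
    rw [orthonormal_iff_ite]
    intro i j
    rw [hin]
    simpa [Subtype.ext_iff] using hv i i.2 j j.2
  obtain ⟨b, hb⟩ := ho.exists_orthonormalBasis_extension_of_card_eq (by simpa using hn)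
  refine ⟨b, ⟨fun i j => ?_, fun v => ?_⟩, hb⟩
  · rw [← hin]
    exact orthonormal_iff_ite.1 b.orthonormal i j
  · conv_rhs => rw [← b.sum_repr v]
    refine Finset.sum_congr rfl fun i _ => ?_
    rw [b.repr_apply_apply, hin, hg.symm]

theorem exists_frame [FiniteDimensional ℝ V] {n : ℕ} (hn : Module.finrank ℝ V = n) :
    ∃ e : Fin n → V, IsFrame g e := by
  obtain ⟨e, he, -⟩ := hg.exists_frame_extending hn 0 ∅ (by simp)
  exact ⟨e, he⟩

theorem exists_frame_pair [FiniteDimensional ℝ V] {n : ℕ} (hn : Module.finrank ℝ V = n)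
    {i j : Fin n} (hij : i ≠ j) {v w : V} (hv : g v v = 1) (hw : g w w = 1) (hvw : g v w = 0) :
    ∃ e : Fin n → V, IsFrame g e ∧ e i = v ∧ e j = w := by
  obtain ⟨e, he, h⟩ := hg.exists_frame_extending hn (fun k => if k = i then v else w) {i, j} (by
    rintro a (rfl | rfl) b (rfl | rfl) <;> simp [hij, hij.symm, hv, hw, hvw, hg.symm w v])
  refine ⟨e, he, ?_, ?_⟩
  · rw [h i (by simp)]; simp
  · rw [h j (by simp)]; simp [hij.symm]

/-- A curvature form vanishes if its sectional curvatures on orthonormal pairs do. -/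
theorem curvatureForm_eq_zero {T : V → V → V → V → ℝ} (hT : IsCurvatureForm T)
    (h : ∀ v w, g v v = 1 → g w w = 1 → g v w = 0 → T v w v w = 0) (v w z u : V) :
    T v w z u = 0 := by
  refine hT.eq_zero (fun v w => ?_) v w z u
  have hz : ∀ w z u, T 0 w z u = 0 := fun w z u => by
    have := hT.smul 0 0 w z u
    simpa using this
  have hnorm : ∀ v, v ≠ 0 → ∃ c : ℝ, ∃ v', v = c • v' ∧ g v' v' = 1 := fun v hv => by
    have h0 := hg.pos v hv
    have hs : √(g v v) ≠ 0 := (Real.sqrt_pos.2 h0).ne'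
    refine ⟨√(g v v), (√(g v v))⁻¹ • v, by rw [smul_smul, mul_inv_cancel₀ hs, one_smul], ?_⟩
    simp only [map_smul, LinearMap.smul_apply, smul_eq_mul]
    rw [← mul_assoc, ← mul_inv, Real.mul_self_sqrt h0.le, inv_mul_cancel₀ h0.ne']
  rcases eq_or_ne v 0 with rfl | hv
  · exact hz _ _ _
  obtain ⟨c, v', rfl, hv'⟩ := hnorm v hv
  have hw : T v' w v' w = 0 := by
    -- One Gram–Schmidt step: the component along `v'` contributes nothing, by skewness in each
    -- pair.
    have hsplit : w = g w v' • v' + (w - g w v' • v') := by abel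
    have ho : g v' (w - g w v' • v') = 0 := by simp [hv', hg.symm w v']
    set w' := w - g w v' • v'
    have hz2 : T v' w' v' w' = 0 := by
      rcases eq_or_ne w' 0 with h0 | h0
      · rw [h0, hT.antisymm, hz, neg_zero]
      obtain ⟨d, w'', hd, hw''⟩ := hnorm w' h0
      rw [hd, hT.smul₂, hT.smul₄, h v' w'' hv' hw'' ?_]
      · simp
      · have hd0 : d ≠ 0 := by
          rintro rfl
          simp [hd] at h0
        rw [hd] at ho
        simpa [hd0] using ho
    rw [hsplit, hT.add₂, hT.add₄, hT.add₄, hT.smul₂, hT.smul₂, hT.smul₄, hT.self_left,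
      hT.self_left, hT.smul₄, hT.self_right, hz2]
    simp
  rw [hT.smul, hT.smul₃, hw]
  simp

/-- A symmetric bilinear form that is constant on unit vectors is a multiple of `g`. -/
theorem bilin_eq_smul [FiniteDimensional ℝ V] {h : LinearMap.BilinForm ℝ V}
    (hh : ∀ v w, h v w = h w v) (hc : ∀ v w, g v v = 1 → g w w = 1 → g v w = 0 → h v v = h w w) :
    ∃ c : ℝ, ∀ v w, h v w = c * g v w := by
  obtain ⟨e, he⟩ := hg.exists_frame (n := Module.finrank ℝ V) rfl
  have hii : ∀ i, g (e i) (e i) = 1 := fun i => by rw [he.apply, if_pos rfl]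
  obtain ⟨c, hcc⟩ : ∃ c : ℝ, ∀ i, h (e i) (e i) = c := by
    rcases isEmpty_or_nonempty (Fin (Module.finrank ℝ V)) with hE | ⟨⟨i⟩⟩
    · exact ⟨0, fun i => hE.elim i⟩
    · refine ⟨h (e i) (e i), fun j => ?_⟩
      rcases eq_or_ne j i with rfl | hj
      · rfl
      · exact hc _ _ (hii j) (hii i) (by rw [he.apply, if_neg hj])
  -- Rotation by 45 degrees: equal values of h on (e_i ± e_j)/√2 kill the off-diagonal entry.
  have hoff : ∀ i j, i ≠ j → h (e i) (e j) = 0 := fun i j hij => by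
    have hr : (√2)⁻¹ * (√2)⁻¹ = (1 / 2 : ℝ) := by
      rw [← mul_inv, Real.mul_self_sqrt (by norm_num)]; norm_num
    have := hc ((√2)⁻¹ • (e i + e j)) ((√2)⁻¹ • (e i - e j)) ?_ ?_ ?_
    · simp only [map_smul, map_add, map_sub, LinearMap.smul_apply, LinearMap.add_apply,
        LinearMap.sub_apply, smul_eq_mul, hh (e j) (e i)] at this
      linear_combination (1 / 2) * this - 2 * h (e i) (e j) * hr
    all_goals
      simp only [map_smul, map_add, map_sub, LinearMap.smul_apply, LinearMap.add_apply,
        LinearMap.sub_apply, smul_eq_mul, he.apply, hij, hij.symm, if_true, if_false]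
      norm_num
    all_goals linear_combination 2 * hr
  refine ⟨c, fun v w => ?_⟩
  have hexp : ∀ b : LinearMap.BilinForm ℝ V, b v w =
      ∑ i, ∑ j, g v (e i) * (g w (e j) * b (e i) (e j)) := fun b => by
    conv_lhs => rw [← he.sum v, ← he.sum w]
    simp only [map_sum, map_smul, LinearMap.sum_apply, LinearMap.smul_apply, smul_eq_mul,
      Finset.mul_sum]
    rw [Finset.sum_comm]
    exact Finset.sum_congr rfl fun i _ => Finset.sum_congr rfl fun j _ => by ring
  rw [hexp h, hexp g, Finset.mul_sum]
  refine Finset.sum_congr rfl fun i _ => ?_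
  rw [Finset.mul_sum]
  refine Finset.sum_congr rfl fun j _ => ?_
  rcases eq_or_ne i j with rfl | hij
  · rw [hcc, hii]; ring
  · rw [hoff i j hij, he.apply, if_neg hij]; ring

end IsInner

end Algebra

/-! ### The Weitzenböck operator on forms -/

section Weitzenbock

variable {V : Type*} [AddCommGroup V] [Module ℝ V] {n p : ℕ}

/-- The Weitzenböck curvature operator on functions of `p` vectors. -/
def weitzenbock (R : V → V → V → V) (e : Fin n → V) (w : (Fin p → V) → ℝ) (Y : Fin p → V) : ℝ :=
  ∑ i, w (Function.update Y i (∑ a, R (Y i) (e a) (e a))) -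
    ∑ i, ∑ k ∈ Finset.univ.erase i, ∑ a,
      w (Function.update (Function.update Y k (R (e a) (Y i) (Y k))) i (e a))

omit [Module ℝ V] in
theorem weitzenbock_add (R : V → V → V → V) (e : Fin n → V) (w w' : (Fin p → V) → ℝ)
    (Y : Fin p → V) : weitzenbock R e (fun Y => w Y + w' Y) Y =
      weitzenbock R e w Y + weitzenbock R e w' Y := by
  simp only [weitzenbock, Finset.sum_add_distrib]
  ring

omit [Module ℝ V] in
theorem weitzenbock_mul (R : V → V → V → V) (e : Fin n → V) (w : (Fin p → V) → ℝ) (c : ℝ)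
    (Y : Fin p → V) : weitzenbock R e (fun Y => w Y * c) Y = weitzenbock R e w Y * c := by
  simp only [weitzenbock, ← Finset.sum_mul]
  ring

/-- An alternating form as a bilinear form in two of its arguments. -/
def slots (w : V [⋀^Fin p]→ₗ[ℝ] ℝ) (Y : Fin p → V) {i k : Fin p} (h : i ≠ k) :
    LinearMap.BilinForm ℝ V :=
  LinearMap.mk₂ ℝ (fun x x' => w (Function.update (Function.update Y k x) i x'))
    (fun x y x' => by simp only [Function.update_comm h.symm, AlternatingMap.map_update_add])
    (fun c x x' => by simp only [Function.update_comm h.symm, AlternatingMap.map_update_smul])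
    (fun x y y' => by simp only [AlternatingMap.map_update_add])
    (fun c x y => by simp only [AlternatingMap.map_update_smul])

theorem slots_apply (w : V [⋀^Fin p]→ₗ[ℝ] ℝ) (Y : Fin p → V) {i k : Fin p} (h : i ≠ k)
    (x x' : V) : slots w Y h x x' = w (Function.update (Function.update Y k x) i x') :=
  rfl

theorem slots_self (w : V [⋀^Fin p]→ₗ[ℝ] ℝ) (Y : Fin p → V) {i k : Fin p} (h : i ≠ k) (x : V) :
    slots w Y h x x = 0 :=
  w.map_eq_zero_of_eq _ (by simp [h.symm]) h

theorem slots_swap (w : V [⋀^Fin p]→ₗ[ℝ] ℝ) (Y : Fin p → V) {i k : Fin p} (h : i ≠ k)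
    (x x' : V) : slots w Y h x x' = - slots w Y h x' x := by
  have := slots_self w Y h (x + x')
  simp only [map_add, LinearMap.add_apply, slots_self] at this
  linarith

namespace IsFrame

variable {g : LinearMap.BilinForm ℝ V} {e : Fin n → V} (he : IsFrame g e)
include he

theorem self (i : Fin n) : g (e i) (e i) = 1 := by rw [he.apply, if_pos rfl]

theorem of_ne {i j : Fin n} (h : i ≠ j) : g (e i) (e j) = 0 := by rw [he.apply, if_neg h]

theorem linear_apply {W : Type*} [AddCommGroup W] [Module ℝ W] (f : V →ₗ[ℝ] W) (v : V) :
    ∑ a, g v (e a) • f (e a) = f v := by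
  conv_rhs => rw [← he.sum v, map_sum]
  simp

/-- The curvature operator of `g · h`. -/
theorem weitzenbock_kulkarniNomizu (hg : ∀ v w, g v w = g w v) {h : LinearMap.BilinForm ℝ V}
    (hh : ∀ v w, h v w = h w v) {H : V →ₗ[ℝ] V} (hH : ∀ v w, g (H v) w = h v w)
    {R : V → V → V → V}
    (hR : ∀ v w u, R v w u = h w u • v + g w u • H v - g v u • H w - h v u • w)
    (w : V [⋀^Fin p]→ₗ[ℝ] ℝ) (Y : Fin p → V) :
    weitzenbock R e w Y = (n - 2 * p) * ∑ i, w (Function.update Y i (H (Y i))) +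
      p * (∑ a, h (e a) (e a)) * w Y := by
  -- The Ricci endomorphism of g·h: the factor n of H loses 2 through the two subtracted terms.
  have hric : ∀ v, ∑ a, R v (e a) (e a) = (∑ a, h (e a) (e a)) • v + ((n : ℝ) - 2) • H v := by
    intro v
    simp only [hR, he.self, Finset.sum_sub_distrib, Finset.sum_add_distrib, he.linear_apply H,
      ← Finset.sum_smul]
    rw [show ∑ a, h v (e a) • e a = H v by simp only [← hH]; exact he.sum _]
    simp only [Finset.sum_const, Finset.card_univ, Fintype.card_fin, nsmul_eq_mul, mul_one]
    module
  have hterm : ∀ i k : Fin p, k ∈ Finset.univ.erase i → ∑ a,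
      w (Function.update (Function.update Y k (R (e a) (Y i) (Y k))) i (e a)) =
      w (Function.update Y i (H (Y i))) + w (Function.update Y k (H (Y k))) := by
    intro i k hik
    have hik : i ≠ k := (Finset.ne_of_mem_erase hik).symm
    simp only [← slots_apply w Y hik, hR, map_add, map_sub, map_smul, LinearMap.add_apply,
      LinearMap.sub_apply, LinearMap.smul_apply, slots_self, smul_zero, zero_add,
      Finset.sum_sub_distrib]
    -- The symmetric h is contracted with a form that is alternating in the two slots.
    have h1 : ∑ a, g (Y i) (Y k) • slots w Y hik (H (e a)) (e a) = 0 := by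
      rw [← Finset.smul_sum]
      have hx : ∑ a, slots w Y hik (H (e a)) (e a) = - ∑ a, slots w Y hik (H (e a)) (e a) := by
        have e1 : ∀ a, slots w Y hik (H (e a)) (e a) =
            ∑ b, h (e a) (e b) * slots w Y hik (e b) (e a) := fun a => by
          rw [← LinearMap.flip_apply, ← he.linear_apply (LinearMap.flip (slots w Y hik) (e a)) (H (e a))]
          simp [hH]
        conv_lhs => rw [Finset.sum_congr rfl fun a _ => e1 a, Finset.sum_comm]
        rw [Finset.sum_congr rfl fun a _ => e1 a, ← Finset.sum_neg_distrib]
        refine Finset.sum_congr rfl fun a _ => ?_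
        rw [← Finset.sum_neg_distrib]
        refine Finset.sum_congr rfl fun b _ => ?_
        rw [hh (e b), slots_swap w Y hik (e a)]
        ring
      rw [show ∑ a, slots w Y hik (H (e a)) (e a) = 0 by linarith, smul_zero]
    have h2 : ∑ a, g (e a) (Y k) • slots w Y hik (H (Y i)) (e a) =
        - w (Function.update Y i (H (Y i))) := by
      simp only [hg _ (Y k)]
      rw [he.linear_apply, slots_swap, slots_apply, Function.update_eq_self]
    have h3 : ∑ a, h (e a) (Y k) • slots w Y hik (Y i) (e a) =
        - w (Function.update Y k (H (Y k))) := by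
      simp only [hh _ (Y k), ← hH]
      rw [he.linear_apply, slots_swap, slots_apply, Function.update_comm hik.symm,
        Function.update_eq_self]
    rw [h1, h2, h3]
    ring
  -- Each slot occurs in 2(p − 1) of the ordered pairs, and (n − 2) − 2(p − 1) = n − 2p.
  rw [weitzenbock, Finset.sum_congr rfl fun i _ => Finset.sum_congr rfl (hterm i)]
  simp only [hric, AlternatingMap.map_update_add, AlternatingMap.map_update_smul,
    Function.update_eq_self, Finset.sum_add_distrib, smul_eq_mul, ← Finset.mul_sum,
    Finset.sum_const, Finset.card_univ,
    Fintype.card_fin, Finset.sum_erase_eq_sub (Finset.mem_univ _), Finset.sum_sub_distrib,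
    nsmul_eq_mul]
  ring

/-- The Weitzenböck operator on a coordinate form of an orthonormal frame. -/
theorem weitzenbock_apply_frame {R : V → V → V → V}
    (hT : IsCurvatureForm fun v w z u => g (R v w u) z)
    {s : Fin p → Fin n} {w : V [⋀^Fin p]→ₗ[ℝ] ℝ} (hw : w (e ∘ s) = 1)
    (hw0 : ∀ (Y : Fin p → V) i b, b ∉ Set.range s → Y i = e b → w Y = 0) :
    weitzenbock R e w (e ∘ s) = ∑ i, ∑ a, g (R (e (s i)) (e a) (e a)) (e (s i)) -
      ∑ i, ∑ k ∈ Finset.univ.erase i, g (R (e (s i)) (e (s k)) (e (s k))) (e (s i)) := by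
  have hsingle : ∀ i u, w (Function.update (e ∘ s) i u) = g u (e (s i)) := by
    intro i u
    have h1 := he.linear_apply (w.toMultilinearMap.toLinearMap (e ∘ s) i) u
    simp only [MultilinearMap.toLinearMap_apply, smul_eq_mul] at h1
    refine h1.symm.trans ?_
    rw [Finset.sum_eq_single (s i)]
    · rw [show Function.update (e ∘ s) i (e (s i)) = e ∘ s from Function.update_eq_self i (e ∘ s)]
      exact (congrArg _ hw).trans (mul_one _)
    · intro b _ hb
      have : w (Function.update (e ∘ s) i (e b)) = 0 := by
        by_cases hbs : b ∈ Set.range s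
        · obtain ⟨l, rfl⟩ := hbs
          have hl : l ≠ i := fun h => hb (by rw [h])
          exact w.map_eq_zero_of_eq _ (by simp [hl]) hl
        · exact hw0 _ i b hbs (by simp)
      exact (congrArg _ this).trans (mul_zero _)
    · simp
  have hdouble : ∀ i k, k ∈ Finset.univ.erase i → ∑ a,
      w (Function.update (Function.update (e ∘ s) k (R (e a) (e (s i)) (e (s k)))) i (e a)) =
      g (R (e (s i)) (e (s k)) (e (s k))) (e (s i)) := by
    intro i k hik
    have hik : i ≠ k := (Finset.ne_of_mem_erase hik).symm
    rw [Finset.sum_eq_single (s k)]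
    · rw [← slots_apply w _ hik, slots_swap, slots_apply,
        show Function.update (e ∘ s) k (e (s k)) = e ∘ s from Function.update_eq_self k (e ∘ s),
        hsingle]
      have := hT.antisymm (e (s k)) (e (s i)) (e (s i)) (e (s k))
      rw [this, neg_neg]
    -- Apart from b = s k every term is zero: R(e_b, e_b) = 0 if b = s i, a repeated argument if b
    -- is another index of s, and `hw0` if b lies outside s.
    · intro b _ hb
      by_cases hbi : b = s i
      · subst hbi
        rw [Function.update_comm hik.symm,
          show Function.update (e ∘ s) i (e (s i)) = e ∘ s from Function.update_eq_self i (e ∘ s),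
          hsingle]
        exact hT.self_left _ _ _
      by_cases hbs : b ∈ Set.range s
      · obtain ⟨l, rfl⟩ := hbs
        have hl : l ≠ i := fun h => hbi (by rw [h])
        have hlk : l ≠ k := fun h => hb (by rw [h])
        exact w.map_eq_zero_of_eq _ (by simp [hl, hlk]) hl
      · exact hw0 _ i b hbs (by simp)
    · simp
  rw [weitzenbock, Finset.sum_congr rfl fun i _ => hsingle i _]
  simp only [Function.comp_apply, map_sum, LinearMap.sum_apply]
  rw [Finset.sum_congr rfl fun i _ => Finset.sum_congr rfl (hdouble i)]

theorem exists_coordinate_form (s : Fin p → Fin n) (hs : Function.Injective s) :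
    ∃ w : V [⋀^Fin p]→ₗ[ℝ] ℝ, w (e ∘ s) = 1 ∧
      ∀ (Y : Fin p → V) i b, b ∉ Set.range s → Y i = e b → w Y = 0 := by
  -- The wedge product of the covectors dual to the e (s i), as a determinant.
  refine ⟨Matrix.detRowAlternating.compLinearMap (LinearMap.pi fun i => g.flip (e (s i))), ?_, ?_⟩
  · rw [AlternatingMap.compLinearMap_apply]
    have : (fun i => (LinearMap.pi fun i => g.flip (e (s i))) ((e ∘ s) i)) =
        (1 : Matrix (Fin p) (Fin p) ℝ) := by
      ext i j
      simp [he.apply, Matrix.one_apply, hs.eq_iff]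
    rw [this]
    exact Matrix.det_one
  · intro Y i b hb hY
    rw [AlternatingMap.compLinearMap_apply]
    refine AlternatingMap.map_coord_zero _ i ?_
    ext j
    have hbj : b ≠ s j := fun h => hb ⟨j, h.symm⟩
    simp [hY, he.of_ne hbj]

end IsFrame

/-- Terms not involving position k₀ are the same for both index families. Those involving it occur
twice in the sum over ordered pairs, by symmetry of K; hence the factor 2. -/
theorem sum_sub_sum_update {r : Fin n → ℝ} {K : Fin n → Fin n → ℝ} (hK : ∀ i j, K i j = K j i)
    (s : Fin p → Fin n) (k₀ : Fin p) (j : Fin n)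
    (h : ∑ i, r (s i) - ∑ i, ∑ k ∈ Finset.univ.erase i, K (s i) (s k) =
      ∑ i, r (Function.update s k₀ j i) - ∑ i, ∑ k ∈ Finset.univ.erase i,
        K (Function.update s k₀ j i) (Function.update s k₀ j k)) :
    r (s k₀) - 2 * ∑ k ∈ Finset.univ.erase k₀, K (s k₀) (s k) =
      r j - 2 * ∑ k ∈ Finset.univ.erase k₀, K j (s k) := by
  have key : ∀ t : Fin p → Fin n, ∑ i, r (t i) - ∑ i, ∑ k ∈ Finset.univ.erase i, K (t i) (t k) =
      r (t k₀) - 2 * ∑ k ∈ Finset.univ.erase k₀, K (t k₀) (t k) +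
      (∑ i ∈ Finset.univ.erase k₀, r (t i) - ∑ i ∈ Finset.univ.erase k₀,
        ∑ k ∈ (Finset.univ.erase i).erase k₀, K (t i) (t k)) := by
    intro t
    rw [← Finset.add_sum_erase _ _ (Finset.mem_univ k₀),
      ← Finset.add_sum_erase _ (fun i => ∑ k ∈ Finset.univ.erase i, K (t i) (t k))
        (Finset.mem_univ k₀)]
    have : ∑ i ∈ Finset.univ.erase k₀, ∑ k ∈ Finset.univ.erase i, K (t i) (t k) =
        ∑ i ∈ Finset.univ.erase k₀, (K (t k₀) (t i) +
          ∑ k ∈ (Finset.univ.erase i).erase k₀, K (t i) (t k)) := by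
      refine Finset.sum_congr rfl fun i hi => ?_
      rw [hK (t k₀), Finset.add_sum_erase _ (fun k => K (t i) (t k))]
      exact Finset.mem_erase.2 ⟨(Finset.ne_of_mem_erase hi).symm, Finset.mem_univ _⟩
    rw [this, Finset.sum_add_distrib]
    ring
  have hu : ∀ i ∈ Finset.univ.erase k₀, Function.update s k₀ j i = s i := fun i hi =>
    Function.update_of_ne (Finset.ne_of_mem_erase hi) _ _
  rw [key s, key (Function.update s k₀ j), Function.update_self,
    Finset.sum_congr rfl fun i hi => congrArg r (hu i hi),
    Finset.sum_congr rfl fun i hi => congrArg (K j) (hu i hi)] at h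
  have h3 : ∑ i ∈ Finset.univ.erase k₀, ∑ k ∈ (Finset.univ.erase i).erase k₀,
        K (Function.update s k₀ j i) (Function.update s k₀ j k) =
      ∑ i ∈ Finset.univ.erase k₀, ∑ k ∈ (Finset.univ.erase i).erase k₀, K (s i) (s k) := by
    refine Finset.sum_congr rfl fun i hi => Finset.sum_congr rfl fun k hk => ?_
    rw [hu i hi, hu k (Finset.mem_erase.2 ⟨Finset.ne_of_mem_erase hk, Finset.mem_univ _⟩)]
  rw [h3] at h
  linarith

/-- The Weitzenböck operator, acting on one group of arguments, maps the symmetric products of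
two `p`-forms to symmetric double forms. -/
def WeitzenbockSymmetric (R : V → V → V → V) (e : Fin n → V) (p : ℕ) : Prop :=
  ∀ (α β : V [⋀^Fin p]→ₗ[ℝ] ℝ) (Y Z : Fin p → V),
    weitzenbock R e α Y * β Z + weitzenbock R e β Y * α Z =
      weitzenbock R e α Z * β Y + weitzenbock R e β Z * α Y

/-- Let α, β be the coordinate forms of s and of s with s k₀ replaced by j. Each is 1 on its own
frame vectors and 0 on those of the other, so symmetry at this pair of arguments reduces to equality
of two diagonal entries of the operator. -/
theorem IsFrame.ricci_sub_eq {g : LinearMap.BilinForm ℝ V} {e : Fin n → V} (he : IsFrame g e)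
    {R : V → V → V → V} (hT : IsCurvatureForm fun v w z u => g (R v w u) z)
    (hW : WeitzenbockSymmetric R e p) {s : Fin p → Fin n} (hs : Function.Injective s)
    (k₀ : Fin p) {j : Fin n} (hj : j ∉ Set.range s) :
    ∑ a, g (R (e (s k₀)) (e a) (e a)) (e (s k₀)) -
        2 * ∑ k ∈ Finset.univ.erase k₀, g (R (e (s k₀)) (e (s k)) (e (s k))) (e (s k₀)) =
      ∑ a, g (R (e j) (e a) (e a)) (e j) -
        2 * ∑ k ∈ Finset.univ.erase k₀, g (R (e j) (e (s k)) (e (s k))) (e j) := by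
  have hs' : Function.Injective (Function.update s k₀ j) := by
    intro a b hab
    by_cases ha : a = k₀ <;> by_cases hb : b = k₀
    · rw [ha, hb]
    · subst ha
      rw [Function.update_self, Function.update_of_ne hb] at hab
      exact (hj ⟨b, hab.symm⟩).elim
    · subst hb
      rw [Function.update_self, Function.update_of_ne ha] at hab
      exact (hj ⟨a, hab⟩).elim
    · rw [Function.update_of_ne ha, Function.update_of_ne hb] at hab
      exact hs hab
  have hk : s k₀ ∉ Set.range (Function.update s k₀ j) := by
    rintro ⟨l, hl⟩
    by_cases hlk : l = k₀
    · subst hlk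
      rw [Function.update_self] at hl
      exact hj ⟨l, hl.symm⟩
    · rw [Function.update_of_ne hlk] at hl
      exact hlk (hs hl)
  obtain ⟨α, hα, hα0⟩ := he.exists_coordinate_form s hs
  obtain ⟨β, hβ, hβ0⟩ := he.exists_coordinate_form _ hs'
  have h := hW α β (e ∘ s) (e ∘ Function.update s k₀ j)
  rw [hα, hβ, hβ0 (e ∘ s) k₀ (s k₀) hk rfl, hα0 (e ∘ Function.update s k₀ j) k₀ j hj (by simp),
    he.weitzenbock_apply_frame hT hα hα0, he.weitzenbock_apply_frame hT hβ hβ0] at h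
  simp only [mul_one, mul_zero, add_zero, zero_add] at h
  exact sum_sub_sum_update (r := fun i => ∑ a, g (R (e i) (e a) (e a)) (e i))
    (K := fun i j => g (R (e i) (e j) (e j)) (e i)) (fun i j => by
      rw [hT.antisymm (e i) (e j) (e i) (e j), hT.skew (e j) (e i) (e i) (e j), neg_neg]) s k₀ j h

end Weitzenbock

/-! ### Pointwise algebra: from a symmetric Weitzenböck operator to the curvature, and back -/

section Pointwise

variable {V : Type*} [AddCommGroup V] [Module ℝ V] {n p : ℕ}

theorem exists_injective_avoiding {i a j b : Fin n} (hia : i ≠ a) (hij : i ≠ j) (hib : i ≠ b)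
    (haj : a ≠ j) (hab : a ≠ b) (hjb : j ≠ b) (hp : 2 ≤ p) (hpn : p + 2 ≤ n) :
    ∃ (s : Fin p → Fin n) (k₀ k₁ : Fin p), Function.Injective s ∧ k₀ ≠ k₁ ∧ s k₀ = i ∧ s k₁ = a ∧
      j ∉ Set.range s ∧ b ∉ Set.range s := by
  let x : Fin 4 ↪ Fin n := ⟨![⟨0, by omega⟩, ⟨1, by omega⟩, ⟨p, by omega⟩, ⟨p + 1, by omega⟩], by
    intro c d h
    fin_cases c <;> fin_cases d <;> simp at h ⊢ <;> omega⟩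
  let y : Fin 4 ↪ Fin n := ⟨![i, a, j, b], by
    intro c d h
    fin_cases c <;> fin_cases d <;> simp_all [eq_comm]⟩
  -- A permutation carrying the positions 0, 1, p, p + 1 to i, a, j, b; the family s is its
  -- restriction to the first p positions.
  obtain ⟨σ, hσ⟩ := (Equiv.Perm.isMultiplyPretransitive (Fin n) 4).exists_smul_eq x y
  have hσ' : ∀ c, σ (x c) = y c := fun c => congrArg (fun f => f c) hσ
  refine ⟨fun k => σ ⟨k, by omega⟩, ⟨0, by omega⟩, ⟨1, by omega⟩, ?_, by simp, hσ' 0, hσ' 1, ?_, ?_⟩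
  · intro c d h
    simpa [Fin.ext_iff] using h
  · rintro ⟨k, hk⟩
    have h1 := congrArg Fin.val (σ.injective (hk.trans (hσ' 2).symm))
    have h2 : (x 2 : ℕ) = p := rfl
    rw [h2] at h1
    simp only at h1
    omega
  · rintro ⟨k, hk⟩
    have h1 := congrArg Fin.val (σ.injective (hk.trans (hσ' 3).symm))
    have h2 : (x 3 : ℕ) = p + 1 := rfl
    rw [h2] at h1
    simp only at h1
    omega

/-- A trace-free array of sectional curvatures with the four-index symmetry vanishes. -/
theorem eq_zero_of_four_index (hn : 3 ≤ n) {K : Fin n → Fin n → ℝ} (hK : ∀ i j, K i j = K j i)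
    (hK0 : ∀ i, K i i = 0) (hrow : ∀ i, ∑ a, K i a = 0)
    (h4 : ∀ i j a b, i ≠ j → a ≠ b → i ≠ a → i ≠ b → j ≠ a → j ≠ b →
      K i a - K i b = K j a - K j b) (i a : Fin n) : K i a = 0 := by
  have hcard : ∀ a b : Fin n, a ≠ b → (((Finset.univ.erase a).erase b).card : ℝ) = n - 2 := by
    intro a b hab
    rw [Finset.card_erase_of_mem (Finset.mem_erase.2 ⟨hab.symm, Finset.mem_univ _⟩),
      Finset.card_erase_of_mem (Finset.mem_univ _), Finset.card_univ, Fintype.card_fin,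
      Nat.sub_sub, Nat.cast_sub (by omega)]
    norm_num
  have hn' : (3 : ℝ) ≤ n := by exact_mod_cast hn
  have h1 : ∀ i a b, a ≠ b → i ≠ a → i ≠ b → K i a = K i b := by
    intro i a b hab hia hib
    -- Whole columns sum to zero and the omitted entries cancel. By the four-index identity all n −
    -- 2 summands are equal. For n = 3 there is just one summand, so that identity is not needed.
    have hsum : ∑ j ∈ (Finset.univ.erase a).erase b, (K j a - K j b) = 0 := by
      rw [Finset.sum_erase_eq_sub (Finset.mem_erase.2 ⟨hab.symm, Finset.mem_univ _⟩),
        Finset.sum_erase_eq_sub (Finset.mem_univ _), Finset.sum_sub_distrib]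
      have hcol : ∀ c, ∑ j, K j c = 0 := fun c => by
        rw [← hrow c]
        exact Finset.sum_congr rfl fun j _ => hK j c
      rw [hcol, hcol, hK0, hK0, hK b a]
      ring
    have hconst : ∀ j ∈ (Finset.univ.erase a).erase b, K j a - K j b = K i a - K i b := by
      intro j hj
      simp only [Finset.mem_erase, Finset.mem_univ, and_true] at hj
      rcases eq_or_ne j i with rfl | hji
      · rfl
      · exact h4 j i a b hji hab hj.2 hj.1 hia hib
    rw [Finset.sum_congr rfl hconst, Finset.sum_const, nsmul_eq_mul, hcard a b hab] at hsum
    rcases mul_eq_zero.1 hsum with h | h <;> linarith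
  rcases eq_or_ne i a with rfl | hia
  · exact hK0 i
  have h2 : ∀ b ∈ Finset.univ.erase i, K i b = K i a := by
    intro b hb
    rcases eq_or_ne b a with rfl | hba
    · rfl
    · exact h1 i b a hba (Finset.ne_of_mem_erase hb).symm hia
  have h3 := hrow i
  rw [← Finset.add_sum_erase _ _ (Finset.mem_univ i), hK0, zero_add, Finset.sum_congr rfl h2,
    Finset.sum_const, Finset.card_erase_of_mem (Finset.mem_univ _), Finset.card_univ,
    Fintype.card_fin, nsmul_eq_mul, Nat.cast_sub (by omega)] at h3
  rcases mul_eq_zero.1 h3 with h | h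
  · norm_num at h; linarith
  · exact h

theorem IsFrame.sum_mul {g : LinearMap.BilinForm ℝ V} {e : Fin n → V} (he : IsFrame g e)
    (b : LinearMap.BilinForm ℝ V) {e' : Fin n → V} (he' : IsFrame g e') (hg : ∀ v w, g v w = g w v) :
    ∑ a, b (e a) (e a) = ∑ a, b (e' a) (e' a) := by
  have h1 : ∀ a, b (e a) (e a) = ∑ c, g (e a) (e' c) * b (e a) (e' c) := fun a => by
    have := he'.linear_apply (b (e a)) (e a)
    simpa using this.symm
  rw [Finset.sum_congr rfl fun a _ => h1 a, Finset.sum_comm]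
  refine Finset.sum_congr rfl fun c _ => ?_
  have := he.linear_apply (LinearMap.flip b (e' c)) (e' c)
  simp only [LinearMap.flip_apply, smul_eq_mul] at this
  rw [← this]
  exact Finset.sum_congr rfl fun a _ => by rw [hg]

variable {g : LinearMap.BilinForm ℝ V} (hg : IsInner g) {R : V → V → V → V}
  (hT : IsCurvatureForm fun v w z u => g (R v w u) z) {ric : LinearMap.BilinForm ℝ V}
  (hric : ∀ e : Fin n → V, IsFrame g e → ∀ v w, ric v w = ∑ a, g (R v (e a) (e a)) w)
  (hW : ∀ e : Fin n → V, IsFrame g e → WeitzenbockSymmetric R e p)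

include hg in
theorem IsInner.two_le_finrank [FiniteDimensional ℝ V] {v w : V} (hv : g v v = 1) (hw : g w w = 1)
    (hvw : g v w = 0) : 2 ≤ Module.finrank ℝ V := by
  have : LinearIndependent ℝ ![v, w] := by
    rw [LinearIndependent.pair_iff]
    intro s t h
    have h1 := congrArg (g v) h
    have h2 := congrArg (g w) h
    simp [hv, hvw, hw, hg.symm w v] at h1 h2
    exact ⟨h1, h2⟩
  simpa using this.fintype_card_le_finrank

include hT hric in
theorem ricci_symm (he : ∃ e : Fin n → V, IsFrame g e) (v w : V) : ric v w = ric w v := by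
  obtain ⟨e, he⟩ := he
  rw [hric e he, hric e he]
  exact Finset.sum_congr rfl fun a _ => hT.pair _ _ _ _

include hg hT hric in
-- For p = 1 the double sum is empty and the diagonal entries are those of Ric, so Ric takes equal
-- values on the two vectors of any orthonormal pair.
theorem exists_ricci_eq_of_weitzenbock_one [FiniteDimensional ℝ V] (hn : Module.finrank ℝ V = n)
    (hW : ∀ e : Fin n → V, IsFrame g e → WeitzenbockSymmetric R e 1) :
    ∃ c : ℝ, ∀ v w, ric v w = c * g v w := by
  refine hg.bilin_eq_smul (ricci_symm hT hric (hg.exists_frame hn)) fun v w hv hw hvw => ?_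
  have h2 := hg.two_le_finrank hv hw hvw
  have hij : (⟨0, by omega⟩ : Fin n) ≠ ⟨1, by omega⟩ := by simp
  obtain ⟨e, he, rfl, rfl⟩ := hg.exists_frame_pair hn hij hv hw hvw
  have := he.ricci_sub_eq hT (hW e he) (s := fun _ => ⟨0, by omega⟩)
    (fun a b _ => Subsingleton.elim a b) 0 (j := ⟨1, by omega⟩) (by simp)
  simpa [hric e he] using this

include hT in
-- The exchange of i for j is applied to an index set containing i and a, and again with a replaced
-- by b. On subtraction the Ricci terms and all common indices drop out. For (n, p) = (3, 2) there
-- are no four distinct indices.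
theorem four_index_of_weitzenbock (hp : (2 ≤ p ∧ p + 2 ≤ n) ∨ (p = 2 ∧ n = 3)) {e : Fin n → V}
    (he : IsFrame g e) (hW : WeitzenbockSymmetric R e p) {i j a b : Fin n} (hij : i ≠ j)
    (hab : a ≠ b) (hia : i ≠ a) (hib : i ≠ b) (hja : j ≠ a) (hjb : j ≠ b) :
    g (R (e i) (e a) (e a)) (e i) - g (R (e i) (e b) (e b)) (e i) =
      g (R (e j) (e a) (e a)) (e j) - g (R (e j) (e b) (e b)) (e j) := by
  rcases hp with ⟨hp, hpn⟩ | ⟨rfl, rfl⟩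
  swap
  · omega
  obtain ⟨s, k₀, k₁, hs, hk, rfl, rfl, hj, hb⟩ :=
    exists_injective_avoiding hia hij hib hja.symm hab hjb hp hpn
  have h1 := he.ricci_sub_eq hT hW hs k₀ hj
  have hs' : Function.Injective (Function.update s k₁ b) := by
    intro c d hcd
    by_cases hc : c = k₁ <;> by_cases hd : d = k₁
    · rw [hc, hd]
    · subst hc
      rw [Function.update_self, Function.update_of_ne hd] at hcd
      exact (hb ⟨d, hcd.symm⟩).elim
    · subst hd
      rw [Function.update_self, Function.update_of_ne hc] at hcd
      exact (hb ⟨c, hcd⟩).elim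
    · rw [Function.update_of_ne hc, Function.update_of_ne hd] at hcd
      exact hs hcd
  have hj' : j ∉ Set.range (Function.update s k₁ b) := by
    rintro ⟨c, hc⟩
    by_cases h : c = k₁
    · subst h
      rw [Function.update_self] at hc
      exact hjb hc.symm
    · rw [Function.update_of_ne h] at hc
      exact hj ⟨c, hc⟩
  have h2 := he.ricci_sub_eq hT hW hs' k₀ hj'
  rw [Function.update_of_ne hk] at h2
  have hmem : k₁ ∈ Finset.univ.erase k₀ := Finset.mem_erase.2 ⟨hk.symm, Finset.mem_univ _⟩
  have hsplit : ∀ (t : Fin p → Fin n) (f : Fin n → ℝ), ∑ k ∈ Finset.univ.erase k₀, f (t k) =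
      f (t k₁) + ∑ k ∈ (Finset.univ.erase k₀).erase k₁, f (t k) := fun t f =>
    (Finset.add_sum_erase _ (fun k => f (t k)) hmem).symm
  have hoff : ∀ f : Fin n → ℝ, ∑ k ∈ (Finset.univ.erase k₀).erase k₁, f (Function.update s k₁ b k) =
      ∑ k ∈ (Finset.univ.erase k₀).erase k₁, f (s k) := fun f =>
    Finset.sum_congr rfl fun k hk => by rw [Function.update_of_ne (Finset.ne_of_mem_erase hk)]
  rw [hsplit s fun c => g (R (e (s k₀)) (e c) (e c)) (e (s k₀)),
    hsplit s fun c => g (R (e j) (e c) (e c)) (e j)] at h1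
  rw [hsplit _ fun c => g (R (e (s k₀)) (e c) (e c)) (e (s k₀)),
    hsplit _ fun c => g (R (e j) (e c) (e c)) (e j), hoff fun c => g (R (e (s k₀)) (e c) (e c)) (e (s k₀)),
    hoff fun c => g (R (e j) (e c) (e c)) (e j), Function.update_self] at h2
  linarith

include hg hT hric hW in
-- The array of g·h in a frame is h_ii + h_jj off the diagonal, which satisfies the four-index
-- identity for any h. The Schouten tensor is the choice making R − g·h Ricci-free, so that
-- `eq_zero_of_four_index` applies in every frame.
theorem exists_kulkarniNomizu_of_weitzenbock [FiniteDimensional ℝ V] (hn : Module.finrank ℝ V = n)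
    (hp : (2 ≤ p ∧ p + 2 ≤ n) ∨ (p = 2 ∧ n = 3)) :
    ∃ h : LinearMap.BilinForm ℝ V, (∀ v w, h v w = h w v) ∧
      (∀ v w z u, g (R v w u) z = kulkarniNomizu (fun a b => g a b) (fun a b => h a b) v w z u) ∧
      (n ≠ 2 * p → ∃ c : ℝ, ∀ v w, h v w = c * g v w) := by
  have hn3 : 3 ≤ n := by omega
  have hn3' : (3 : ℝ) ≤ n := by exact_mod_cast hn3
  have hn1 : (n : ℝ) - 1 ≠ 0 := by linarith
  have hn2 : (n : ℝ) - 2 ≠ 0 := by linarith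
  obtain ⟨e₀, he₀⟩ := hg.exists_frame hn
  have hrs := ricci_symm hT hric ⟨e₀, he₀⟩
  set S : ℝ := ∑ a, ric (e₀ a) (e₀ a) with hS
  -- The solution of (n − 2) h + (tr h) g = Ric; taking traces, tr h = S / (2(n − 1)).
  let h : LinearMap.BilinForm ℝ V := ((n : ℝ) - 2)⁻¹ • (ric - (S / (2 * (n - 1))) • g)
  have hh : ∀ v w, h v w = (ric v w - S / (2 * (n - 1)) * g v w) / (n - 2) := fun v w => by
    simp only [h, LinearMap.smul_apply, LinearMap.sub_apply, smul_eq_mul]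
    ring
  have hhs : ∀ v w, h v w = h w v := fun v w => by rw [hh, hh, hrs, hg.symm]
  have hKN := isCurvatureForm_kulkarniNomizu hg.symm hhs
  have hTK := hT.sub hKN
  have hD : ∀ v w, g v v = 1 → g w w = 1 → g v w = 0 →
      g (R v w w) v - kulkarniNomizu (fun a b => g a b) (fun a b => h a b) v w v w = 0 := by
    intro v w hv hw hvw
    have hij : (⟨0, by omega⟩ : Fin n) ≠ ⟨1, by omega⟩ := by simp
    obtain ⟨e, he, rfl, rfl⟩ := hg.exists_frame_pair hn hij hv hw hvw
    refine eq_zero_of_four_index hn3 (K := fun i j => g (R (e i) (e j) (e j)) (e i) -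
      kulkarniNomizu (fun a b => g a b) (fun a b => h a b) (e i) (e j) (e i) (e j))
      ?_ ?_ ?_ ?_ _ _
    · intro i j
      have := hTK.antisymm (e i) (e j) (e i) (e j)
      have h2 := hTK.skew (e j) (e i) (e i) (e j)
      linarith
    · intro i
      exact hTK.self_left _ _ _
    · intro i
      rw [Finset.sum_sub_distrib, ← hric e he, sub_eq_zero]
      have htr : ∑ a, h (e a) (e a) = S / (2 * (n - 1)) := by
        have : ∑ a, ric (e a) (e a) = S := he.sum_mul ric he₀ hg.symm
        simp only [hh, ← Finset.sum_div, Finset.sum_sub_distrib, this, he.self, mul_one,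
          Finset.sum_const, Finset.card_univ, Fintype.card_fin, nsmul_eq_mul]
        field_simp
        ring
      have hoff : ∑ a, g (e i) (e a) * h (e a) (e i) = h (e i) (e i) := by
        have := he.linear_apply (LinearMap.flip h (e i)) (e i)
        simpa using this
      have hoff' : ∑ a, g (e a) (e i) * h (e i) (e a) = h (e i) (e i) := by
        rw [← hoff]
        exact Finset.sum_congr rfl fun a _ => by rw [hg.symm, hhs]
      simp only [kulkarniNomizu, he.self, Finset.sum_sub_distrib, Finset.sum_add_distrib, one_mul,
        hoff, hoff', htr, Finset.sum_const, Finset.card_univ, Fintype.card_fin, nsmul_eq_mul]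
      rw [hh (e i) (e i), he.self]
      field_simp
      ring
    · intro i j a b h1 h2 h3 h4 h5 h6
      have := four_index_of_weitzenbock hT hp he (hW e he) h1 h2 h3 h4 h5 h6
      simp only [kulkarniNomizu, he.self, he.of_ne h3, he.of_ne h3.symm, he.of_ne h4,
        he.of_ne h4.symm, he.of_ne h5, he.of_ne h5.symm, he.of_ne h6, he.of_ne h6.symm]
      linarith
  have hKNeq : ∀ v w z u, g (R v w u) z =
      kulkarniNomizu (fun a b => g a b) (fun a b => h a b) v w z u := fun v w z u =>
    sub_eq_zero.1 (hg.curvatureForm_eq_zero hTK hD v w z u)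
  refine ⟨h, hhs, hKNeq, fun hnp => hg.bilin_eq_smul hhs fun v w hv hw hvw => ?_⟩
  -- The orthonormal pair is placed at the indices 0 and n − 1. The family of the first p indices
  -- contains 0 but not n − 1, because p < n, so the two may be exchanged.
  have hij : (⟨0, by omega⟩ : Fin n) ≠ ⟨n - 1, by omega⟩ := by simp [Fin.ext_iff]; omega
  obtain ⟨e, he, rfl, rfl⟩ := hg.exists_frame_pair hn hij hv hw hvw
  have hpn : p < n := by omega
  have hs : Function.Injective (fun k : Fin p => (⟨k, by omega⟩ : Fin n)) := by
    intro c d hcd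
    simpa [Fin.ext_iff] using hcd
  have hj : (⟨n - 1, by omega⟩ : Fin n) ∉ Set.range (fun k : Fin p => (⟨k, by omega⟩ : Fin n)) := by
    rintro ⟨k, hk⟩
    simp [Fin.ext_iff] at hk
    omega
  have h1 := he.ricci_sub_eq hT (hW e he) hs ⟨0, by omega⟩ hj
  have hKij : ∀ i j, i ≠ j → g (R (e i) (e j) (e j)) (e i) = h (e i) (e i) + h (e j) (e j) := by
    intro i j hij
    rw [hKNeq]
    simp only [kulkarniNomizu, he.self, he.of_ne hij, he.of_ne hij.symm]
    ring
  have hKii : ∀ i, g (R (e i) (e i) (e i)) (e i) = 0 := fun i => hT.self_left _ _ _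
  have hrow : ∀ i, ∑ a, g (R (e i) (e a) (e a)) (e i) =
      (n - 2) * h (e i) (e i) + ∑ a, h (e a) (e a) := by
    intro i
    rw [← Finset.add_sum_erase _ _ (Finset.mem_univ i), hKii, zero_add,
      Finset.sum_congr rfl fun a ha => hKij i a (Finset.ne_of_mem_erase ha).symm,
      Finset.sum_add_distrib, Finset.sum_const, Finset.card_erase_of_mem (Finset.mem_univ _),
      Finset.card_univ, Fintype.card_fin, nsmul_eq_mul, Nat.cast_sub (by omega),
      Finset.sum_erase_eq_sub (Finset.mem_univ _)]
    push_cast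
    ring
  have hsum : ∀ i : Fin n, (∀ k ∈ Finset.univ.erase (⟨0, by omega⟩ : Fin p),
      i ≠ ⟨(k : Fin p), by omega⟩) → ∑ k ∈ Finset.univ.erase (⟨0, by omega⟩ : Fin p),
        g (R (e i) (e ⟨(k : Fin p), by omega⟩) (e ⟨(k : Fin p), by omega⟩)) (e i) =
      (p - 1) * h (e i) (e i) + ∑ k ∈ Finset.univ.erase (⟨0, by omega⟩ : Fin p),
        h (e ⟨(k : Fin p), by omega⟩) (e ⟨(k : Fin p), by omega⟩) := by
    intro i hi
    rw [Finset.sum_congr rfl fun k hk => hKij i _ (hi k hk), Finset.sum_add_distrib,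
      Finset.sum_const, Finset.card_erase_of_mem (Finset.mem_univ _), Finset.card_univ,
      Fintype.card_fin, nsmul_eq_mul, Nat.cast_sub (by omega)]
    push_cast
    ring
  rw [hrow, hrow, hsum, hsum] at h1
  · have h2 : ((n : ℝ) - 2 * p) ≠ 0 := by
      rw [sub_ne_zero]
      exact_mod_cast hnp
    -- The exchange identity contributes (n − 2) h_ii from Ric and −2(p − 1) h_ii from the sectional
    -- terms; the rest is common to both sides.
    have h3 : ((n : ℝ) - 2 * p) * (h (e ⟨0, by omega⟩) (e ⟨0, by omega⟩)) =
        ((n : ℝ) - 2 * p) * (h (e ⟨n - 1, by omega⟩) (e ⟨n - 1, by omega⟩)) := by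
      linear_combination h1
    exact mul_left_cancel₀ h2 h3
  · intro k hk h0
    exact hj ⟨k, h0.symm⟩
  · intro k hk h0
    exact (Finset.ne_of_mem_erase hk) (hs h0).symm

include hg in
/-- The curvature operator is a multiple of the identity if `R = g · h` and `n = 2p` or `h = c g`. -/
theorem exists_weitzenbock_eq_of_kulkarniNomizu {e : Fin n → V} (he : IsFrame g e)
    {h : LinearMap.BilinForm ℝ V} (hh : ∀ v w, h v w = h w v)
    (hR : ∀ v w z u, g (R v w u) z = kulkarniNomizu (fun a b => g a b) (fun a b => h a b) v w z u)
    (hc : n = 2 * p ∨ ∃ c : ℝ, ∀ v w, h v w = c * g v w) :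
    ∃ c : ℝ, ∀ (w : V [⋀^Fin p]→ₗ[ℝ] ℝ) (Y : Fin p → V), weitzenbock R e w Y = c * w Y := by
  -- The endomorphism obtained from h by raising an index with g.
  let H : V →ₗ[ℝ] V := ∑ b, (LinearMap.flip h (e b)).smulRight (e b)
  have hH : ∀ v w, g (H v) w = h v w := fun v w => by
    simp only [H, LinearMap.sum_apply, LinearMap.smulRight_apply, LinearMap.flip_apply, map_sum,
      map_smul, LinearMap.smul_apply, smul_eq_mul]
    have := he.linear_apply (h v) w
    simp only [smul_eq_mul] at this
    rw [← this]
    exact Finset.sum_congr rfl fun a _ => by rw [hg.symm]; ring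
  have hR' : ∀ v w u, R v w u = h w u • v + g w u • H v - g v u • H w - h v u • w := by
    intro v w u
    apply hg.ext_apply
    intro z
    rw [hR]
    simp only [kulkarniNomizu, map_add, map_sub, map_smul, LinearMap.add_apply,
      LinearMap.sub_apply, LinearMap.smul_apply, smul_eq_mul, hH]
    ring
  have key := fun w : V [⋀^Fin p]→ₗ[ℝ] ℝ => he.weitzenbock_kulkarniNomizu hg.symm hh hH hR' w
  rcases hc with hc | ⟨c, hc⟩
  · refine ⟨p * ∑ a, h (e a) (e a), fun w Y => ?_⟩
    have h0 : (n : ℝ) - 2 * p = 0 := by rw [sub_eq_zero]; exact_mod_cast hc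
    rw [key, h0]
    ring
  · have hHc : ∀ v, H v = c • v := fun v => by
      apply hg.ext_apply
      intro z
      rw [hH, hc]
      simp
    refine ⟨(n - 2 * p) * p * c + p * ∑ a, h (e a) (e a), fun w Y => ?_⟩
    rw [key]
    simp only [hHc, AlternatingMap.map_update_smul, Function.update_eq_self, Finset.sum_const,
      Finset.card_univ, Fintype.card_fin, nsmul_eq_mul, smul_eq_mul]
    ring

include hg hric in
theorem exists_weitzenbock_eq_of_einstein {e : Fin n → V} (he : IsFrame g e) {c : ℝ}
    (hc : ∀ v w, ric v w = c * g v w) (w : V [⋀^Fin 1]→ₗ[ℝ] ℝ) (Y : Fin 1 → V) :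
    weitzenbock R e w Y = c * w Y := by
  have : ∀ v, ∑ a, R v (e a) (e a) = c • v := fun v => by
    apply hg.ext_apply
    intro z
    simp only [map_sum, LinearMap.sum_apply, ← hric e he, hc, map_smul, LinearMap.smul_apply,
      smul_eq_mul]
  simp only [weitzenbock, this, AlternatingMap.map_update_smul, Function.update_eq_self,
    Finset.univ_unique, Finset.sum_singleton, Finset.erase_singleton, Finset.sum_empty, sub_zero,
    smul_eq_mul]

include hg hT hric in
/-- In dimension two, `Ric = c g` determines the Riemann tensor. -/
theorem kulkarniNomizu_of_einstein_two [FiniteDimensional ℝ V] (hn : Module.finrank ℝ V = n)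
    (hn2 : n = 2) {c : ℝ} (hc : ∀ v w, ric v w = c * g v w) (v w z u : V) :
    g (R v w u) z =
      kulkarniNomizu (fun a b => g a b) (fun a b => ((c / 2) • g) a b) v w z u := by
  subst hn2
  have hs : ∀ v w, ((c / 2) • g) v w = ((c / 2) • g) w v := fun v w => by
    simp [hg.symm v w]
  refine sub_eq_zero.1 (hg.curvatureForm_eq_zero (hT.sub (isCurvatureForm_kulkarniNomizu hg.symm hs))
    (fun v w hv hw hvw => ?_) v w z u)
  obtain ⟨e, he, rfl, rfl⟩ := hg.exists_frame_pair hn (show (0 : Fin 2) ≠ 1 by simp) hv hw hvw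
  have h1 := hric e he (e 0) (e 0)
  rw [Fin.sum_univ_two, hc, hv] at h1
  have h0 : g (R (e 0) (e 0) (e 0)) (e 0) = 0 := hT.self_left _ _ _
  simp only [kulkarniNomizu, LinearMap.smul_apply, smul_eq_mul, hv, hw, hvw]
  linarith

include hg hT in
/-- Constant sectional curvature determines the Riemann tensor. -/
theorem kulkarniNomizu_of_sectional {c : ℝ}
    (hc : ∀ v w, LinearIndependent ℝ ![v, w] →
      g (R v w w) v / (g v v * g w w - g v w ^ 2) = c) (v w z u : V) :
    g (R v w u) z =
      kulkarniNomizu (fun a b => g a b) (fun a b => ((c / 2) • g) a b) v w z u := by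
  have hs : ∀ v w, ((c / 2) • g) v w = ((c / 2) • g) w v := fun v w => by
    simp [hg.symm v w]
  refine sub_eq_zero.1 (hg.curvatureForm_eq_zero (hT.sub (isCurvatureForm_kulkarniNomizu hg.symm hs))
    (fun v w hv hw hvw => ?_) v w z u)
  have hli : LinearIndependent ℝ ![v, w] := by
    rw [LinearIndependent.pair_iff]
    intro s t h
    have h1 := congrArg (g v) h
    have h2 := congrArg (g w) h
    simp [hv, hvw, hw, hg.symm w v] at h1 h2
    exact ⟨h1, h2⟩
  have h1 := hc v w hli
  rw [hv, hw, hvw] at h1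
  simp only [kulkarniNomizu, LinearMap.smul_apply, smul_eq_mul, hv, hw, hvw, hg.symm w v]
  norm_num at h1
  linarith

include hg in
-- Strict Cauchy–Schwarz: the vector g(v,v) w − g(v,w) v is nonzero, and its squared length is
-- g(v,v) times the Gram determinant, the denominator of the sectional curvature.
theorem IsInner.gram_pos {v w : V} (h : LinearIndependent ℝ ![v, w]) :
    0 < g v v * g w w - g v w ^ 2 := by
  have hv : v ≠ 0 := by
    have := h.ne_zero 0
    simpa using this
  have hx : g v v • w - g v w • v ≠ 0 := fun h0 => by
    rw [LinearIndependent.pair_iff] at h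
    have := (h (- g v w) (g v v) (by rw [← h0]; module)).2
    exact (hg.pos v hv).ne' this
  have h1 := hg.pos _ hx
  simp only [map_sub, map_smul, LinearMap.sub_apply, LinearMap.smul_apply, smul_eq_mul,
    hg.symm w v] at h1
  have h2 : 0 < g v v * (g v v * g w w - g v w ^ 2) := by nlinarith
  exact (mul_pos_iff_of_pos_left (hg.pos v hv)).1 h2

end Pointwise

/-! ### Traces of the curvature and symmetry of the cross term -/

section CurvatureOperator

variable {V : Type*} [AddCommGroup V] [Module ℝ V] {n p q : ℕ}

/-- The alternating form obtained from a double form by fixing the second group of arguments. -/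
def evalRight (w : DoubleForm p q V) (Z : Fin q → V) : V [⋀^Fin p]→ₗ[ℝ] ℝ :=
  LinearMap.compAlternatingMap
    ({ toFun := fun a => a Z, map_add' := fun _ _ => rfl, map_smul' := fun _ _ => rfl } :
      (V [⋀^Fin q]→ₗ[ℝ] ℝ) →ₗ[ℝ] ℝ) w

/-- The bilinear form `(v, z) ↦ ∑ T(v, e_a; z, e_a)`. -/
def ricciForm {T : V → V → V → V → ℝ} (hT : IsCurvatureForm T) (e : Fin n → V) :
    LinearMap.BilinForm ℝ V :=
  LinearMap.mk₂ ℝ (fun v z => ∑ a, T v (e a) z (e a))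
    (fun v v' z => by simp only [hT.add, Finset.sum_add_distrib])
    (fun c v z => by simp only [hT.smul, Finset.mul_sum, smul_eq_mul])
    (fun v z z' => by simp only [hT.add₃, Finset.sum_add_distrib])
    (fun c v z => by simp only [hT.smul₃, Finset.mul_sum, smul_eq_mul])

/-- A curvature form as a bilinear form in its second and fourth arguments. -/
def secondFourth {T : V → V → V → V → ℝ} (hT : IsCurvatureForm T) (v z : V) :
    LinearMap.BilinForm ℝ V :=
  LinearMap.mk₂ ℝ (fun w u => T v w z u)
    (fun w w' u => hT.add₂ v w w' z u) (fun c w u => hT.smul₂ c v w z u)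
    (fun w u u' => hT.add₄ v w z u u') (fun c w u => hT.smul₄ c v w z u)

theorem ricciForm_eq {g : LinearMap.BilinForm ℝ V} (hg : IsInner g)
    {T : V → V → V → V → ℝ} (hT : IsCurvatureForm T) {e e' : Fin n → V} (he : IsFrame g e)
    (he' : IsFrame g e') (v w : V) : ricciForm hT e v w = ∑ a, T v (e' a) w (e' a) :=
  he.sum_mul (secondFourth hT v w) he' hg.symm

variable {g : LinearMap.BilinForm ℝ V} (hg : IsInner g) {R : V → V → V → V}
  (hT : IsCurvatureForm fun v w z u => g (R v w u) z)

/-- The curvature operator as a linear map of its first argument. -/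
def curvatureLin (w u : V) : V →ₗ[ℝ] V where
  toFun v := R v w u
  map_add' v v' := hg.ext_apply fun z => by
    simpa using hT.add v v' w z u
  map_smul' c v := hg.ext_apply fun z => by
    simpa using hT.smul c v w z u

include hT in
-- Expanding R(e_a, Y_i)Z_l in the frame, its coefficient along e_b equals that of R(e_b, Z_l)Y_i
-- along e_a by pair symmetry. Relabelling a and b and using the symmetry of θ gives the claim.
theorem curvature_cross_symm {e : Fin n → V} (he : IsFrame g e) {θ : DoubleForm p p V}
    (hθ : ∀ Y Z, θ Y Z = θ Z Y) (Y Z : Fin p → V) (i l : Fin p) :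
    ∑ a, θ (Function.update Y i (e a)) (Function.update Z l (R (e a) (Y i) (Z l))) =
      ∑ a, θ (Function.update Z l (e a)) (Function.update Y i (R (e a) (Z l) (Y i))) := by
  have hexp : ∀ (Y Z : Fin p → V) (i l : Fin p) (a : Fin n),
      θ (Function.update Y i (e a)) (Function.update Z l (R (e a) (Y i) (Z l))) =
      ∑ b, g (R (e a) (Y i) (Z l)) (e b) *
        θ (Function.update Y i (e a)) (Function.update Z l (e b)) := fun Y Z i l a => by
    have := he.linear_apply ((θ (Function.update Y i (e a))).toMultilinearMap.toLinearMap Z l)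
      (R (e a) (Y i) (Z l))
    exact this.symm
  rw [Finset.sum_congr rfl fun a _ => hexp Y Z i l a, Finset.sum_congr rfl fun a _ => hexp Z Y l i a,
    Finset.sum_comm]
  refine Finset.sum_congr rfl fun a _ => Finset.sum_congr rfl fun b _ => ?_
  rw [hθ (Function.update Z l (e a)) (Function.update Y i (e b))]
  congr 1
  exact hT.pair _ _ _ _

end CurvatureOperator

/-! ### The asymmetry of the Laplacian in coordinates -/

section LocalSymmetry

set_option maxSynthPendingDepth 5

variable {n p : ℕ} {G : LocalMetric n} {U : Set (Model n)}

/-- The metric at `y` as a bilinear form. -/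
def metricForm (G : LocalMetric n) (y : Model n) : LinearMap.BilinForm ℝ (Model n) :=
  LinearMap.mk₂ ℝ (fun v w => G y v w) (by simp) (by simp) (by simp) (by simp)

theorem metricForm_apply (G : LocalMetric n) (y v w : Model n) : metricForm G y v w = G y v w :=
  rfl

variable (hG : IsRiemannianOn G U) {y : Model n} (hy : y ∈ U)
include hG hy

theorem isInner_metricForm : IsInner (metricForm G y) where
  symm := hG.symm y hy
  pos := hG.pos y hy

theorem isCurvatureForm_local :
    IsCurvatureForm fun v w z u => metricForm G y (localCurvature G y v w u) z where
  add v v' w z u := by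
    simp only [hG.localCurvature_eq hy, map_add, map_sub, add_apply, LinearMap.add_apply,
      LinearMap.sub_apply]
    ring
  smul c v w z u := by
    simp only [hG.localCurvature_eq hy, map_add, map_sub, map_smul, _root_.smul_apply,
      LinearMap.add_apply, LinearMap.sub_apply, LinearMap.smul_apply, smul_eq_mul]
    ring
  antisymm v w z u := by
    rw [hG.localCurvature_antisymm hy, map_neg, LinearMap.neg_apply]
  skew v w z u := hG.localCurvature_metric_skew hy v w u z
  bianchi v w z u := by
    have h := congrArg (fun x => G y x u) (hG.localCurvature_bianchi hy v w z)
    simp only [map_add, add_apply, map_zero, zero_apply] at h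
    simp only [metricForm_apply]
    rw [hG.localCurvature_metric_skew hy v w u z, hG.localCurvature_metric_skew hy w z u v,
      hG.localCurvature_metric_skew hy z v u w]
    linarith

theorem sum_frame_dualFrame {e : Fin n → Model n} (he : IsFrame (metricForm G y) e)
    (b : LinearMap.BilinForm ℝ (Model n)) :
    ∑ a, b (frame a) (dualFrame G y a) = ∑ a, b (e a) (e a) := by
  have h1 : ∀ a, b (frame a) (dualFrame G y a) = ∑ k, (e k) a * b (frame a) (e k) := fun a => by
    rw [← he.linear_apply (b (frame a)) (dualFrame G y a)]
    simp only [metricForm_apply, hG.apply_dualFrame hy, smul_eq_mul]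
  rw [Finset.sum_congr rfl fun a _ => h1 a, Finset.sum_comm]
  exact Finset.sum_congr rfl fun k _ =>
    (linearMap_apply_eq_sum (LinearMap.flip b (e k)) (e k)).symm

/-- The Ricci tensor in coordinates. -/
theorem sum_localCurvature {e : Fin n → Model n} (he : IsFrame (metricForm G y) e) (v w : Model n) :
    ∑ a : Fin n, EuclideanSpace.proj (𝕜 := ℝ) a (localCurvature G y (frame a) v w) =
      ∑ a, metricForm G y (localCurvature G y v (e a) (e a)) w := by
  have hT := isCurvatureForm_local hG hy
  have h1 := sum_frame_dualFrame hG hy he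
    (LinearMap.mk₂ ℝ (fun x x' => metricForm G y (localCurvature G y x v w) x')
      (fun x x' z => hT.add x x' v z w) (fun c x z => hT.smul c x v z w)
      (fun x z z' => hT.add₃ x v z z' w) (fun c x z => hT.smul₃ c x v z w))
  simp only [LinearMap.mk₂_apply] at h1
  have h2 : ∀ a, metricForm G y (localCurvature G y (frame a) v w) (dualFrame G y a) =
      EuclideanSpace.proj (𝕜 := ℝ) a (localCurvature G y (frame a) v w) := fun a => by
    rw [(isInner_metricForm hG hy).symm]
    exact hG.apply_dualFrame hy a _
  rw [← Finset.sum_congr rfl fun a _ => h2 a, h1]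
  refine Finset.sum_congr rfl fun a _ => ?_
  have h3 := hT.antisymm (e a) v (e a) w
  have h4 := hT.skew v (e a) (e a) w
  rw [h3, h4, neg_neg]

/-- The asymmetry of the Laplacian of a symmetric double form. -/
theorem localLaplacian_sub_transpose {e : Fin n → Model n} (he : IsFrame (metricForm G y) e)
    {Θ : Model n → DoubleForm (p + 1) (p + 1) (Model n)}
    (hΘ : ∀ Y Z, ContDiffOn ℝ ∞ (fun y => Θ y Y Z) U) (hs : ∀ y Y Z, Θ y Y Z = Θ y Z Y)
    (Y Z : Fin (p + 1) → Model n) :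
    localLaplacian G (fun y Y Z => Θ y Y Z) y Y Z - localLaplacian G (fun y Y Z => Θ y Y Z) y Z Y =
      weitzenbock (localCurvature G y) e (fun Y => Θ y Y Z) Y -
        weitzenbock (localCurvature G y) e (fun Z => Θ y Z Y) Z := by
  have hg := isInner_metricForm hG hy
  have hT := isCurvatureForm_local hG hy
  have hric : ∀ v, ∑ a, localCurvature G y (frame a) v (dualFrame G y a) =
      - ∑ a, localCurvature G y v (e a) (e a) := by
    intro v
    apply hg.ext_apply
    intro z
    have h1 := sum_frame_dualFrame hG hy he (secondFourth hT v z)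
    simp only [secondFourth, LinearMap.mk₂_apply] at h1
    simp only [map_sum, map_neg, LinearMap.sum_apply, LinearMap.neg_apply, ← h1]
    rw [← Finset.sum_neg_distrib]
    exact Finset.sum_congr rfl fun a _ => hT.antisymm _ _ _ _
  -- The Weitzenböck formula with all traces taken in the orthonormal frame. The second and third
  -- terms are symmetric in (Y, Z), so only the first survives in the difference.
  have key : ∀ Y Z : Fin (p + 1) → Model n, localLaplacian G (fun y Y Z => Θ y Y Z) y Y Z =
      weitzenbock (localCurvature G y) e (fun Y => Θ y Y Z) Y
      - ∑ a, covDeriv2 G (fun y Y Z => Θ y Y Z) y (frame a) (dualFrame G y a) Y Z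
      - ∑ i, ∑ l, ∑ a, Θ y (Function.update Y i (e a))
          (Function.update Z l (localCurvature G y (e a) (Y i) (Z l))) := by
    intro Y Z
    rw [localLaplacian_eq hG hy hΘ, weitzenbock]
    have h1 : ∀ i, ∑ a, Θ y (Function.update Y i
        (localCurvature G y (frame a) (Y i) (dualFrame G y a))) Z =
        - Θ y (Function.update Y i (∑ a, localCurvature G y (Y i) (e a) (e a))) Z := by
      intro i
      let f := (evalRight (Θ y) Z).toMultilinearMap.toLinearMap Y i
      have h2 : ∑ a, f (localCurvature G y (frame a) (Y i) (dualFrame G y a)) =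
          - f (∑ a, localCurvature G y (Y i) (e a) (e a)) := by
        rw [← map_sum, hric, map_neg]
      exact h2
    have h2 : ∀ i, ∑ a, ∑ k ∈ Finset.univ.erase i, Θ y (Function.update (Function.update Y k
          (localCurvature G y (frame a) (Y i) (Y k))) i (dualFrame G y a)) Z =
        ∑ k ∈ Finset.univ.erase i, ∑ a, Θ y (Function.update (Function.update Y k
          (localCurvature G y (e a) (Y i) (Y k))) i (e a)) Z := by
      intro i
      rw [Finset.sum_comm]
      refine Finset.sum_congr rfl fun k hk => ?_
      have hik : i ≠ k := (Finset.ne_of_mem_erase hk).symm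
      exact sum_frame_dualFrame hG hy he
        (LinearMap.comp (slots (evalRight (Θ y) Z) Y hik) (curvatureLin hg hT (Y i) (Y k)))
    have h3 : ∀ i, ∑ a, ∑ l, Θ y (Function.update Y i (dualFrame G y a))
          (Function.update Z l (localCurvature G y (frame a) (Y i) (Z l))) =
        ∑ l, ∑ a, Θ y (Function.update Y i (e a))
          (Function.update Z l (localCurvature G y (e a) (Y i) (Z l))) := by
      intro i
      rw [Finset.sum_comm]
      refine Finset.sum_congr rfl fun l _ => ?_
      exact sum_frame_dualFrame hG hy he (LinearMap.mk₂ ℝ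
        (fun x x' => Θ y (Function.update Y i x')
          (Function.update Z l (curvatureLin hg hT (Y i) (Z l) x)))
        (fun x x' z => by rw [map_add, AlternatingMap.map_update_add])
        (fun c x z => by rw [map_smul, AlternatingMap.map_update_smul])
        (fun x z z' => by rw [AlternatingMap.map_update_add, AlternatingMap.add_apply])
        (fun c x z => by rw [AlternatingMap.map_update_smul, AlternatingMap.smul_apply]))
    simp only [Finset.sum_add_distrib, h1, h2, h3, Finset.sum_neg_distrib]
    ring
  have hc : ∑ i, ∑ l, ∑ a, Θ y (Function.update Y i (e a))
        (Function.update Z l (localCurvature G y (e a) (Y i) (Z l))) =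
      ∑ i, ∑ l, ∑ a, Θ y (Function.update Z i (e a))
        (Function.update Y l (localCurvature G y (e a) (Z i) (Y l))) := by
    rw [Finset.sum_comm]
    exact Finset.sum_congr rfl fun l _ => Finset.sum_congr rfl fun i _ =>
      curvature_cross_symm hT he (hs y) Y Z i l
  rw [key Y Z, key Z Y, hc,
    Finset.sum_congr rfl fun a _ => covDeriv2_transpose G hs y (frame a) (dualFrame G y a) Y Z]
  ring

end LocalSymmetry

/-! ### The second Bianchi identity and the local Schur lemma -/

section Bianchi

set_option maxSynthPendingDepth 5

variable {n : ℕ} {G : LocalMetric n} {U : Set (Model n)} (hG : IsRiemannianOn G U) {y : Model n}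
  (hy : y ∈ U)
include hG hy

theorem hasFDerivAt_localCurvature (v w z : Model n) :
    ∃ L : Model n →L[ℝ] Model n, HasFDerivAt (fun y' => localCurvature G y' v w z) L y ∧
      ∀ u, L u = fderiv ℝ (fderiv ℝ (christoffelCLM G)) y u v w z
        - fderiv ℝ (fderiv ℝ (christoffelCLM G)) y u w v z
        + (fderiv ℝ (christoffelCLM G) y u v (christoffelCLM G y w z)
          + christoffelCLM G y v (fderiv ℝ (christoffelCLM G) y u w z))
        - (fderiv ℝ (christoffelCLM G) y u w (christoffelCLM G y v z)
          + christoffelCLM G y w (fderiv ℝ (christoffelCLM G) y u v z)) := by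
  have hc := (hG.differentiableAt_christoffelCLM hy).hasFDerivAt
  have hd := (((hG.contDiffAt_christoffelCLM hy).fderiv_right (m := ∞)
    (by simp)).differentiableAt (by simp)).hasFDerivAt
  have hd1 : ∀ v w z, HasFDerivAt (fun y' => fderiv ℝ (christoffelCLM G) y' v w z) _ y :=
    fun v w z => ((hd.clm_apply (hasFDerivAt_const v y)).clm_apply (hasFDerivAt_const w y)).clm_apply
      (hasFDerivAt_const z y)
  have hc1 : ∀ v w, HasFDerivAt (fun y' => christoffelCLM G y' v w) _ y :=
    fun v w => (hc.clm_apply (hasFDerivAt_const v y)).clm_apply (hasFDerivAt_const w y)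
  have hc2 : ∀ v w z, HasFDerivAt (fun y' => christoffelCLM G y' v (christoffelCLM G y' w z)) _ y :=
    fun v w z => (hc.clm_apply (hasFDerivAt_const v y)).clm_apply (hc1 w z)
  have h := (((hd1 v w z).sub (hd1 w v z)).add (hc2 v w z)).sub (hc2 w v z)
  have he : (fun y' => localCurvature G y' v w z) =ᶠ[𝓝 y] fun y' =>
      fderiv ℝ (christoffelCLM G) y' v w z - fderiv ℝ (christoffelCLM G) y' w v z
      + christoffelCLM G y' v (christoffelCLM G y' w z)
      - christoffelCLM G y' w (christoffelCLM G y' v z) := by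
    filter_upwards [hG.eventually_mem hy] with y' hy'
    exact hG.localCurvature_eq hy' v w z
  refine ⟨_, h.congr_of_eventuallyEq he, fun u => ?_⟩
  simp only [add_apply, sub_apply, ContinuousLinearMap.comp_apply, ContinuousLinearMap.flip_apply,
    zero_apply, map_zero, zero_add]
  abel

/-- The second Bianchi identity, before the terms that cancel by symmetry are added. -/
theorem bianchi_aux (u v w z : Model n) :
    (fderiv ℝ (fun y' => localCurvature G y' v w z) y u
      + christoffelCLM G y u (localCurvature G y v w z)
      - localCurvature G y v w (christoffelCLM G y u z)) +
    (fderiv ℝ (fun y' => localCurvature G y' w u z) y v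
      + christoffelCLM G y v (localCurvature G y w u z)
      - localCurvature G y w u (christoffelCLM G y v z)) +
    (fderiv ℝ (fun y' => localCurvature G y' u v z) y w
      + christoffelCLM G y w (localCurvature G y u v z)
      - localCurvature G y u v (christoffelCLM G y w z)) = 0 := by
  obtain ⟨L1, h1, h1'⟩ := hasFDerivAt_localCurvature hG hy v w z
  obtain ⟨L2, h2, h2'⟩ := hasFDerivAt_localCurvature hG hy w u z
  obtain ⟨L3, h3, h3'⟩ := hasFDerivAt_localCurvature hG hy u v z
  have hs : ∀ v w, fderiv ℝ (fderiv ℝ (christoffelCLM G)) y v w =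
      fderiv ℝ (fderiv ℝ (christoffelCLM G)) y w v :=
    fun v w => ((hG.contDiffAt_christoffelCLM hy).isSymmSndFDerivAt two_le_infty).eq v w
  rw [h1.fderiv, h2.fderiv, h3.fderiv, h1', h2', h3']
  simp only [hG.localCurvature_eq hy, map_add, map_sub]
  rw [hs v u, hs w u, hs w v]
  abel

/-- The covariant derivative of the Riemann tensor. -/
def covRiemann (G : LocalMetric n) (y x v w z u : Model n) : ℝ :=
  fderiv ℝ (fun y' => G y' (localCurvature G y' v w u) z) y x
    - G y (localCurvature G y (christoffelCLM G y x v) w u) z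
    - G y (localCurvature G y v (christoffelCLM G y x w) u) z
    - G y (localCurvature G y v w u) (christoffelCLM G y x z)
    - G y (localCurvature G y v w (christoffelCLM G y x u)) z

theorem hasFDerivAt_riemann (v w z u : Model n) :
    DifferentiableAt ℝ (fun y' => G y' (localCurvature G y' v w u) z) y ∧
    ∀ x, fderiv ℝ (fun y' => G y' (localCurvature G y' v w u) z) y x =
      G y (fderiv ℝ (fun y' => localCurvature G y' v w u) y x
        + christoffelCLM G y x (localCurvature G y v w u)) z
      + G y (localCurvature G y v w u) (christoffelCLM G y x z) := by
  obtain ⟨L, h, -⟩ := hasFDerivAt_localCurvature hG hy v w u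
  have h1 := ((hG.differentiableAt hy).hasFDerivAt.clm_apply h).clm_apply (hasFDerivAt_const z y)
  refine ⟨h1.differentiableAt, fun x => ?_⟩
  rw [h1.fderiv, h.fderiv]
  simp only [add_apply, ContinuousLinearMap.comp_apply, ContinuousLinearMap.flip_apply, zero_apply,
    map_zero, zero_add, hG.fderiv_eq hy, map_add, christoffelCLM_apply]
  ring

theorem covRiemann_eq (x v w z u : Model n) : covRiemann G y x v w z u =
    G y (fderiv ℝ (fun y' => localCurvature G y' v w u) y x
        + christoffelCLM G y x (localCurvature G y v w u)
        - localCurvature G y v w (christoffelCLM G y x u)) z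
      - G y (localCurvature G y (christoffelCLM G y x v) w u) z
      - G y (localCurvature G y v (christoffelCLM G y x w) u) z := by
  rw [covRiemann, (hasFDerivAt_riemann hG hy v w z u).2]
  simp only [map_add, map_sub, add_apply, sub_apply]
  ring

/-- Each symmetry of R is a linear identity with constant coefficients on a neighbourhood, so it
passes to the derivative and to the Γ-correction of each slot. -/
theorem isCurvatureForm_covRiemann (x : Model n) : IsCurvatureForm (covRiemann G y x) := by
  have hT := fun {y'} (hy' : y' ∈ U) => isCurvatureForm_local hG hy'
  simp only [metricForm_apply] at hT
  have hd := fun v w z u => (hasFDerivAt_riemann hG hy v w z u).1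
  have hev := hG.eventually_mem hy
  refine ⟨fun v v' w z u => ?_, fun c v w z u => ?_, fun v w z u => ?_, fun v w z u => ?_,
    fun v w z u => ?_⟩
  · have he : (fun y' => G y' (localCurvature G y' (v + v') w u) z) =ᶠ[𝓝 y] fun y' =>
        G y' (localCurvature G y' v w u) z + G y' (localCurvature G y' v' w u) z := by
      filter_upwards [hev] with y' hy'
      exact (hT hy').add v v' w z u
    simp only [covRiemann]
    rw [he.fderiv_eq, fderiv_fun_add (hd _ _ _ _) (hd _ _ _ _), map_add, add_apply,
      (hT hy).add, (hT hy).add, (hT hy).add, (hT hy).add]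
    ring
  · have he : (fun y' => G y' (localCurvature G y' (c • v) w u) z) =ᶠ[𝓝 y] fun y' =>
        c * G y' (localCurvature G y' v w u) z := by
      filter_upwards [hev] with y' hy'
      exact (hT hy').smul c v w z u
    simp only [covRiemann]
    rw [he.fderiv_eq, fderiv_const_mul (hd _ _ _ _), map_smul, _root_.smul_apply, smul_eq_mul,
      (hT hy).smul, (hT hy).smul, (hT hy).smul, (hT hy).smul]
    ring
  · have he : (fun y' => G y' (localCurvature G y' v w u) z) =ᶠ[𝓝 y] fun y' =>
        - G y' (localCurvature G y' w v u) z := by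
      filter_upwards [hev] with y' hy'
      exact (hT hy').antisymm v w z u
    simp only [covRiemann]
    rw [he.fderiv_eq, fderiv_fun_neg, neg_apply, (hT hy).antisymm (christoffelCLM G y x v),
      (hT hy).antisymm v, (hT hy).antisymm v, (hT hy).antisymm v]
    ring
  · have he : (fun y' => G y' (localCurvature G y' v w u) z) =ᶠ[𝓝 y] fun y' =>
        - G y' (localCurvature G y' v w z) u := by
      filter_upwards [hev] with y' hy'
      exact (hT hy').skew v w z u
    simp only [covRiemann]
    rw [he.fderiv_eq, fderiv_fun_neg, neg_apply]
    have s1 := (hT hy).skew (christoffelCLM G y x v) w z u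
    have s2 := (hT hy).skew v (christoffelCLM G y x w) z u
    have s3 := (hT hy).skew v w (christoffelCLM G y x z) u
    have s4 := (hT hy).skew v w z (christoffelCLM G y x u)
    linarith
  · have he : (fun y' => G y' (localCurvature G y' v w u) z) =ᶠ[𝓝 y] fun y' =>
        - G y' (localCurvature G y' w z u) v - G y' (localCurvature G y' z v u) w := by
      filter_upwards [hev] with y' hy'
      have := (hT hy').bianchi v w z u
      linarith
    simp only [covRiemann]
    rw [he.fderiv_eq, fderiv_fun_sub (hd _ _ _ _).fun_neg (hd _ _ _ _), fderiv_fun_neg, sub_apply,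
      neg_apply]
    have b1 := (hT hy).bianchi (christoffelCLM G y x v) w z u
    have b2 := (hT hy).bianchi v (christoffelCLM G y x w) z u
    have b3 := (hT hy).bianchi v w (christoffelCLM G y x z) u
    have b4 := (hT hy).bianchi v w z (christoffelCLM G y x u)
    linarith

/-- The second Bianchi identity. -/
theorem covRiemann_bianchi (x v w z u : Model n) :
    covRiemann G y x v w z u + covRiemann G y v w x z u + covRiemann G y w x v z u = 0 := by
  have h := congrArg (fun t => G y t z) (bianchi_aux hG hy x v w u)
  have ha : ∀ v w, G y (localCurvature G y v w u) z = - G y (localCurvature G y w v u) z :=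
    fun v w => (isCurvatureForm_local hG hy).antisymm v w z u
  simp only [covRiemann_eq hG hy]
  -- The corrections in the first two slots cancel in pairs, by skewness of R and symmetry of Γ.
  rw [ha (christoffelCLM G y x v), ha (christoffelCLM G y v w), ha (christoffelCLM G y w x),
    hG.christoffelCLM_symm hy w x, hG.christoffelCLM_symm hy x v, hG.christoffelCLM_symm hy v w]
  rw [map_zero, zero_apply, map_add, map_add, add_apply, add_apply] at h
  linarith

/-- The covariant derivative of the Ricci tensor, if `Ric = c g` with a function `c`. -/
theorem sum_covRiemann {c : Model n → ℝ} (hc : DifferentiableAt ℝ c y)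
    (hric : ∀ y' ∈ U, ∀ v w, ∑ a : Fin n,
      EuclideanSpace.proj (𝕜 := ℝ) a (localCurvature G y' (frame a) v w) = c y' * G y' v w)
    {e : Fin n → Model n} (he : IsFrame (metricForm G y) e) (x v w : Model n) :
    ∑ a, covRiemann G y x (e a) v (e a) w = fderiv ℝ c y x * G y v w := by
  have hT := fun {y'} (hy' : y' ∈ U) => isCurvatureForm_local hG hy'
  simp only [metricForm_apply] at hT
  have hD := isCurvatureForm_covRiemann hG hy x
  have h0 := sum_frame_dualFrame hG hy he (LinearMap.mk₂ ℝ
      (fun t t' => covRiemann G y x t v t' w)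
      (fun t t' z => hD.add t t' v z w) (fun c t z => hD.smul c t v z w)
      (fun t z z' => hD.add₃ t v z z' w) (fun c t z => hD.smul₃ c t v z w))
  simp only [LinearMap.mk₂_apply] at h0
  have hric' : ∀ y' ∈ U, ∀ v w, ∑ a : Fin n,
      G y' (localCurvature G y' (frame a) v w) (dualFrame G y' a) = c y' * G y' v w := by
    intro y' hy' v w
    rw [← hric y' hy']
    exact Finset.sum_congr rfl fun a _ => by
      rw [hG.symm y' hy', hG.apply_dualFrame hy']
      rfl
  have hcon := fderiv_contraction hG hy
    (B := fun y' t t' => G y' (localCurvature G y' t v w) t')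
    (fun t t' => linearMap_apply_eq_sum ((LinearMap.flip (metricForm G y) t').comp
      (curvatureLin (isInner_metricForm hG hy) (isCurvatureForm_local hG hy) v w)) t)
    (fun y' hy' t t' => linearMap_apply_eq_sum (G y' (localCurvature G y' t v w)).toLinearMap t')
    (fun t t' => (hasFDerivAt_riemann hG hy t v t' w).1) x
  have he1 : (fun y' => ∑ a, G y' (localCurvature G y' (frame a) v w) (dualFrame G y' a)) =ᶠ[𝓝 y]
      fun y' => c y' * G y' v w := by
    filter_upwards [hG.eventually_mem hy] with y' hy'
    exact hric' y' hy' v w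
  have hGd : DifferentiableAt ℝ (fun y' => G y' v w) y :=
    ((hG.differentiableAt hy).clm_apply (differentiableAt_const v)).clm_apply
      (differentiableAt_const w)
  rw [he1.fderiv_eq, fderiv_fun_mul hc hGd] at hcon
  simp only [add_apply, _root_.smul_apply, smul_eq_mul, hG.fderiv_apply hy, hG.fderiv_eq hy] at hcon
  have r1 := hric' y hy (christoffel G y x v) w
  have r2 := hric' y hy v (christoffel G y x w)
  rw [← h0]
  simp only [covRiemann, Finset.sum_sub_distrib, christoffelCLM_apply] at hcon ⊢
  linarith

/-- Schur's lemma. -/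
theorem fderiv_eq_zero_of_einstein (hn : 3 ≤ n) {c : Model n → ℝ} (hc : DifferentiableAt ℝ c y)
    (hric : ∀ y' ∈ U, ∀ v w, ∑ a : Fin n,
      EuclideanSpace.proj (𝕜 := ℝ) a (localCurvature G y' (frame a) v w) = c y' * G y' v w) :
    fderiv ℝ c y = 0 := by
  have hg := isInner_metricForm hG hy
  obtain ⟨e, he⟩ := hg.exists_frame (n := n) (by simp)
  have hD := isCurvatureForm_covRiemann hG hy
  have hs := sum_covRiemann hG hy hc hric he
  ext v
  -- The twice contracted Bianchi identity; its three sums are dc(v), −n dc(v) and dc(v).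
  have hB : ∑ a, ∑ b, (covRiemann G y (e a) v (e b) (e a) (e b)
      + covRiemann G y v (e b) (e a) (e a) (e b)
      + covRiemann G y (e b) (e a) v (e a) (e b)) = 0 :=
    Finset.sum_eq_zero fun a _ => Finset.sum_eq_zero fun b _ => covRiemann_bianchi hG hy _ _ _ _ _
  simp only [Finset.sum_add_distrib] at hB
  have hlin : ∑ a, fderiv ℝ c y (e a) * G y v (e a) = fderiv ℝ c y v := by
    rw [← ContinuousLinearMap.coe_coe, ← he.linear_apply (fderiv ℝ c y).toLinearMap v]
    exact Finset.sum_congr rfl fun a _ => mul_comm _ _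
  have h1 : ∑ a, ∑ b, covRiemann G y (e a) v (e b) (e a) (e b) = fderiv ℝ c y v := by
    rw [← hlin]
    refine Finset.sum_congr rfl fun a _ => ?_
    rw [← hs]
    refine Finset.sum_congr rfl fun b _ => ?_
    rw [(hD _).antisymm, (hD _).skew, neg_neg]
  have h2 : ∑ a, ∑ b, covRiemann G y v (e b) (e a) (e a) (e b) = - (n * fderiv ℝ c y v) := by
    rw [Finset.sum_comm]
    have : ∀ b, ∑ a, covRiemann G y v (e b) (e a) (e a) (e b) = - fderiv ℝ c y v := fun b => by
      have hb := hs v (e b) (e b)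
      rw [show G y (e b) (e b) = 1 from he.self b, mul_one] at hb
      rw [← hb, ← Finset.sum_neg_distrib]
      exact Finset.sum_congr rfl fun a _ => (hD v).antisymm _ _ _ _
    rw [Finset.sum_congr rfl fun b _ => this b]
    simp
  have h3 : ∑ a, ∑ b, covRiemann G y (e b) (e a) v (e a) (e b) = fderiv ℝ c y v := by
    rw [← hlin, Finset.sum_comm]
    exact Finset.sum_congr rfl fun b _ => hs _ _ _
  rw [h1, h2, h3] at hB
  have hn' : (3 : ℝ) ≤ n := by exact_mod_cast hn
  have : (2 - (n : ℝ)) * fderiv ℝ c y v = 0 := by linarith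
  rcases mul_eq_zero.1 this with h | h
  · linarith
  · simpa using h

end Bianchi

/-! ### Invariance of connection and curvature under isometries -/

section Covariance

set_option maxSynthPendingDepth 5

variable {n : ℕ} {G G' : LocalMetric n} {U U' : Set (Model n)} (hG : IsRiemannianOn G U)
  (hG' : IsRiemannianOn G' U') {φ : Model n → Model n}
  (hφ : ∀ y ∈ U, φ y ∈ U' ∧ ContDiffAt ℝ ∞ φ y ∧
    ∀ v w, G y v w = G' (φ y) (fderiv ℝ φ y v) (fderiv ℝ φ y w))
include hG hG' hφ

/-- Christoffel maps transform like a connection under isometries. -/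
theorem christoffel_isometry (hinv : ∀ y ∈ U, Function.Surjective (fderiv ℝ φ y)) {y : Model n}
    (hy : y ∈ U) (v w : Model n) :
    fderiv ℝ φ y (christoffelCLM G y v w) =
      christoffelCLM G' (φ y) (fderiv ℝ φ y v) (fderiv ℝ φ y w) + fderiv ℝ (fderiv ℝ φ) y v w := by
  obtain ⟨hy', hd, hiso⟩ := hφ y hy
  have hinj : Function.Injective (fderiv ℝ φ y) :=
    (LinearMap.injective_iff_surjective (f := (fderiv ℝ φ y).toLinearMap)).2 (hinv y hy)
  have hD := ((hd.fderiv_right (m := ∞) (by simp)).differentiableAt (by simp)).hasFDerivAt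
  have hs := (hd.isSymmSndFDerivAt two_le_infty).eq
  choose P hP using hinv y hy
  have hcomp := (hG'.differentiableAt hy').hasFDerivAt.comp y
    (hd.differentiableAt (by simp)).hasFDerivAt
  have hderiv : ∀ u v w, fderiv ℝ G y u v w =
      fderiv ℝ G' (φ y) (fderiv ℝ φ y u) (fderiv ℝ φ y v) (fderiv ℝ φ y w)
      + G' (φ y) (fderiv ℝ (fderiv ℝ φ) y u v) (fderiv ℝ φ y w)
      + G' (φ y) (fderiv ℝ φ y v) (fderiv ℝ (fderiv ℝ φ) y u w) := by
    intro u v w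
    have h1 := ((hG.differentiableAt hy).hasFDerivAt.clm_apply (hasFDerivAt_const v y)).clm_apply
      (hasFDerivAt_const w y)
    have h2 := (hcomp.clm_apply (hD.clm_apply (hasFDerivAt_const v y))).clm_apply
      (hD.clm_apply (hasFDerivAt_const w y))
    have he : (fun y' => G y' v w) =ᶠ[𝓝 y] fun y' =>
        (G' ∘ φ) y' (fderiv ℝ φ y' v) (fderiv ℝ φ y' w) := by
      filter_upwards [hG.eventually_mem hy] with y' hy'
      exact (hφ y' hy').2.2 v w
    have h3 := congrArg (fun L => L u) (h1.unique (h2.congr_of_eventuallyEq he))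
    simp only [add_apply, ContinuousLinearMap.comp_apply, ContinuousLinearMap.flip_apply,
      zero_apply, map_zero, zero_add, Function.comp_apply] at h3
    rw [h3]
    ring
  -- The connection pulled back by φ, with P inverting dφ, is symmetric and compatible with G, so it
  -- is the Levi-Civita connection.
  have hunique := hG.christoffel_unique hy
    (fun v w => P (christoffelCLM G' (φ y) (fderiv ℝ φ y v) (fderiv ℝ φ y w) +
      fderiv ℝ (fderiv ℝ φ) y v w))
    (fun v w => by rw [hG'.christoffelCLM_symm hy', hs v w])
    (fun u v w => by
      rw [hderiv, hiso, hiso, hP, hP, hG'.fderiv_eq hy']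
      simp only [map_add, add_apply, christoffelCLM_apply]
      ring) v w
  rw [christoffelCLM_apply, hunique, hP]

/-- The curvature is invariant under isometries. -/
theorem localCurvature_isometry (hinv : ∀ y ∈ U, Function.Surjective (fderiv ℝ φ y))
    {y : Model n} (hy : y ∈ U) (v w z : Model n) :
    fderiv ℝ φ y (localCurvature G y v w z) =
      localCurvature G' (φ y) (fderiv ℝ φ y v) (fderiv ℝ φ y w) (fderiv ℝ φ y z) := by
  obtain ⟨hy', hd, -⟩ := hφ y hy
  have hc := fun {y} (hy : y ∈ U) => christoffel_isometry hG hG' hφ hinv hy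
  have hd1 := hd.fderiv_right (m := ∞) (by simp)
  have hD := (hd1.differentiableAt (by simp)).hasFDerivAt
  have hDD := ((hd1.fderiv_right (m := ∞) (by simp)).differentiableAt (by simp)).hasFDerivAt
  have hs := (hd.isSymmSndFDerivAt two_le_infty).eq
  have hss := (hd1.isSymmSndFDerivAt two_le_infty).eq
  have hΓ := (hG.differentiableAt_christoffelCLM hy).hasFDerivAt
  have hΓ' := (hG'.differentiableAt_christoffelCLM hy').hasFDerivAt.comp y
    (hd.differentiableAt (by simp)).hasFDerivAt
  have hderiv : ∀ v w z, fderiv ℝ φ y (fderiv ℝ (christoffelCLM G) y v w z) =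
      fderiv ℝ (christoffelCLM G') (φ y) (fderiv ℝ φ y v) (fderiv ℝ φ y w) (fderiv ℝ φ y z)
      + christoffelCLM G' (φ y) (fderiv ℝ (fderiv ℝ φ) y v w) (fderiv ℝ φ y z)
      + christoffelCLM G' (φ y) (fderiv ℝ φ y w) (fderiv ℝ (fderiv ℝ φ) y v z)
      + fderiv ℝ (fderiv ℝ (fderiv ℝ φ)) y v w z
      - fderiv ℝ (fderiv ℝ φ) y v (christoffelCLM G y w z) := by
    intro v w z
    have hcon := fun x : Model n => hasFDerivAt_const (𝕜 := ℝ) x y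
    have h1 := hD.clm_apply ((hΓ.clm_apply (hcon w)).clm_apply (hcon z))
    have h2 := ((hΓ'.clm_apply (hD.clm_apply (hcon w))).clm_apply (hD.clm_apply (hcon z))).add
      ((hDD.clm_apply (hcon w)).clm_apply (hcon z))
    have he : (fun y' => fderiv ℝ φ y' (christoffelCLM G y' w z)) =ᶠ[𝓝 y] fun y' =>
        (christoffelCLM G' ∘ φ) y' (fderiv ℝ φ y' w) (fderiv ℝ φ y' z)
          + fderiv ℝ (fderiv ℝ φ) y' w z := by
      filter_upwards [hG.eventually_mem hy] with y' hy'
      exact hc hy' w z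
    have h3 := congrArg (fun L => L v) (h1.unique (h2.congr_of_eventuallyEq he))
    simp only [add_apply, ContinuousLinearMap.comp_apply, ContinuousLinearMap.flip_apply,
      zero_apply, map_zero, zero_add, Function.comp_apply] at h3
    rw [eq_sub_iff_add_eq, h3]
    abel
  rw [hG.localCurvature_eq hy, hG'.localCurvature_eq hy']
  simp only [map_add, map_sub, hderiv, hc hy]
  -- Symmetry of the second and third derivatives of φ removes the inhomogeneous terms of the
  -- transformation law.
  have t1 : fderiv ℝ (fderiv ℝ (fderiv ℝ φ)) y v w z = fderiv ℝ (fderiv ℝ (fderiv ℝ φ)) y w v z := by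
    rw [hss]
  rw [t1, hs w v]
  abel

/-- dφ carries orthonormal frames to orthonormal frames, and in these both traces agree term by
term. -/
theorem ricci_isometry (hinv : ∀ y ∈ U, Function.Surjective (fderiv ℝ φ y)) {y : Model n}
    (hy : y ∈ U) (v w : Model n) :
    ∑ a : Fin n, EuclideanSpace.proj (𝕜 := ℝ) a (localCurvature G y (frame a) v w) =
      ∑ a : Fin n, EuclideanSpace.proj (𝕜 := ℝ) a (localCurvature G' (φ y) (frame a)
        (fderiv ℝ φ y v) (fderiv ℝ φ y w)) := by
  obtain ⟨hy', hd, hiso⟩ := hφ y hy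
  obtain ⟨e, he⟩ := (isInner_metricForm hG hy).exists_frame (n := n) (by simp)
  have hsum : ∀ v', ∑ a, G' (φ y) v' (fderiv ℝ φ y (e a)) • fderiv ℝ φ y (e a) = v' := by
    intro v'
    obtain ⟨v, rfl⟩ := hinv y hy v'
    simp only [← hiso]
    exact he.linear_apply (fderiv ℝ φ y).toLinearMap v
  have he' : IsFrame (metricForm G' (φ y)) fun a => fderiv ℝ φ y (e a) :=
    ⟨fun i j => by rw [metricForm_apply, ← hiso]; exact he.apply i j, hsum⟩
  rw [sum_localCurvature hG hy he, sum_localCurvature hG' hy' he']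
  refine Finset.sum_congr rfl fun a _ => ?_
  rw [metricForm_apply, metricForm_apply, hiso, localCurvature_isometry hG hG' hφ hinv hy]

end Covariance

/-! ### The metric in charts -/

section Charts

variable {n : ℕ} {M : Type*} [TopologicalSpace M] [ChartedSpace (Model n) M]
  [IsManifold 𝓘(ℝ, Model n) ∞ M]

omit [IsManifold 𝓘(ℝ, Model n) ∞ M] in
theorem chartFrame_eq_mfderivWithin (x₀ : M) (y : Model n) :
    chartFrame x₀ y = mfderivWithin 𝓘(ℝ, Model n) 𝓘(ℝ, Model n)
      (extChartAt 𝓘(ℝ, Model n) x₀).symm (Set.range 𝓘(ℝ, Model n)) y := by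
  rw [ModelWithCorners.range_eq_univ, mfderivWithin_univ]
  rfl

theorem mfderiv_extChartAt_chartFrame {x₀ : M} {y : Model n}
    (hy : y ∈ (extChartAt 𝓘(ℝ, Model n) x₀).target) (v : Model n) :
    mfderiv 𝓘(ℝ, Model n) 𝓘(ℝ, Model n) (extChartAt 𝓘(ℝ, Model n) x₀)
      ((extChartAt 𝓘(ℝ, Model n) x₀).symm y) (chartFrame x₀ y v) = v := by
  rw [chartFrame_eq_mfderivWithin]
  exact DFunLike.congr_fun
    (mfderiv_extChartAt_comp_mfderivWithin_extChartAt_symm (I := 𝓘(ℝ, Model n)) hy) v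

/-- Tangent vectors at x are their components in the preferred chart at x, so that chart's frame at
its own centre is the identity. -/
theorem chartFrame_self (x : M) (v : Model n) :
    (chartFrame x (extChartAt 𝓘(ℝ, Model n) x x) v : Model n) = v := by
  rw [chartFrame_eq_mfderivWithin]
  exact DFunLike.congr_fun (mfderivWithin_range_extChartAt_symm (I := 𝓘(ℝ, Model n)) (x := x)) v

theorem inner_congr (g : Metric n M) {x x' : M} (h : x = x') (v w : Model n) :
    g.inner x v w = g.inner x' v w := by
  subst h
  rfl

theorem chartMetric_self (g : Metric n M) (x : M) (v w : Model n) :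
    chartMetric g x (extChartAt 𝓘(ℝ, Model n) x x) v w = g.inner x v w := by
  rw [chartMetric_apply]
  refine (inner_congr g (extChartAt_to_inv x) _ _).trans ?_
  rw [chartFrame_self, chartFrame_self]

/-- In the trivialization of the tangent bundle at x₀ this section is the constant v. -/
theorem contMDiffOn_chartFrame (x₀ : M) (v : Model n) :
    ContMDiffOn 𝓘(ℝ, Model n) (𝓘(ℝ, Model n).prod 𝓘(ℝ, Model n)) ∞
      (fun y => (⟨(extChartAt 𝓘(ℝ, Model n) x₀).symm y, chartFrame x₀ y v⟩ :
        TangentBundle 𝓘(ℝ, Model n) M)) (extChartAt 𝓘(ℝ, Model n) x₀).target := by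
  have hsrc : ∀ y ∈ (extChartAt 𝓘(ℝ, Model n) x₀).target,
      (extChartAt 𝓘(ℝ, Model n) x₀).symm y ∈ (chartAt (Model n) x₀).source := fun y hy => by
    rw [← extChartAt_source 𝓘(ℝ, Model n)]
    exact (extChartAt 𝓘(ℝ, Model n) x₀).map_target hy
  rw [(trivializationAt (Model n) (TangentSpace 𝓘(ℝ, Model n)) x₀).contMDiffOn_iff]
  · refine ⟨contMDiffOn_extChartAt_symm x₀, contMDiffOn_const.congr fun y hy => (?_ : _ = v)⟩
    refine Eq.trans ?_ (mfderiv_extChartAt_chartFrame hy v)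
    rw [← TangentBundle.continuousLinearMapAt_trivializationAt (hsrc y hy)]
    exact (Bundle.Trivialization.continuousLinearMapAt_apply_of_mem (R := ℝ)
      (trivializationAt (Model n) (TangentSpace 𝓘(ℝ, Model n)) x₀) (hsrc y hy) _).symm
  · intro y hy
    rw [Bundle.Trivialization.mem_source]
    exact hsrc y hy

theorem contDiffOn_chartMetric_apply (g : Metric n M) (x₀ : M) (v w : Model n) :
    ContDiffOn ℝ ∞ (fun y => chartMetric g x₀ y v w) (extChartAt 𝓘(ℝ, Model n) x₀).target := by
  have h := (g.contMDiff.comp_contMDiffOn (contMDiffOn_extChartAt_symm (I := 𝓘(ℝ, Model n))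
    (n := ∞) x₀))
  have h2 := ContMDiffOn.clm_bundle_apply₂ (F₃ := ℝ) (E₃ := Bundle.Trivial M ℝ) h
    (contMDiffOn_chartFrame x₀ v) (contMDiffOn_chartFrame x₀ w)
  rw [(trivializationAt ℝ (Bundle.Trivial M ℝ) x₀).contMDiffOn_iff] at h2
  · exact contMDiffOn_iff_contDiffOn.1 h2.2
  · intro y _
    simp

theorem isRiemannianOn_chartMetric (g : Metric n M) (x₀ : M) :
    IsRiemannianOn (chartMetric g x₀) (extChartAt 𝓘(ℝ, Model n) x₀).target where
  isOpen := isOpen_extChartAt_target x₀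
  smooth := by
    refine contDiffOn_clm_apply.2 fun v => contDiffOn_clm_apply.2 fun w => ?_
    exact contDiffOn_chartMetric_apply g x₀ v w
  symm y _ v w := g.symm _ _ _
  pos y hy v hv := g.pos _ _ fun h => hv <| (mfderiv_extChartAt_chartFrame hy v).symm.trans <|
    (congrArg _ h).trans (map_zero _)

end Charts

/-! ### Changes of charts and the global Schur lemma -/

section Transition

set_option maxSynthPendingDepth 5

variable {n : ℕ} {M : Type*} [TopologicalSpace M] [ChartedSpace (Model n) M]
  [IsManifold 𝓘(ℝ, Model n) ∞ M]

theorem IsRiemannianOn.mono {G : LocalMetric n} {U U' : Set (Model n)} (hG : IsRiemannianOn G U)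
    (hU' : IsOpen U') (h : U' ⊆ U) : IsRiemannianOn G U' :=
  ⟨hU', hG.smooth.mono h, fun y hy => hG.symm y (h hy), fun y hy => hG.pos y (h hy)⟩

theorem chartFrame_mfderiv_extChartAt' {x₀ x : M} (hx : x ∈ (extChartAt 𝓘(ℝ, Model n) x₀).source)
    (v : Model n) :
    (chartFrame x₀ (extChartAt 𝓘(ℝ, Model n) x₀ x) (mfderiv 𝓘(ℝ, Model n) 𝓘(ℝ, Model n)
      (extChartAt 𝓘(ℝ, Model n) x₀) x v : Model n) : Model n) = v := by
  rw [chartFrame_eq_mfderivWithin]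
  exact DFunLike.congr_fun
    (mfderivWithin_extChartAt_symm_comp_mfderiv_extChartAt' (I := 𝓘(ℝ, Model n)) hx) v

/-- The change of charts. -/
def transition (x₀ x : M) (y : Model n) : Model n :=
  extChartAt 𝓘(ℝ, Model n) x ((extChartAt 𝓘(ℝ, Model n) x₀).symm y)

variable (n) in
/-- The domain of the change of charts. -/
def transitionSource (x₀ x : M) : Set (Model n) :=
  (extChartAt 𝓘(ℝ, Model n) x₀).target ∩
    (extChartAt 𝓘(ℝ, Model n) x₀).symm ⁻¹' (extChartAt 𝓘(ℝ, Model n) x).source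

omit [IsManifold 𝓘(ℝ, Model n) ∞ M] in
theorem isOpen_transitionSource (x₀ x : M) : IsOpen (transitionSource n x₀ x) :=
  (continuousOn_extChartAt_symm x₀).isOpen_inter_preimage (isOpen_extChartAt_target x₀)
    (isOpen_extChartAt_source x)

theorem contDiffAt_transition {x₀ x : M} {y : Model n} (hy : y ∈ transitionSource n x₀ x) :
    ContDiffAt ℝ ∞ (transition x₀ x) y := by
  have h : ContDiffOn ℝ ∞ (transition x₀ x) (transitionSource n x₀ x) :=
    contMDiffOn_iff_contDiffOn.1 <| (contMDiffOn_extChartAt (I := 𝓘(ℝ, Model n)) (x := x)).comp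
      ((contMDiffOn_extChartAt_symm x₀).mono Set.inter_subset_left) fun z hz => by
        rw [← extChartAt_source 𝓘(ℝ, Model n)]
        exact hz.2
  exact h.contDiffAt ((isOpen_transitionSource x₀ x).mem_nhds hy)

theorem fderiv_transition {x₀ x : M} {y : Model n} (hy : y ∈ transitionSource n x₀ x)
    (v : Model n) : fderiv ℝ (transition x₀ x) y v =
      mfderiv 𝓘(ℝ, Model n) 𝓘(ℝ, Model n) (extChartAt 𝓘(ℝ, Model n) x)
        ((extChartAt 𝓘(ℝ, Model n) x₀).symm y) (chartFrame x₀ y v) := by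
  have h1 : MDifferentiableAt 𝓘(ℝ, Model n) 𝓘(ℝ, Model n) (extChartAt 𝓘(ℝ, Model n) x)
      ((extChartAt 𝓘(ℝ, Model n) x₀).symm y) :=
    mdifferentiableAt_extChartAt (by rw [← extChartAt_source 𝓘(ℝ, Model n)]; exact hy.2)
  have h2 : MDifferentiableAt 𝓘(ℝ, Model n) 𝓘(ℝ, Model n) (extChartAt 𝓘(ℝ, Model n) x₀).symm y := by
    have := mdifferentiableWithinAt_extChartAt_symm (I := 𝓘(ℝ, Model n)) hy.1
    rwa [ModelWithCorners.range_eq_univ, mdifferentiableWithinAt_univ] at this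
  have h3 := mfderiv_comp y h1 h2
  rw [← mfderiv_eq_fderiv]
  exact DFunLike.congr_fun h3 v

theorem chartFrame_fderiv_transition {x₀ x : M} {y : Model n} (hy : y ∈ transitionSource n x₀ x)
    (v : Model n) : (chartFrame x (transition x₀ x y) (fderiv ℝ (transition x₀ x) y v) : Model n) =
      chartFrame x₀ y v := by
  rw [fderiv_transition hy]
  exact chartFrame_mfderiv_extChartAt' hy.2 _

theorem chartMetric_transition (g : Metric n M) {x₀ x : M} {y : Model n}
    (hy : y ∈ transitionSource n x₀ x) (v w : Model n) :
    chartMetric g x₀ y v w = chartMetric g x (transition x₀ x y)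
      (fderiv ℝ (transition x₀ x) y v) (fderiv ℝ (transition x₀ x) y w) := by
  rw [chartMetric_apply, chartMetric_apply]
  refine Eq.symm ((inner_congr g ((extChartAt 𝓘(ℝ, Model n) x).left_inv hy.2) _ _).trans ?_)
  rw [chartFrame_fderiv_transition hy, chartFrame_fderiv_transition hy]

omit [IsManifold 𝓘(ℝ, Model n) ∞ M] in
theorem transition_mem_target {x₀ x : M} {y : Model n} (hy : y ∈ transitionSource n x₀ x) :
    transition x₀ x y ∈ (extChartAt 𝓘(ℝ, Model n) x).target :=
  (extChartAt 𝓘(ℝ, Model n) x).map_source hy.2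

theorem fderiv_transition_surjective (g : Metric n M) {x₀ x : M} {y : Model n}
    (hy : y ∈ transitionSource n x₀ x) :
    Function.Surjective (fderiv ℝ (transition x₀ x) y) := by
  refine (LinearMap.injective_iff_surjective
    (f := (fderiv ℝ (transition x₀ x) y : Model n →ₗ[ℝ] Model n))).1 ?_
  rw [← LinearMap.ker_eq_bot, LinearMap.ker_eq_bot']
  intro v hv
  by_contra hne
  have h := (isRiemannianOn_chartMetric g x₀).pos y hy.1 v hne
  rw [chartMetric_transition g hy, show fderiv ℝ (transition x₀ x) y v = 0 from hv] at h
  simp at h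

/-- The Einstein equation at a point is given in the chart centred there. Changes of charts are
isometries of the chart metrics, so it holds at every point of one fixed chart. -/
theorem sum_localCurvature_chartMetric (g : Metric n M) {x₀ : M} {y : Model n}
    (hy : y ∈ (extChartAt 𝓘(ℝ, Model n) x₀).target) {c : ℝ}
    (hc : ∀ v w, ricci g ((extChartAt 𝓘(ℝ, Model n) x₀).symm y) v w =
      c * g.inner ((extChartAt 𝓘(ℝ, Model n) x₀).symm y) v w) (v w : Model n) :
    ∑ a, EuclideanSpace.proj (𝕜 := ℝ) a (localCurvature (chartMetric g x₀) y (frame a) v w) =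
      c * chartMetric g x₀ y v w := by
  set x := (extChartAt 𝓘(ℝ, Model n) x₀).symm y with hx
  have hy' : y ∈ transitionSource n x₀ x := ⟨hy, mem_extChartAt_source x⟩
  have h := ricci_isometry (φ := transition x₀ x)
    ((isRiemannianOn_chartMetric g x₀).mono (isOpen_transitionSource x₀ x) Set.inter_subset_left)
    (isRiemannianOn_chartMetric g x)
    (fun z hz => ⟨transition_mem_target hz, contDiffAt_transition hz,
      fun v w => chartMetric_transition g hz v w⟩)
    (fun z hz => fderiv_transition_surjective g hz) hy' v w
  rw [h, chartMetric_transition g hy']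
  refine (hc _ _).trans ?_
  rw [← chartMetric_self]
  rfl

/-- Schur's lemma. -/
theorem isEinstein_of_pointwise [ConnectedSpace M] (g : Metric n M) (hn : 3 ≤ n)
    (h : ∀ x : M, ∃ c : ℝ, ∀ v w, ricci g x v w = c * g.inner x v w) : IsEinstein g := by
  choose c hc using h
  have hloc : IsLocallyConstant c := by
    rw [IsLocallyConstant.iff_eventually_eq]
    intro x₀
    set y₀ := extChartAt 𝓘(ℝ, Model n) x₀ x₀
    have hG := isRiemannianOn_chartMetric g x₀
    set f : Model n → ℝ := fun y => c ((extChartAt 𝓘(ℝ, Model n) x₀).symm y)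
    have hf : ∀ y ∈ (extChartAt 𝓘(ℝ, Model n) x₀).target, ∀ v w,
        ∑ a, EuclideanSpace.proj (𝕜 := ℝ) a
          (localCurvature (chartMetric g x₀) y (frame a) v w) = f y * chartMetric g x₀ y v w :=
      fun y hy v w => sum_localCurvature_chartMetric g hy (hc _) v w
    let v₀ : Model n := frame ⟨0, by omega⟩
    have hv₀ : v₀ ≠ 0 := by
      intro h0
      have := congrArg (fun u : Model n => u ⟨0, by omega⟩) h0
      simp [v₀, frame] at this
    have hd : ∀ y ∈ (extChartAt 𝓘(ℝ, Model n) x₀).target, DifferentiableAt ℝ f y := by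
      intro y hy
      -- The factor c was chosen point by point; it is differentiable because locally it is Ric(v₀,
      -- v₀) / g(v₀, v₀).
      have h1 : DifferentiableAt ℝ (fun y => (∑ a, EuclideanSpace.proj (𝕜 := ℝ) a
          (localCurvature (chartMetric g x₀) y (frame a) v₀ v₀)) *
            (chartMetric g x₀ y v₀ v₀)⁻¹) y := by
        refine DifferentiableAt.fun_mul ?_ (DifferentiableAt.fun_inv ?_ (hG.pos y hy v₀ hv₀).ne')
        · refine DifferentiableAt.fun_sum fun a _ => ?_
          obtain ⟨L, hL, -⟩ := hasFDerivAt_localCurvature hG hy (frame a) v₀ v₀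
          exact ((EuclideanSpace.proj (𝕜 := ℝ) a : Model n →L[ℝ] ℝ).hasFDerivAt.comp y
            hL).differentiableAt
        · exact ((contDiffOn_chartMetric_apply g x₀ v₀ v₀).contDiffAt
            (hG.isOpen.mem_nhds hy)).differentiableAt (by simp)
      refine h1.congr_of_eventuallyEq ?_
      filter_upwards [hG.isOpen.mem_nhds hy] with z hz
      rw [hf z hz, mul_inv_cancel_right₀ (hG.pos z hz v₀ hv₀).ne']
    obtain ⟨r, hr, hball⟩ := Metric.isOpen_iff.1 hG.isOpen y₀ (mem_extChartAt_target x₀)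
    have hconst : ∀ y ∈ Metric.ball y₀ r, f y = f y₀ := fun y hy =>
      (convex_ball y₀ r).is_const_of_fderivWithin_eq_zero (𝕜 := ℝ)
        (fun z hz => (hd z (hball hz)).differentiableWithinAt)
        (fun z hz => by
          rw [fderivWithin_of_isOpen Metric.isOpen_ball hz]
          exact fderiv_eq_zero_of_einstein hG (hball hz) hn (hd z (hball hz)) hf)
        hy (Metric.mem_ball_self hr)
    filter_upwards [(continuousAt_extChartAt x₀).preimage_mem_nhds (Metric.ball_mem_nhds y₀ hr),
      extChartAt_source_mem_nhds (I := 𝓘(ℝ, Model n)) x₀] with x hx hxs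
    have := hconst _ hx
    simp only [f, y₀] at this
    rwa [(extChartAt 𝓘(ℝ, Model n) x₀).left_inv hxs, extChartAt_to_inv] at this
  obtain ⟨x₀⟩ := (inferInstance : Nonempty M)
  refine ⟨c x₀, fun x v w => ?_⟩
  rw [hc, hloc.apply_eq_of_preconnectedSpace x x₀]

end Transition

/-! ### Pullbacks and symmetric products of forms -/

section Pullback

variable {V W : Type*} [AddCommGroup V] [Module ℝ V] [AddCommGroup W] [Module ℝ W] {p q : ℕ}

/-- The pullback of a double form by a linear map. -/
def pullback (w : DoubleForm p q W) (f : V →ₗ[ℝ] W) : DoubleForm p q V :=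
  LinearMap.compAlternatingMap
    ({ toFun := fun a => a.compLinearMap f, map_add' := fun _ _ => rfl,
       map_smul' := fun _ _ => rfl } : (W [⋀^Fin q]→ₗ[ℝ] ℝ) →ₗ[ℝ] (V [⋀^Fin q]→ₗ[ℝ] ℝ))
    (w.compLinearMap f)

/-- The symmetrization `α ⊗ β + β ⊗ α`. -/
def symmTensor (α β : V [⋀^Fin p]→ₗ[ℝ] ℝ) : DoubleForm p p V :=
  (LinearMap.toSpanSingleton ℝ _ β).compAlternatingMap α +
    (LinearMap.toSpanSingleton ℝ _ α).compAlternatingMap β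

theorem symmTensor_apply (α β : V [⋀^Fin p]→ₗ[ℝ] ℝ) (Y Z : Fin p → V) :
    symmTensor α β Y Z = α Y * β Z + β Y * α Z :=
  rfl

theorem symmTensor_comm (α β : V [⋀^Fin p]→ₗ[ℝ] ℝ) (Y Z : Fin p → V) :
    symmTensor α β Y Z = symmTensor α β Z Y := by
  rw [symmTensor_apply, symmTensor_apply]
  ring

end Pullback

/-- In coordinates a multilinear form is a polynomial. -/
theorem MultilinearMap.contDiff_model {n : ℕ} {ι : Type*} [Fintype ι]
    (f : MultilinearMap ℝ (fun _ : ι => Model n) ℝ) :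
    ContDiff ℝ ∞ (f : (ι → Model n) → ℝ) := by
  classical
  have h : (f : (ι → Model n) → ℝ) = fun Y => ∑ r : ι → Fin n,
      (∏ i, EuclideanSpace.proj (𝕜 := ℝ) (r i) (Y i)) * f fun i => frame (r i) := by
    ext Y
    conv_lhs => rw [show Y = fun i => ∑ b, Y i b • (frame b : Model n) from
      funext fun i => (sum_smul_frame (Y i)).symm]
    rw [MultilinearMap.map_sum]
    refine Finset.sum_congr rfl fun r _ => ?_
    rw [MultilinearMap.map_smul_univ, smul_eq_mul]
    rfl
  rw [h]
  refine ContDiff.sum fun r _ => ContDiff.mul (contDiff_prod fun i _ => ?_) contDiff_const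
  exact (EuclideanSpace.proj (𝕜 := ℝ) (r i) : Model n →L[ℝ] ℝ).contDiff.comp
    (contDiff_apply ℝ (Model n) i)

/-! ### The Laplacian on the manifold and test forms -/

section Laplacian

set_option maxSynthPendingDepth 5

variable {n : ℕ} {M : Type*} [TopologicalSpace M] [ChartedSpace (Model n) M]
  [IsManifold 𝓘(ℝ, Model n) ∞ M]

/-- The metric at a point as a bilinear form on the model space. -/
def innerForm (g : Metric n M) (x : M) : LinearMap.BilinForm ℝ (Model n) :=
  metricForm (chartMetric g x) (extChartAt 𝓘(ℝ, Model n) x x)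

/-- The curvature endomorphisms at a point, on the model space. -/
def modelCurvature (g : Metric n M) (x : M) : Model n → Model n → Model n → Model n :=
  localCurvature (chartMetric g x) (extChartAt 𝓘(ℝ, Model n) x x)

theorem innerForm_apply (g : Metric n M) (x : M) (v w : Model n) :
    innerForm g x v w = g.inner x v w :=
  chartMetric_self g x v w

theorem isInner_innerForm (g : Metric n M) (x : M) : IsInner (innerForm g x) :=
  isInner_metricForm (isRiemannianOn_chartMetric g x) (mem_extChartAt_target x)

theorem laplacian_sub_transpose (g : Metric n M) {p : ℕ}
    {θ : ∀ x : M, DoubleForm (p + 1) (p + 1) (TangentSpace 𝓘(ℝ, Model n) x)} (hθ : IsSmooth θ)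
    (hs : ∀ x, transpose (fun Y Z => θ x Y Z) = fun Y Z => θ x Y Z) (x : M)
    {e : Fin n → Model n} (he : IsFrame (innerForm g x) e) (Y Z : Fin (p + 1) → Model n) :
    laplacian g θ x Y Z - laplacian g θ x Z Y =
      weitzenbock (modelCurvature g x) e
        (fun Y => inChart θ x (extChartAt 𝓘(ℝ, Model n) x x) Y Z) Y -
      weitzenbock (modelCurvature g x) e
        (fun Z => inChart θ x (extChartAt 𝓘(ℝ, Model n) x x) Z Y) Z :=
  localLaplacian_sub_transpose (isRiemannianOn_chartMetric g x) (mem_extChartAt_target x) he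
    (Θ := fun y => pullback (θ ((extChartAt 𝓘(ℝ, Model n) x).symm y))
      (chartFrame x y).toLinearMap) (hθ x)
    (fun y _ _ => congrFun₂ (hs ((extChartAt 𝓘(ℝ, Model n) x).symm y)) _ _ |>.symm) Y Z

theorem inChart_self {p q : ℕ} (θ : ∀ x : M, DoubleForm p q (TangentSpace 𝓘(ℝ, Model n) x))
    (x : M) (Y : Fin p → Model n) (Z : Fin q → Model n) :
    inChart θ x (extChartAt 𝓘(ℝ, Model n) x x) Y Z = θ x Y Z := by
  have h : ∀ x' : M, x = x' → ((θ x' : DoubleForm p q (Model n)) Y Z) = θ x Y Z := by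
    intro x' h
    subst h
    rfl
  refine Eq.trans ?_ (h _ (extChartAt_to_inv (I := 𝓘(ℝ, Model n)) x).symm)
  unfold inChart
  have hY : (fun i => (chartFrame x (extChartAt 𝓘(ℝ, Model n) x x) (Y i) : Model n)) = Y :=
    funext fun i => chartFrame_self x (Y i)
  have hZ : (fun i => (chartFrame x (extChartAt 𝓘(ℝ, Model n) x x) (Z i) : Model n)) = Z :=
    funext fun i => chartFrame_self x (Z i)
  exact congrArg₂ (fun Y Z => (θ ((extChartAt 𝓘(ℝ, Model n) x).symm
    (extChartAt 𝓘(ℝ, Model n) x x)) : DoubleForm p q (Model n)) Y Z) hY hZ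

/-- If W is scalar at x, both one-sided operators multiply θ by the same number, and their
difference is zero. The scalar may vary with x. -/
theorem laplacianPreservesSymmetric_of_weitzenbock (g : Metric n M) {p : ℕ}
    (h : ∀ x, ∀ e : Fin n → Model n, IsFrame (innerForm g x) e →
      ∃ c : ℝ, ∀ (w : Model n [⋀^Fin (p + 1)]→ₗ[ℝ] ℝ) (Y : Fin (p + 1) → Model n),
        weitzenbock (modelCurvature g x) e w Y = c * w Y) :
    LaplacianPreservesSymmetric g (p + 1) := by
  intro θ hθ hs x
  obtain ⟨e, he⟩ := (isInner_innerForm g x).exists_frame (n := n) (by simp)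
  obtain ⟨c, hc⟩ := h x e he
  refine funext fun (Y : Fin (p + 1) → Model n) => funext fun (Z : Fin (p + 1) → Model n) => ?_
  refine eq_of_sub_eq_zero ((laplacian_sub_transpose g hθ hs x he Z Y).trans ?_)
  have h1 := hc (evalRight (θ x : DoubleForm _ _ (Model n)) Y) Z
  have h2 := hc (evalRight (θ x : DoubleForm _ _ (Model n)) Z) Y
  simp only [inChart_self]
  rw [sub_eq_zero]
  refine h1.trans (Eq.trans ?_ h2.symm)
  exact congrArg (c * ·) (congrFun₂ (hs x) Y Z)

section TestForms

variable {p : ℕ} (x₀ : M) (α β : Model n [⋀^Fin p]→ₗ[ℝ] ℝ)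

/-- The double form `α ⊗ β + β ⊗ α`, transported by the chart at `x₀` and cut off. -/
def testForm (ρ : SmoothBumpFunction 𝓘(ℝ, Model n) x₀) (x : M) :
    DoubleForm p p (TangentSpace 𝓘(ℝ, Model n) x) :=
  ρ x • pullback (symmTensor α β) (mfderiv 𝓘(ℝ, Model n) 𝓘(ℝ, Model n)
    (extChartAt 𝓘(ℝ, Model n) x₀) x).toLinearMap

omit [IsManifold 𝓘(ℝ, Model n) ∞ M] in
theorem transpose_testForm (ρ : SmoothBumpFunction 𝓘(ℝ, Model n) x₀) (x : M) :
    transpose (fun Y Z => testForm x₀ α β ρ x Y Z) = fun Y Z => testForm x₀ α β ρ x Y Z := by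
  funext Y Z
  exact congrArg (ρ x * ·) (symmTensor_comm α β _ _)

theorem inChart_testForm (ρ : SmoothBumpFunction 𝓘(ℝ, Model n) x₀) {x : M} {y : Model n}
    (hy : y ∈ transitionSource n x x₀) (Y Z : Fin p → Model n) :
    inChart (testForm x₀ α β ρ) x y Y Z = ρ ((extChartAt 𝓘(ℝ, Model n) x).symm y) *
      (α (fun i => fderiv ℝ (transition x x₀) y (Y i)) *
        β (fun i => fderiv ℝ (transition x x₀) y (Z i)) +
      β (fun i => fderiv ℝ (transition x x₀) y (Y i)) *
        α (fun i => fderiv ℝ (transition x x₀) y (Z i))) := by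
  simp only [fderiv_transition hy]
  rfl

theorem contDiffAt_alternating_fderiv (γ : Model n [⋀^Fin p]→ₗ[ℝ] ℝ) {φ : Model n → Model n}
    {y : Model n} (hφ : ContDiffAt ℝ ∞ φ y) (Y : Fin p → Model n) :
    ContDiffAt ℝ ∞ (fun y => γ fun i => fderiv ℝ φ y (Y i)) y :=
  (MultilinearMap.contDiff_model γ.toMultilinearMap).contDiffAt.comp y <|
    contDiffAt_pi.2 fun i => (hφ.fderiv_right (m := ∞) (by simp)).clm_apply contDiffAt_const

theorem isSmooth_testForm [T2Space M] (ρ : SmoothBumpFunction 𝓘(ℝ, Model n) x₀) :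
    IsSmooth (testForm x₀ α β ρ) := by
  intro x Y Z y hy
  refine ContDiffAt.contDiffWithinAt ?_
  have hρ : ContDiffAt ℝ ∞ (fun y => ρ ((extChartAt 𝓘(ℝ, Model n) x).symm y)) y :=
    (contMDiffOn_iff_contDiffOn.1 (ρ.contMDiff.comp_contMDiffOn
      (contMDiffOn_extChartAt_symm x))).contDiffAt ((isOpen_extChartAt_target x).mem_nhds hy)
  by_cases h : (extChartAt 𝓘(ℝ, Model n) x).symm y ∈ (extChartAt 𝓘(ℝ, Model n) x₀).source
  · have hy' : y ∈ transitionSource n x x₀ := ⟨hy, h⟩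
    have hφ := contDiffAt_transition hy'
    refine ContDiffAt.congr_of_eventuallyEq (hρ.mul
      (((contDiffAt_alternating_fderiv α hφ Y).mul (contDiffAt_alternating_fderiv β hφ Z)).add
      ((contDiffAt_alternating_fderiv β hφ Y).mul (contDiffAt_alternating_fderiv α hφ Z)))) ?_
    filter_upwards [(isOpen_transitionSource x x₀).mem_nhds hy'] with z hz
    exact inChart_testForm x₀ α β ρ hz Y Z
  -- Outside the domain of the chart at x₀ the form vanishes near the point, because the closed
  -- support of ρ lies in that domain.
  · have h0 : (extChartAt 𝓘(ℝ, Model n) x).symm y ∈ (tsupport ρ)ᶜ :=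
      fun h' => h (ρ.tsupport_subset_extChartAt_source h')
    refine ContDiffAt.congr_of_eventuallyEq (contDiffAt_const (c := (0 : ℝ))) ?_
    filter_upwards [(continuousAt_extChartAt_symm'' hy).preimage_mem_nhds
      ((isClosed_tsupport ρ).isOpen_compl.mem_nhds h0)] with z hz
    have hz0 : ρ ((extChartAt 𝓘(ℝ, Model n) x).symm z) = 0 := image_eq_zero_of_notMem_tsupport hz
    exact (congrArg (· * _) hz0).trans (zero_mul _)

end TestForms

/-- The test form centred at x is α⊗β + β⊗α at x: there ρ is 1 and the change of charts has identity
differential. The asymmetry of its Laplacian depends only on this value. -/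
theorem weitzenbockSymmetric_of_laplacianPreservesSymmetric [T2Space M] (g : Metric n M) {p : ℕ}
    (h : LaplacianPreservesSymmetric g (p + 1)) (x : M) {e : Fin n → Model n}
    (he : IsFrame (innerForm g x) e) :
    WeitzenbockSymmetric (modelCurvature g x) e (p + 1) := by
  intro α β Y Z
  let ρ : SmoothBumpFunction 𝓘(ℝ, Model n) x := Classical.arbitrary _
  have h1 := laplacian_sub_transpose g (isSmooth_testForm x α β ρ) (transpose_testForm x α β ρ) x
    he Y Z
  have h2 : laplacian g (testForm x α β ρ) x Y Z = laplacian g (testForm x α β ρ) x Z Y :=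
    congrFun₂ (h _ (isSmooth_testForm x α β ρ) (transpose_testForm x α β ρ) x) Z Y
  have hy : extChartAt 𝓘(ℝ, Model n) x x ∈ transitionSource n x x :=
    ⟨mem_extChartAt_target x, by
      rw [Set.mem_preimage, extChartAt_to_inv]; exact mem_extChartAt_source x⟩
  have hd : ∀ v, fderiv ℝ (transition x x) (extChartAt 𝓘(ℝ, Model n) x x) v = v := fun v => by
    rw [fderiv_transition hy]
    exact mfderiv_extChartAt_chartFrame hy.1 v
  have h3 : ∀ Y Z : Fin (p + 1) → Model n,
      inChart (testForm x α β ρ) x (extChartAt 𝓘(ℝ, Model n) x x) Y Z =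
        α Y * β Z + β Y * α Z := fun Y Z => by
    rw [inChart_testForm x α β ρ hy, extChartAt_to_inv, ρ.eq_one, one_mul]
    simp only [hd]
  simp only [h3, weitzenbock_add, weitzenbock_mul] at h1
  linarith

end Laplacian

/-! ### The characterization -/

section Characterization

variable {n : ℕ} {M : Type*} [TopologicalSpace M] [ChartedSpace (Model n) M]
  [IsManifold 𝓘(ℝ, Model n) ∞ M] (g : Metric n M)

theorem isCurvatureForm_modelCurvature (x : M) :
    IsCurvatureForm fun v w z u => innerForm g x (modelCurvature g x v w u) z :=
  isCurvatureForm_local (isRiemannianOn_chartMetric g x) (mem_extChartAt_target x)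

theorem innerForm_modelCurvature (x : M) (v w z u : Model n) :
    innerForm g x (modelCurvature g x v w u) z = riemann g x v w z u :=
  innerForm_apply g x _ _

theorem exists_ricciForm (x : M) : ∃ ric : LinearMap.BilinForm ℝ (Model n),
    (∀ v w, ric v w = ricci g x v w) ∧ ∀ e : Fin n → Model n, IsFrame (innerForm g x) e →
      ∀ v w, ric v w = ∑ a, innerForm g x (modelCurvature g x v (e a) (e a)) w := by
  have hg := isInner_innerForm g x
  have hT := isCurvatureForm_modelCurvature g x
  obtain ⟨e, he⟩ := hg.exists_frame (n := n) (by simp)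
  refine ⟨ricciForm hT e, fun v w => ?_, fun e' he' v w => ricciForm_eq hg hT he he' v w⟩
  exact (ricciForm_eq hg hT he he v w).trans (sum_localCurvature
    (isRiemannianOn_chartMetric g x) (mem_extChartAt_target x) he v w).symm

theorem ricci_eq_zero_of_le_one (hn : n ≤ 1) (x : M) (v w : Model n) : ricci g x v w = 0 := by
  obtain ⟨ric, h1, h2⟩ := exists_ricciForm g x
  obtain ⟨e, he⟩ := (isInner_innerForm g x).exists_frame (n := n) (by simp)
  have hT := isCurvatureForm_modelCurvature g x
  have : Subsingleton (Fin n) := Fin.subsingleton_iff_le_one.2 hn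
  refine (h1 v w).symm.trans ?_
  rw [h2 e he]
  refine Finset.sum_eq_zero fun a _ => ?_
  have hv := he.sum v
  rw [Fintype.sum_subsingleton _ a] at hv
  rw [← hv, hT.smul, hT.self_left, mul_zero]

theorem ricci_of_kulkarniNomizu (x : M) {c : ℝ}
    (hR : ∀ v w z u, innerForm g x (modelCurvature g x v w u) z = kulkarniNomizu
      (fun a b => innerForm g x a b) (fun a b => c * innerForm g x a b) v w z u) (v w : Model n) :
    ricci g x v w = 2 * (n - 1) * c * g.inner x v w := by
  obtain ⟨ric, h1, h2⟩ := exists_ricciForm g x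
  have hg := isInner_innerForm g x
  obtain ⟨e, he⟩ := hg.exists_frame (n := n) (by simp)
  refine (h1 v w).symm.trans ?_
  have hs : ∑ a, innerForm g x v (e a) * innerForm g x (e a) w = innerForm g x v w := by
    conv_rhs => rw [← he.sum v]
    simp
  rw [h2 e he, ← innerForm_apply]
  have : ∀ a, innerForm g x (modelCurvature g x v (e a) (e a)) w =
      2 * c * innerForm g x v w - 2 * c * (innerForm g x v (e a) * innerForm g x (e a) w) := by
    intro a
    rw [hR, kulkarniNomizu, he.apply, if_pos rfl]
    ring
  rw [Finset.sum_congr rfl fun a _ => this a, Finset.sum_sub_distrib, ← Finset.mul_sum,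
    ← Finset.mul_sum, hs]
  simp
  ring

theorem isConformallyFlat_of_forall (h : ∀ x : M, ∃ h : LinearMap.BilinForm ℝ (Model n),
    (∀ v w, h v w = h w v) ∧ ∀ v w z u, innerForm g x (modelCurvature g x v w u) z =
      kulkarniNomizu (fun a b => innerForm g x a b) (fun a b => h a b) v w z u) :
    IsConformallyFlat g := by
  intro x
  obtain ⟨h, h1, h2⟩ := h x
  refine ⟨h, h1, fun v w z u => ?_⟩
  have := h2 v w z u
  simp only [innerForm_apply g x] at this
  exact (innerForm_modelCurvature g x v w z u).symm.trans this

theorem hasConstantSectionalCurvature_of_forall [ConnectedSpace M] (hn : 3 ≤ n)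
    (h : ∀ x : M, ∃ c : ℝ, ∀ v w z u, innerForm g x (modelCurvature g x v w u) z =
      kulkarniNomizu (fun a b => innerForm g x a b) (fun a b => c * innerForm g x a b) v w z u) :
    HasConstantSectionalCurvature g := by
  choose c hc using h
  obtain ⟨C, hC⟩ := isEinstein_of_pointwise g hn
    fun x => ⟨_, fun v w => ricci_of_kulkarniNomizu g x (hc x) v w⟩
  have hn' : (3 : ℝ) ≤ n := by exact_mod_cast hn
  -- R = g·(c g) has sectional curvature 2c and Ric = 2(n − 1)c g; Schur's lemma makes the latter
  -- factor the constant C.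
  refine ⟨C / (n - 1), fun x (v : Model n) (w : Model n) hvw => ?_⟩
  have hpos := (isInner_innerForm g x).gram_pos hvw
  have hv : 0 < innerForm g x v v := (isInner_innerForm g x).pos v (hvw.ne_zero 0)
  have hcx : 2 * ((n : ℝ) - 1) * c x = C := by
    have := (ricci_of_kulkarniNomizu g x (hc x) v v).symm.trans (hC x v v)
    rw [← innerForm_apply] at this
    exact mul_right_cancel₀ hv.ne' this
  have hK := hc x v w v w
  rw [innerForm_modelCurvature, kulkarniNomizu] at hK
  simp only [innerForm_apply] at hK hpos
  refine (div_eq_iff hpos.ne').2 ?_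
  refine hK.trans ?_
  rw [← hcx, (g.symm x w v : g.inner x w v = g.inner x v w)]
  have : (n : ℝ) - 1 ≠ 0 := by linarith
  field_simp
  ring

theorem conditions_of_laplacianPreservesSymmetric [T2Space M] [ConnectedSpace M] {p : ℕ}
    (hp : p = 1 ∨ (2 ≤ p ∧ p + 2 ≤ n) ∨ (p = 2 ∧ n = 3)) (h : LaplacianPreservesSymmetric g p) :
    (p = 1 ∧ IsEinstein g) ∨ (n = 2 * p ∧ IsConformallyFlat g) ∨
      (1 < p ∧ n ≠ 2 * p ∧ HasConstantSectionalCurvature g) := by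
  have hW : ∀ x, ∀ e : Fin n → Model n, IsFrame (innerForm g x) e →
      WeitzenbockSymmetric (modelCurvature g x) e p := by
    obtain ⟨q, rfl⟩ : ∃ q, p = q + 1 := ⟨p - 1, by omega⟩
    exact fun x e he => weitzenbockSymmetric_of_laplacianPreservesSymmetric g h x he
  by_cases hp1 : p = 1
  · subst hp1
    have hric : ∀ x, ∃ c : ℝ, ∀ v w : Model n, ricci g x v w = c * g.inner x v w := fun x => by
      obtain ⟨ric, h1, h2⟩ := exists_ricciForm g x
      obtain ⟨c, hc⟩ := exists_ricci_eq_of_weitzenbock_one (isInner_innerForm g x)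
        (isCurvatureForm_modelCurvature g x) h2 (by simp) (hW x)
      exact ⟨c, fun v w => by rw [← innerForm_apply, ← hc]; exact (h1 v w).symm⟩
    -- Schur's lemma needs n ≥ 3. For n ≤ 1 Ric is zero, and for n = 2 = 2p the second condition is
    -- the one that holds.
    rcases Nat.lt_or_ge n 3 with hn | hn
    · rcases Nat.lt_or_ge n 2 with hn' | hn'
      · exact Or.inl ⟨rfl, 0, fun x v w => by
          rw [zero_mul]; exact ricci_eq_zero_of_le_one g (by omega) x v w⟩
      · have hn2 : n = 2 := by omega
        refine Or.inr (Or.inl ⟨hn2, isConformallyFlat_of_forall g fun x => ?_⟩)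
        obtain ⟨ric, h1, h2⟩ := exists_ricciForm g x
        obtain ⟨c, hc⟩ := hric x
        exact ⟨(c / 2) • innerForm g x, fun v w => by simp [(isInner_innerForm g x).symm v w],
          kulkarniNomizu_of_einstein_two (isInner_innerForm g x)
            (isCurvatureForm_modelCurvature g x) h2 (by simp) hn2
            (fun v w => by rw [innerForm_apply, ← hc]; exact h1 v w)⟩
    · exact Or.inl ⟨rfl, isEinstein_of_pointwise g hn hric⟩
  · have hp' : (2 ≤ p ∧ p + 2 ≤ n) ∨ (p = 2 ∧ n = 3) := hp.resolve_left hp1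
    have hR : ∀ x, ∃ h : LinearMap.BilinForm ℝ (Model n), (∀ v w, h v w = h w v) ∧
        (∀ v w z u, innerForm g x (modelCurvature g x v w u) z =
          kulkarniNomizu (fun a b => innerForm g x a b) (fun a b => h a b) v w z u) ∧
        (n ≠ 2 * p → ∃ c : ℝ, ∀ v w, h v w = c * innerForm g x v w) := fun x => by
      obtain ⟨ric, -, h2⟩ := exists_ricciForm g x
      exact exists_kulkarniNomizu_of_weitzenbock (isInner_innerForm g x)
        (isCurvatureForm_modelCurvature g x) h2 (hW x) (by simp) hp'
    by_cases hn : n = 2 * p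
    · exact Or.inr <| Or.inl ⟨hn, isConformallyFlat_of_forall g fun x =>
        (hR x).imp fun h hh => ⟨hh.1, hh.2.1⟩⟩
    · refine Or.inr <| Or.inr ⟨by omega, hn,
        hasConstantSectionalCurvature_of_forall g (by omega) fun x => ?_⟩
      obtain ⟨h, -, h2, h3⟩ := hR x
      obtain ⟨c, hc⟩ := h3 hn
      simp only [hc] at h2
      exact ⟨c, h2⟩

theorem laplacianPreservesSymmetric_one_of_isEinstein (h : IsEinstein g) :
    LaplacianPreservesSymmetric g 1 := by
  obtain ⟨c, hc⟩ := h
  refine laplacianPreservesSymmetric_of_weitzenbock g fun x e he => ⟨c, fun w Y => ?_⟩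
  obtain ⟨ric, h1, h2⟩ := exists_ricciForm g x
  exact exists_weitzenbock_eq_of_einstein (isInner_innerForm g x) h2 he
    (fun v w => by rw [innerForm_apply, h1]; exact hc x v w) w Y

theorem laplacianPreservesSymmetric_of_isConformallyFlat {p : ℕ} (hn : n = 2 * (p + 1))
    (h : IsConformallyFlat g) : LaplacianPreservesSymmetric g (p + 1) := by
  refine laplacianPreservesSymmetric_of_weitzenbock g fun x e he => ?_
  obtain ⟨k, h1, h2⟩ := h x
  refine exists_weitzenbock_eq_of_kulkarniNomizu (isInner_innerForm g x) he
    (h := (k : LinearMap.BilinForm ℝ (Model n))) h1 (fun v w z u => ?_) (Or.inl hn)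
  rw [innerForm_modelCurvature]
  simp only [innerForm_apply]
  exact h2 v w z u

theorem laplacianPreservesSymmetric_of_hasConstantSectionalCurvature {p : ℕ}
    (h : HasConstantSectionalCurvature g) : LaplacianPreservesSymmetric g (p + 1) := by
  obtain ⟨K, hK⟩ := h
  refine laplacianPreservesSymmetric_of_weitzenbock g fun x e he => ?_
  have hg := isInner_innerForm g x
  refine exists_weitzenbock_eq_of_kulkarniNomizu hg he
    (h := (K / 2) • innerForm g x) (fun v w => by simp [hg.symm v w])
    (kulkarniNomizu_of_sectional hg (isCurvatureForm_modelCurvature g x) fun v w hvw => ?_)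
    (Or.inr ⟨K / 2, fun v w => by simp⟩)
  rw [innerForm_modelCurvature]
  simp only [innerForm_apply]
  exact hK x v w hvw

end Characterization

end DoubleForms

end

theorem mainTheorem10 {n : ℕ} {M : Type*} [TopologicalSpace M] [T2Space M] [ConnectedSpace M]
    [ChartedSpace (Model n) M] [IsManifold 𝓘(ℝ, Model n) ∞ M] (g : Metric n M) (p : ℕ)
    (hp : p = 1 ∨ (2 ≤ p ∧ p + 2 ≤ n) ∨ (p = 2 ∧ n = 3)) :
    LaplacianPreservesSymmetric g p ↔
      (p = 1 ∧ IsEinstein g) ∨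
      (n = 2 * p ∧ IsConformallyFlat g) ∨
      (1 < p ∧ n ≠ 2 * p ∧ HasConstantSectionalCurvature g) := by
  refine ⟨conditions_of_laplacianPreservesSymmetric g hp, ?_⟩
  -- All admissible p are positive, so Δ is given by the successor case of `localLaplacian`.
  obtain ⟨q, rfl⟩ : ∃ q, p = q + 1 := ⟨p - 1, by omega⟩
  rintro (⟨hq, h⟩ | ⟨hn, h⟩ | ⟨-, -, h⟩)
  · obtain rfl : q = 0 := by omega
    exact laplacianPreservesSymmetric_one_of_isEinstein g h
  · exact laplacianPreservesSymmetric_of_isConformallyFlat g hn h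
  · exact laplacianPreservesSymmetric_of_hasConstantSectionalCurvature g h
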